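/- Let $k$ be a field of characteristic $0$. \textbf{The categories $\mathcal Z(G,\alpha)$.} For a finite group $G$ and a normalised 3-cocycle $\alpha\in Z^3(G,k^*)$, i.e. $\alpha(g,h,l)\,\alpha(f,gh,l)\,\alpha(f,g,h)=\alpha(fg,h,l)\,\alpha(f,g,hl)$, put, with ${}^fh=fhf^{-1}$, $$\alpha(f,g|h)=\alpha(f,g,h)^{-1}\alpha(f,{}^gh,g)\,\alpha({}^{fg}h,f,g)^{-1},\qquad \alpha(f|g,h)=\alpha(f,g,h)\,\alpha({}^fg,f,h)^{-1}\alpha({}^fg,{}^fh,f).$$ Objects of $\mathcal Z(G,\alpha)$ are finite-dimensional $G$-graded $k$-vector spaces $V=\bigoplus_g V_g$ with automorphisms $v\mapsto f.v$ ($f\in G$) such that $f.V_g=V_{{}^fg}$ and $(fg).v=\alpha(f,g|h)\,f.(g.v)$ for $v\in V_h$; morphisms are the linear maps that preserve the grading and the action. The tensor product is that of graded vector spaces with $f.(x\otimes y)=\alpha(f|g,h)\,f.x\otimes f.y$ for $x\in X_g,\ y\in Y_h$; the associativity constraint is $x\otimes(y\otimes z)\mapsto\alpha(f,g,h)\,(x\otimes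 y)\otimes z$ for $x\in X_f,\ y\in Y_g,\ z\in Z_h$; the braiding is $x\otimes y\mapsto f.y\otimes x$ for $x\in X_f$; the twist is $\theta_X(x)=f.x$ for $x\in X_f$. \textbf{The algebra.} Let $H$ be a finite group, $\alpha\in Z^3(H,k^*)$ a normalised 3-cocycle and $F\vartriangleleft H$ a normal subgroup. Let $\gamma:F\times F\to k^*$ with $\gamma(1,f)=\gamma(f,1)=1$ and $\varepsilon:H\times F\to k^*$, $(h,f)\mapsto\varepsilon_h(f)$, satisfy $$\gamma(g,h)\gamma(f,gh)=\alpha(f,g,h)\gamma(f,g)\gamma(fg,h)\quad(f,g,h\in F),$$ $$\varepsilon_{gh}(f)=\alpha(g,h|f)\,\varepsilon_g({}^hf)\,\varepsilon_h(f)\quad(g,h\in H,\ f\in F),$$ $$\gamma(f,g)\,\varepsilon_h(fg)=\alpha(h|f,g)\,\varepsilon_h(f)\varepsilon_h(g)\,\gamma({}^hf,{}^hg)\quad(h\in H,\ f,g\in F),$$ $$\gamma(f,g)=\varepsilon_f(g)\,\gamma({}^fg,f)\quad(f,g\in F).$$ Let $A=k[F,\gamma,\varepsilon]$ be the commutative algebra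 in $\mathcal Z(H,\alpha)$ with basis $e_f$ ($f\in F$) in degrees $f$, product $e_fe_g=\gamma(f,g)e_{fg}$, unit $e_1$ and action $h.e_f=\varepsilon_h(f)e_{{}^hf}$. \textbf{Local modules.} A (unital) right $A$-module $M$ in $\mathcal Z(H,\alpha)$ is local if its action $M\otimes A\to M$ is unchanged by precomposition with the double braiding $M\otimes A\to A\otimes M\to M\otimes A$. The category $\mathcal Z(H,\alpha)^{\mathrm{loc}}_A$ of local right $A$-modules and $A$-linear morphisms is a braided monoidal category under the relative tensor product $\otimes_A$, with unit $A$ and the braiding induced by that of $\mathcal Z(H,\alpha)$. \textbf{The reduced cochain.} Let $s:H/F\to H$ be a section of the quotient map with $s(1)=1$, and put $\tau(x,y)=s(y)^{-1}s(x)^{-1}s(xy)\in F$. For $x,y,z\in H/F$ put $$a=\tau(y,z),\quad b=\tau(x,yz),\quad c=\tau(x,y),\quad d=\tau(xy,z),\quad h=s(xy)^{-1}s(xyz),\quad c'=h^{-1}ch,$$ and $$\overline\alpha(x,y,z)=\frac{\alpha\big(s(x),s(y),s(y)^{-1}s(x)^{-1}s(xyz)\big)\;\gamma(a,b)\;\varepsilon_h(c')\;\alpha\big(s(x)s(y),c,h\big)\;\alpha\big(s(z),d,c'\big)}{\gamma(d,c')\;\alpha\big(s(z),a,b\big)\;\alpha\big(s(y),s(z)a,b\big)\;\alpha\big(s(x),s(y),c\big)}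 .$$ \textbf{Theorem.} The function $\overline\alpha$ is a normalised 3-cocycle of $H/F$. The twist $\theta$ of $\mathcal Z(H,\alpha)$ restricts to a twist of $\mathcal Z(H,\alpha)^{\mathrm{loc}}_A$; with these twists both $\mathcal Z(H,\alpha)^{\mathrm{loc}}_A$ and $\mathcal Z(H/F,\overline\alpha)$ are ribbon categories, i.e. they are rigid, and $\theta$ is a natural automorphism of the identity functor with $\theta_{X\otimes Y}=(\theta_X\otimes\theta_Y)\,c_{Y,X}\,c_{X,Y}$ and $\theta_{X^\vee}=(\theta_X)^\vee$. There is an equivalence of ribbon categories $$\mathcal Z(H,\alpha)^{\mathrm{loc}}_{k[F,\gamma,\varepsilon]}\;\simeq\;\mathcal Z(H/F,\overline\alpha),$$ that is, a $k$-linear braided monoidal equivalence that takes the twist of the source to the twist of the target. -/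

import Mathlib

set_option linter.unusedSectionVars false
set_option linter.unusedSimpArgs false

universe u v

open CategoryTheory MonoidalCategory

/-- Normalised 3-cocycles of a group `G` with values in the multiplicative group `kˣ`. -/
structure Cocycle3 (k : Type u) (G : Type v) [Field k] [Group G] where
  toFun : G → G → G → kˣ
  cocycle : ∀ f g h l : G,
    toFun g h l * toFun f (g * h) l * toFun f g h = toFun (f * g) h l * toFun f g (h * l)
  one_left : ∀ g h, toFun 1 g h = 1
  one_mid : ∀ f h, toFun f 1 h = 1
  one_right : ∀ f g, toFun f g 1 = 1

namespace Cocycle3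

variable {k : Type u} {G : Type v} [Field k] [Group G]

instance : CoeFun (Cocycle3 k G) (fun _ => G → G → G → kˣ) := ⟨toFun⟩

variable (α : Cocycle3 k G)

/-- `α(f, g | h)`, the multiplier of the projective action. -/
def two (f g h : G) : kˣ :=
  (α f g h)⁻¹ * α f (g * h * g⁻¹) g * (α (f * g * h * (f * g)⁻¹) f g)⁻¹

/-- `α(f | g, h)`, the twist of the diagonal action on a tensor product. -/
def one (f g h : G) : kˣ :=
  α f g h * (α (f * g * f⁻¹) f h)⁻¹ * α (f * g * f⁻¹) (f * h * f⁻¹) f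

section additive
variable {M : Type*} [AddCommGroup M] {c : G → G → G → M}

theorem aux_two (hc : ∀ f g h l, c g h l + c f (g * h) l + c f g h = c (f * g) h l + c f g (h * l))
    (f g h u : G) :
    (-c f (g*h) u + c f (g*h*u*(g*h)⁻¹) (g*h) - c (f*(g*h)*u*(f*(g*h))⁻¹) f (g*h))
      + (-c g h u + c g (h*u*h⁻¹) h - c (g*h*u*(g*h)⁻¹) g h)
    = (-c (f*g) h u + c (f*g) (h*u*h⁻¹) h - c (f*g*h*u*(f*g*h)⁻¹) (f*g) h)
      + (-c f g (h*u*h⁻¹) + c f (g*(h*u*h⁻¹)*g⁻¹) g - c (f*g*(h*u*h⁻¹)*(f*g)⁻¹) f g) := by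
  have h1 := hc f g h u
  have h2 := hc f g (h*u*h⁻¹) h
  have h3 := hc f (g*h*u*h⁻¹*g⁻¹) g h
  have h4 := hc (f*g*h*u*h⁻¹*g⁻¹*f⁻¹) f g h
  simp only [mul_inv_rev, inv_mul_cancel_right, ← mul_assoc] at *
  linear_combination (norm := abel) -h1 + h2 - h3 + h4

theorem aux_one_two
    (hc : ∀ f g h l, c g h l + c f (g * h) l + c f g h = c (f * g) h l + c f g (h * l))
    (f g x y : G) :
    (c (f*g) x y - c (f*g*x*(f*g)⁻¹) (f*g) y + c (f*g*x*(f*g)⁻¹) (f*g*y*(f*g)⁻¹) (f*g))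
      + (-c f g x + c f (g*x*g⁻¹) g - c (f*g*x*(f*g)⁻¹) f g)
      + (-c f g y + c f (g*y*g⁻¹) g - c (f*g*y*(f*g)⁻¹) f g)
    = (-c f g (x*y) + c f (g*(x*y)*g⁻¹) g - c (f*g*(x*y)*(f*g)⁻¹) f g)
      + (c g x y - c (g*x*g⁻¹) g y + c (g*x*g⁻¹) (g*y*g⁻¹) g)
      + (c f (g*x*g⁻¹) (g*y*g⁻¹) - c (f*(g*x*g⁻¹)*f⁻¹) f (g*y*g⁻¹)
          + c (f*(g*x*g⁻¹)*f⁻¹) (f*(g*y*g⁻¹)*f⁻¹) f) := by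
  have h1 := hc f g x y
  have h2 := hc f (g*x*g⁻¹) g y
  have h3 := hc f (g*x*g⁻¹) (g*y*g⁻¹) g
  have h4 := hc (f*g*x*g⁻¹*f⁻¹) f g y
  have h5 := hc (f*g*x*g⁻¹*f⁻¹) f (g*y*g⁻¹) g
  have h6 := hc (f*g*x*g⁻¹*f⁻¹) (f*g*y*g⁻¹*f⁻¹) f g
  simp only [mul_inv_rev, inv_mul_cancel_right, ← mul_assoc] at *
  linear_combination (norm := abel) -h1 + h2 - h3 - h4 + h5 - h6

theorem aux_one_assoc
    (hc : ∀ f g h l, c g h l + c f (g * h) l + c f g h = c (f * g) h l + c f g (h * l))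
    (f x y z : G) :
    c x y z + (c f (x*y) z - c (f*(x*y)*f⁻¹) f z + c (f*(x*y)*f⁻¹) (f*z*f⁻¹) f)
      + (c f x y - c (f*x*f⁻¹) f y + c (f*x*f⁻¹) (f*y*f⁻¹) f)
    = (c f x (y*z) - c (f*x*f⁻¹) f (y*z) + c (f*x*f⁻¹) (f*(y*z)*f⁻¹) f)
      + (c f y z - c (f*y*f⁻¹) f z + c (f*y*f⁻¹) (f*z*f⁻¹) f)
      + c (f*x*f⁻¹) (f*y*f⁻¹) (f*z*f⁻¹) := by
  have h1 := hc f x y z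
  have h2 := hc (f*x*f⁻¹) f y z
  have h3 := hc (f*x*f⁻¹) (f*y*f⁻¹) f z
  have h4 := hc (f*x*f⁻¹) (f*y*f⁻¹) (f*z*f⁻¹) f
  simp only [inv_mul_cancel_right, ← mul_assoc] at *
  linear_combination (norm := abel) h1 - h2 + h3 - h4

theorem aux_braid (f g x : G) :
    (c f g x - c (f*g*f⁻¹) f x + c (f*g*f⁻¹) (f*x*f⁻¹) f)
      + (-c f g x + c f (g*x*g⁻¹) g - c (f*g*x*(f*g)⁻¹) f g)
    = (c f (g*x*g⁻¹) g - c (f*(g*x*g⁻¹)*f⁻¹) f g + c (f*(g*x*g⁻¹)*f⁻¹) (f*g*f⁻¹) f)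
      + (-c (f*g*f⁻¹) f x + c (f*g*f⁻¹) (f*x*f⁻¹) f
          - c (f*g*f⁻¹*f*x*(f*g*f⁻¹*f)⁻¹) (f*g*f⁻¹) f) := by
  simp only [mul_inv_rev, inv_mul_cancel_right, inv_inv, ← mul_assoc]
  abel
end additive

theorem two_mul (f g h u : G) :
    α.two f (g * h) u * α.two g h u = α.two (f * g) h u * α.two f g (h * u * h⁻¹) :=
  aux_two (M := Additive kˣ) (c := α.toFun) α.cocycle f g h u

theorem one_two (f g x y : G) :
    α.one (f * g) x y * α.two f g x * α.two f g y =
      α.two f g (x * y) * α.one g x y * α.one f (g * x * g⁻¹) (g * y * g⁻¹) :=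
  aux_one_two (M := Additive kˣ) (c := α.toFun) α.cocycle f g x y

theorem one_assoc (f x y z : G) :
    α x y z * α.one f (x * y) z * α.one f x y =
      α.one f x (y * z) * α.one f y z * α (f * x * f⁻¹) (f * y * f⁻¹) (f * z * f⁻¹) :=
  aux_one_assoc (M := Additive kˣ) (c := α.toFun) α.cocycle f x y z

theorem one_two_braid (f g x : G) :
    α.one f g x * α.two f g x = α.one f (g * x * g⁻¹) g * α.two (f * g * f⁻¹) f x :=
  aux_braid (M := Additive kˣ) (c := α.toFun) f g x

@[simp] theorem two_one (f g : G) : α.two f g 1 = 1 := by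
  simp [two, α.one_left, α.one_mid, α.one_right]
@[simp] theorem two_one_left (g h : G) : α.two 1 g h = 1 := by
  simp [two, α.one_left, α.one_mid, α.one_right]
@[simp] theorem two_one_mid (f h : G) : α.two f 1 h = 1 := by
  simp [two, α.one_left, α.one_mid, α.one_right]
@[simp] theorem one_one (g h : G) : α.one 1 g h = 1 := by
  simp [one, α.one_left, α.one_mid, α.one_right]
@[simp] theorem one_one_left (f h : G) : α.one f 1 h = 1 := by
  simp [one, α.one_left, α.one_mid, α.one_right]
@[simp] theorem one_one_right (f g : G) : α.one f g 1 = 1 := by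
  simp [one, α.one_left, α.one_mid, α.one_right]

theorem mul_inv_self (f : G) :
    α f⁻¹ f f⁻¹ * α f f⁻¹ f = 1 := by
  have := α.cocycle f f⁻¹ f f⁻¹
  simpa [α.one_left, α.one_mid, α.one_right] using this

end Cocycle3

open scoped TensorProduct

/-- Objects of `Z(G, α)`: finite-dimensional `G`-graded vector spaces with an `α`-projective action
of `G`.  The grading is given by its projections: the degree `g` component is the range of
`proj g`.  As `α(1, 1 | h) = 1`, the condition `act_one` says that all `act f` are invertible. -/
structure ZObj {k G : Type u} [Field k] [Group G] [Fintype G] (α : Cocycle3 k G) where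
  V : Type u
  [addCommGroup : AddCommGroup V]
  [module : Module k V]
  [finite : Module.Finite k V]
  proj : G → V →ₗ[k] V
  proj_self : ∀ g v, proj g (proj g v) = proj g v
  proj_ne : ∀ g h, g ≠ h → ∀ v, proj g (proj h v) = 0
  sum_proj : ∀ v, ∑ g, proj g v = v
  act : G → V →ₗ[k] V
  act_one : ∀ v, act 1 v = v
  act_proj : ∀ f g v, act f (proj g v) = proj (f * g * f⁻¹) (act f v)
  act_mul : ∀ f g h v, act (f * g) (proj h v) = (α.two f g h : k) • act f (act g (proj h v))

namespace ZObj

variable {k G : Type u} [Field k] [Group G] [Fintype G] {α : Cocycle3 k G}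

attribute [instance] addCommGroup module finite

/-- `v` is homogeneous of degree `g`. -/
def IsDeg (X : ZObj α) (g : G) (v : X.V) : Prop := X.proj g v = v

variable {X Y : ZObj α}

theorem isDeg_proj (X : ZObj α) (g : G) (v : X.V) : X.IsDeg g (X.proj g v) := X.proj_self g v

theorem IsDeg.proj_ne {g h : G} {v : X.V} (hv : X.IsDeg g v) (hn : h ≠ g) : X.proj h v = 0 := by
  rw [← hv]; exact X.proj_ne h g hn v

theorem IsDeg.proj [DecidableEq G] {g : G} {v : X.V} (hv : X.IsDeg g v) (h : G) :
    X.proj h v = if h = g then v else 0 := by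
  split_ifs with e
  · rw [e]; exact hv
  · exact hv.proj_ne e

theorem IsDeg.sum {W : Type*} [AddCommMonoid W] {g : G} {v : X.V} (hv : X.IsDeg g v)
    (F : G → X.V → W) (hF : ∀ h, F h 0 = 0) : ∑ h, F h (X.proj h v) = F g v := by
  rw [Finset.sum_eq_single g, hv]
  · intro h _ hn; rw [hv.proj_ne hn, hF]
  · simp

theorem IsDeg.act {g : G} {v : X.V} (hv : X.IsDeg g v) (f : G) :
    X.IsDeg (f * g * f⁻¹) (X.act f v) := by
  unfold IsDeg; rw [← X.act_proj, hv]

theorem IsDeg.act_mul {h : G} {v : X.V} (hv : X.IsDeg h v) (f g : G) :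
    X.act (f * g) v = (α.two f g h : k) • X.act f (X.act g v) := by
  have := X.act_mul f g h v
  rwa [hv] at this

theorem IsDeg.smul {g : G} {v : X.V} (hv : X.IsDeg g v) (c : k) : X.IsDeg g (c • v) := by
  unfold IsDeg; rw [map_smul, hv]

theorem deg_induction {P : X.V → Prop} (h0 : P 0) (ha : ∀ v w, P v → P w → P (v + w))
    (hd : ∀ g v, X.IsDeg g v → P v) (v : X.V) : P v := by
  rw [← X.sum_proj v]
  exact Finset.sum_induction _ P ha h0 fun g _ => hd g _ (X.isDeg_proj g v)

theorem lin_ext {W : Type*} [AddCommGroup W] [Module k W] {φ ψ : X.V →ₗ[k] W}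
    (h : ∀ g v, X.IsDeg g v → φ v = ψ v) : φ = ψ := by
  ext v
  induction v using deg_induction with
  | h0 => simp
  | ha v w hv hw => rw [map_add, map_add, hv, hw]
  | hd g v hv => exact h g v hv

theorem tens_ext {X Y : ZObj α} {W : Type*} [AddCommGroup W] [Module k W]
    {φ ψ : X.V ⊗[k] Y.V →ₗ[k] W}
    (h : ∀ g v, X.IsDeg g v → ∀ h w, Y.IsDeg h w → φ (v ⊗ₜ w) = ψ (v ⊗ₜ w)) : φ = ψ :=
  TensorProduct.ext (lin_ext fun g v hv => lin_ext fun g' w hw => h g v hv g' w hw)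

theorem tens_ext₃ {X Y Z : ZObj α} {W : Type*} [AddCommGroup W] [Module k W]
    {φ ψ : (X.V ⊗[k] Y.V) ⊗[k] Z.V →ₗ[k] W}
    (h : ∀ f u, X.IsDeg f u → ∀ g v, Y.IsDeg g v → ∀ h w, Z.IsDeg h w →
      φ ((u ⊗ₜ v) ⊗ₜ w) = ψ ((u ⊗ₜ v) ⊗ₜ w)) : φ = ψ :=
  TensorProduct.ext (tens_ext fun f u hu g v hv => lin_ext fun l w hw => h f u hu g v hv l w hw)

theorem tens_ext₃' {X Y Z : ZObj α} {W : Type*} [AddCommGroup W] [Module k W]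
    {φ ψ : X.V ⊗[k] (Y.V ⊗[k] Z.V) →ₗ[k] W}
    (h : ∀ f u, X.IsDeg f u → ∀ g v, Y.IsDeg g v → ∀ h w, Z.IsDeg h w →
      φ (u ⊗ₜ (v ⊗ₜ w)) = ψ (u ⊗ₜ (v ⊗ₜ w))) : φ = ψ :=
  TensorProduct.ext (lin_ext fun f u hu => tens_ext fun g v hv l w hw => h f u hu g v hv l w hw)

theorem tens_ext₄ {U X Y Z : ZObj α} {W : Type*} [AddCommGroup W] [Module k W]
    {φ ψ : ((U.V ⊗[k] X.V) ⊗[k] Y.V) ⊗[k] Z.V →ₗ[k] W}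
    (h : ∀ e t, U.IsDeg e t → ∀ f u, X.IsDeg f u → ∀ g v, Y.IsDeg g v → ∀ h w, Z.IsDeg h w →
      φ (((t ⊗ₜ u) ⊗ₜ v) ⊗ₜ w) = ψ (((t ⊗ₜ u) ⊗ₜ v) ⊗ₜ w)) : φ = ψ :=
  TensorProduct.ext (tens_ext₃ fun e t ht f u hu g v hv =>
    lin_ext fun l w hw => h e t ht f u hu g v hv l w hw)

/-- Morphisms of `Z(G, α)`: linear maps preserving the grading and the action. -/
@[ext]
structure Hom (X Y : ZObj α) where
  lin : X.V →ₗ[k] Y.V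
  proj_comm : ∀ g v, lin (X.proj g v) = Y.proj g (lin v)
  act_comm : ∀ f v, lin (X.act f v) = Y.act f (lin v)

instance : Category (ZObj α) where
  Hom := Hom
  id X := ⟨LinearMap.id, fun _ _ => rfl, fun _ _ => rfl⟩
  comp φ ψ := ⟨ψ.lin ∘ₗ φ.lin, fun g v => by simp [φ.proj_comm, ψ.proj_comm],
    fun f v => by simp [φ.act_comm, ψ.act_comm]⟩

theorem hom_ext {φ ψ : X ⟶ Y} (h : φ.lin = ψ.lin) : φ = ψ := Hom.ext h

@[simp] theorem id_lin (X : ZObj α) : Hom.lin (𝟙 X) = LinearMap.id := rfl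
@[simp] theorem comp_lin {X Y Z : ZObj α} (φ : X ⟶ Y) (ψ : Y ⟶ Z) :
    (φ ≫ ψ).lin = ψ.lin ∘ₗ φ.lin := rfl

theorem IsDeg.map {g : G} {v : X.V} (hv : X.IsDeg g v) (φ : X ⟶ Y) : Y.IsDeg g (φ.lin v) := by
  unfold IsDeg; rw [← φ.proj_comm, hv]

/-- A morphism can be checked on homogeneous elements. -/
def mkHom (φ : X.V →ₗ[k] Y.V) (hp : ∀ g v, X.IsDeg g v → Y.IsDeg g (φ v))
    (ha : ∀ f g v, X.IsDeg g v → φ (X.act f v) = Y.act f (φ v)) : X ⟶ Y where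
  lin := φ
  proj_comm g v := by
    induction v using deg_induction with
    | h0 => simp
    | ha v w hv hw => simp only [map_add, hv, hw]
    | hd h v hv => classical rw [hv.proj, (hp h v hv).proj, apply_ite φ, map_zero]
  act_comm f v := by
    induction v using deg_induction with
    | h0 => simp
    | ha v w hv hw => simp only [map_add, hv, hw]
    | hd h v hv => exact ha f h v hv

/-- A morphism with a linear inverse is an isomorphism. -/
@[simps]
def mkIso (φ : X ⟶ Y) (ψ : Y.V →ₗ[k] X.V) (h₁ : ψ ∘ₗ φ.lin = LinearMap.id)
    (h₂ : φ.lin ∘ₗ ψ = LinearMap.id) : X ≅ Y where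
  hom := φ
  inv :=
    { lin := ψ
      proj_comm := fun g v => by
        have e := LinearMap.congr_fun h₁ (X.proj g (ψ v))
        have e' := LinearMap.congr_fun h₂ v
        simp only [LinearMap.comp_apply, LinearMap.id_apply, φ.proj_comm] at e e'
        rw [e'] at e; exact e
      act_comm := fun g v => by
        have e := LinearMap.congr_fun h₁ (X.act g (ψ v))
        have e' := LinearMap.congr_fun h₂ v
        simp only [LinearMap.comp_apply, LinearMap.id_apply, φ.act_comm] at e e'
        rw [e'] at e; exact e }
  hom_inv_id := hom_ext h₁
  inv_hom_id := hom_ext h₂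

/-! ### The monoidal structure -/

/-- The projection onto degree `f` of a tensor product. -/
def tProj (X Y : ZObj α) (f : G) : X.V ⊗[k] Y.V →ₗ[k] X.V ⊗[k] Y.V :=
  ∑ g, TensorProduct.map (X.proj g) (Y.proj (g⁻¹ * f))

/-- `f.(x ⊗ y) = α(f | g, h) f.x ⊗ f.y` for `x`, `y` of degrees `g`, `h`. -/
def tAct (X Y : ZObj α) (f : G) : X.V ⊗[k] Y.V →ₗ[k] X.V ⊗[k] Y.V :=
  ∑ g, ∑ h, (α.one f g h : k) •
    TensorProduct.map (X.act f ∘ₗ X.proj g) (Y.act f ∘ₗ Y.proj h)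

theorem tProj_tmul [DecidableEq G] {g h : G} {v : X.V} {w : Y.V} (hv : X.IsDeg g v)
    (hw : Y.IsDeg h w) (f : G) : tProj X Y f (v ⊗ₜ w) = if f = g * h then v ⊗ₜ w else 0 := by
  simp only [tProj, LinearMap.sum_apply, TensorProduct.map_tmul]
  rw [hv.sum (fun g' v' => v' ⊗ₜ[k] Y.proj (g'⁻¹ * f) w) (by simp), hw.proj]
  simp only [inv_mul_eq_iff_eq_mul]
  split_ifs <;> simp

theorem tAct_tmul {g h : G} {v : X.V} {w : Y.V} (hv : X.IsDeg g v)
    (hw : Y.IsDeg h w) (f : G) :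
    tAct X Y f (v ⊗ₜ w) = (α.one f g h : k) • (X.act f v ⊗ₜ Y.act f w) := by
  simp only [tAct, LinearMap.sum_apply, LinearMap.smul_apply, TensorProduct.map_tmul,
    LinearMap.comp_apply]
  rw [hv.sum (fun g' v' => ∑ h', (α.one f g' h' : k) • (X.act f v' ⊗ₜ[k] Y.act f (Y.proj h' w)))
    (by simp), hw.sum (fun h' w' => (α.one f g h' : k) • (X.act f v ⊗ₜ[k] Y.act f w')) (by simp)]

/-- The tensor product of `Z(G, α)`. -/
abbrev tensor (X Y : ZObj α) : ZObj α where
  V := X.V ⊗[k] Y.V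
  proj := tProj X Y
  proj_self g v := by
    classical
    refine LinearMap.congr_fun (f := tProj X Y g ∘ₗ tProj X Y g) (g := tProj X Y g)
      (tens_ext fun a v hv b w hw => ?_) v
    simp only [LinearMap.comp_apply, tProj_tmul hv hw]
    split_ifs with e <;> simp [tProj_tmul hv hw, e]
  proj_ne g h hn v := by
    classical
    refine LinearMap.congr_fun (f := tProj X Y g ∘ₗ tProj X Y h) (g := 0)
      (tens_ext fun a v hv b w hw => ?_) v
    simp only [LinearMap.comp_apply, tProj_tmul hv hw]
    split_ifs with e
    · rw [tProj_tmul hv hw, if_neg (by rwa [← e])]; rfl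
    · simp
  sum_proj v := by
    classical
    have : ∑ g, tProj X Y g = LinearMap.id := tens_ext fun a v hv b w hw => by
      simp [LinearMap.sum_apply, tProj_tmul hv hw]
    simpa [LinearMap.sum_apply] using LinearMap.congr_fun this v
  act := tAct X Y
  act_one v := by
    refine LinearMap.congr_fun (f := tAct X Y 1) (g := LinearMap.id)
      (tens_ext fun a v hv b w hw => ?_) v
    simp [tAct_tmul hv hw, X.act_one, Y.act_one]
  act_proj f g v := by
    classical
    refine LinearMap.congr_fun (f := tAct X Y f ∘ₗ tProj X Y g)
      (g := tProj X Y (f * g * f⁻¹) ∘ₗ tAct X Y f) (tens_ext fun a v hv b w hw => ?_) v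
    simp only [LinearMap.comp_apply, tProj_tmul hv hw, tAct_tmul hv hw, map_smul,
      tProj_tmul (hv.act f) (hw.act f)]
    have : f * g * f⁻¹ = f * a * f⁻¹ * (f * b * f⁻¹) ↔ g = a * b := by
      rw [conj_mul]; simp
    simp only [this]
    split_ifs <;> simp [tAct_tmul hv hw]
  act_mul f g h v := by
    classical
    refine LinearMap.congr_fun (f := tAct X Y (f * g) ∘ₗ tProj X Y h)
      (g := (α.two f g h : k) • (tAct X Y f ∘ₗ tAct X Y g ∘ₗ tProj X Y h))
      (tens_ext fun a v hv b w hw => ?_) v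
    simp only [LinearMap.comp_apply, tProj_tmul hv hw, LinearMap.smul_apply]
    split_ifs with e
    · subst e
      simp only [tAct_tmul hv hw, map_smul, tAct_tmul (hv.act g) (hw.act g), hv.act_mul, hw.act_mul,
        TensorProduct.smul_tmul', TensorProduct.tmul_smul, smul_smul]
      rw [tAct_tmul ((hv.act g).smul _) (hw.act g), map_smul]
      simp only [← TensorProduct.smul_tmul', smul_smul]
      congr 1
      have := congrArg (Units.val) (α.one_two f g a b)
      push_cast at this
      linear_combination this
    · simp

theorem IsDeg.tmul {g h : G} {v : X.V} {w : Y.V} (hv : X.IsDeg g v) (hw : Y.IsDeg h w) :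
    (tensor X Y).IsDeg (g * h) (v ⊗ₜ w) := by
  classical
  exact (tProj_tmul hv hw _).trans (if_pos rfl)

theorem act_tmul {g h : G} {v : X.V} {w : Y.V} (hv : X.IsDeg g v) (hw : Y.IsDeg h w) (f : G) :
    (tensor X Y).act f (v ⊗ₜ w) = (α.one f g h : k) • (X.act f v ⊗ₜ Y.act f w) :=
  tAct_tmul hv hw f

/-- A morphism out of a tensor product can be checked on homogeneous tensors. -/
theorem isDeg_of_tmul {Z : ZObj α} (φ : X.V ⊗[k] Y.V →ₗ[k] Z.V)
    (h : ∀ a v, X.IsDeg a v → ∀ b w, Y.IsDeg b w → Z.IsDeg (a * b) (φ (v ⊗ₜ w)))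
    (g : G) (v : (tensor X Y).V) (hv : (tensor X Y).IsDeg g v) : Z.IsDeg g (φ v) := by
  classical
  have : Z.proj g ∘ₗ φ = φ ∘ₗ tProj X Y g := tens_ext fun a v hv b w hw => by
    simp only [LinearMap.comp_apply, tProj_tmul hv hw, (h a v hv b w hw).proj, apply_ite φ,
      map_zero]
  exact (LinearMap.congr_fun this v).trans (congrArg φ hv)

/-- The unit object `k`, in degree `1` with trivial action. -/
noncomputable abbrev unit (α : Cocycle3 k G) : ZObj α where
  V := k
  proj g := by classical exact if g = 1 then LinearMap.id else 0
  proj_self g v := by split_ifs <;> simp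
  proj_ne g h hn v := by
    by_cases e : g = 1
    · rw [if_neg (fun e' : h = 1 => hn (e.trans e'.symm))]; simp
    · simp [e]
  sum_proj v := by
    classical
    rw [← LinearMap.sum_apply]; simp
  act _ := LinearMap.id
  act_one _ := rfl
  act_proj f g v := by
    by_cases e : g = 1 <;> simp [e]
  act_mul f g h v := by
    by_cases e : h = 1 <;> simp [e]

theorem isDeg_unit (c : k) : (unit α).IsDeg 1 c := by
  simp [IsDeg, unit]

/-- The tensor product of morphisms. -/
def tensorMap {X Y X' Y' : ZObj α} (φ : X ⟶ X') (ψ : Y ⟶ Y') : tensor X Y ⟶ tensor X' Y' where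
  lin := TensorProduct.map φ.lin ψ.lin
  proj_comm g v := by
    classical
    refine LinearMap.congr_fun (f := TensorProduct.map φ.lin ψ.lin ∘ₗ tProj X Y g)
      (g := tProj X' Y' g ∘ₗ TensorProduct.map φ.lin ψ.lin) (tens_ext fun a v hv b w hw => ?_) v
    simp only [LinearMap.comp_apply, tProj_tmul hv hw, TensorProduct.map_tmul,
      tProj_tmul (hv.map φ) (hw.map ψ)]
    split_ifs <;> simp
  act_comm f v := by
    refine LinearMap.congr_fun (f := TensorProduct.map φ.lin ψ.lin ∘ₗ tAct X Y f)
      (g := tAct X' Y' f ∘ₗ TensorProduct.map φ.lin ψ.lin) (tens_ext fun a v hv b w hw => ?_) v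
    simp only [LinearMap.comp_apply, tAct_tmul hv hw, TensorProduct.map_tmul, map_smul,
      tAct_tmul (hv.map φ) (hw.map ψ), φ.act_comm, ψ.act_comm]

/-- The linear map `x ⊗ (y ⊗ z) ↦ α(f, g, h) (x ⊗ y) ⊗ z` on elements of degrees `f`, `g`, `h`. -/
def assocInv (X Y Z : ZObj α) : X.V ⊗[k] (Y.V ⊗[k] Z.V) →ₗ[k] (X.V ⊗[k] Y.V) ⊗[k] Z.V :=
  ∑ f, ∑ g, ∑ h, (α f g h : k) • ((TensorProduct.assoc k X.V Y.V Z.V).symm.toLinearMap ∘ₗ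
    TensorProduct.map (X.proj f) (TensorProduct.map (Y.proj g) (Z.proj h)))

/-- The inverse of `assocInv`. -/
def assocHom (X Y Z : ZObj α) : (X.V ⊗[k] Y.V) ⊗[k] Z.V →ₗ[k] X.V ⊗[k] (Y.V ⊗[k] Z.V) :=
  ∑ f, ∑ g, ∑ h, ((α f g h)⁻¹ : k) • ((TensorProduct.assoc k X.V Y.V Z.V).toLinearMap ∘ₗ
    TensorProduct.map (TensorProduct.map (X.proj f) (Y.proj g)) (Z.proj h))

theorem assocInv_tmul {X Y Z : ZObj α} {f g h : G} {u : X.V} {v : Y.V} {w : Z.V}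
    (hu : X.IsDeg f u) (hv : Y.IsDeg g v) (hw : Z.IsDeg h w) :
    assocInv X Y Z (u ⊗ₜ (v ⊗ₜ w)) = (α f g h : k) • ((u ⊗ₜ v) ⊗ₜ w) := by
  simp only [assocInv, LinearMap.sum_apply, LinearMap.smul_apply, TensorProduct.map_tmul,
    LinearMap.comp_apply, LinearEquiv.coe_coe, TensorProduct.assoc_symm_tmul]
  rw [hu.sum (fun f' u' => ∑ g', ∑ h', (α f' g' h' : k) •
      ((u' ⊗ₜ[k] Y.proj g' v) ⊗ₜ[k] Z.proj h' w)) (by simp),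
    hv.sum (fun g' v' => ∑ h', (α f g' h' : k) • ((u ⊗ₜ[k] v') ⊗ₜ[k] Z.proj h' w)) (by simp),
    hw.sum (fun h' w' => (α f g h' : k) • ((u ⊗ₜ[k] v) ⊗ₜ[k] w')) (by simp)]

theorem assocHom_tmul {X Y Z : ZObj α} {f g h : G} {u : X.V} {v : Y.V} {w : Z.V}
    (hu : X.IsDeg f u) (hv : Y.IsDeg g v) (hw : Z.IsDeg h w) :
    assocHom X Y Z ((u ⊗ₜ v) ⊗ₜ w) = ((α f g h)⁻¹ : k) • (u ⊗ₜ (v ⊗ₜ w)) := by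
  simp only [assocHom, LinearMap.sum_apply, LinearMap.smul_apply, TensorProduct.map_tmul,
    LinearMap.comp_apply, LinearEquiv.coe_coe, TensorProduct.assoc_tmul]
  rw [hu.sum (fun f' u' => ∑ g', ∑ h', ((α f' g' h')⁻¹ : k) •
      (u' ⊗ₜ[k] (Y.proj g' v ⊗ₜ[k] Z.proj h' w))) (by simp),
    hv.sum (fun g' v' => ∑ h', ((α f g' h')⁻¹ : k) • (u ⊗ₜ[k] (v' ⊗ₜ[k] Z.proj h' w))) (by simp),
    hw.sum (fun h' w' => ((α f g h')⁻¹ : k) • (u ⊗ₜ[k] (v ⊗ₜ[k] w'))) (by simp)]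

/-- The associativity constraint `(X ⊗ Y) ⊗ Z ≅ X ⊗ (Y ⊗ Z)`; its inverse multiplies
`x ⊗ (y ⊗ z)` by `α(f, g, h)`. -/
def assoc (X Y Z : ZObj α) : tensor (tensor X Y) Z ≅ tensor X (tensor Y Z) :=
  mkIso
    { lin := assocHom X Y Z
      proj_comm := fun g v => by
        classical
        refine LinearMap.congr_fun (f := assocHom X Y Z ∘ₗ tProj (tensor X Y) Z g)
          (g := tProj X (tensor Y Z) g ∘ₗ assocHom X Y Z)
          (tens_ext₃ fun f u hu g v hv h w hw => ?_) v
        simp only [LinearMap.comp_apply, tProj_tmul (hu.tmul hv) hw, assocHom_tmul hu hv hw,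
          map_smul, tProj_tmul hu (hv.tmul hw), ← mul_assoc]
        split_ifs <;> simp [assocHom_tmul hu hv hw]
      act_comm := fun a v => by
        refine LinearMap.congr_fun (f := assocHom X Y Z ∘ₗ tAct (tensor X Y) Z a)
          (g := tAct X (tensor Y Z) a ∘ₗ assocHom X Y Z)
          (tens_ext₃ fun f u hu g v hv h w hw => ?_) v
        simp only [LinearMap.comp_apply, tAct_tmul (hu.tmul hv) hw, act_tmul hu hv,
          assocHom_tmul hu hv hw, map_smul, tAct_tmul hu (hv.tmul hw), act_tmul hv hw,
          ← TensorProduct.smul_tmul', TensorProduct.tmul_smul, smul_smul,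
          assocHom_tmul (hu.act a) (hv.act a) (hw.act a)]
        congr 1
        have := congrArg (Units.val) (α.one_assoc a f g h)
        push_cast at this
        field_simp
        linear_combination this }
    (assocInv X Y Z)
    (tens_ext₃ fun f u hu g v hv h w hw => by
      simp [assocHom_tmul hu hv hw, assocInv_tmul hu hv hw])
    (tens_ext₃' fun f u hu g v hv h w hw => by
      simp [assocHom_tmul hu hv hw, assocInv_tmul hu hv hw])

/-- The left unit constraint. -/
noncomputable def lUnit (X : ZObj α) : tensor (unit α) X ≅ X :=
  mkIso
    { lin := (TensorProduct.lid k X.V).toLinearMap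
      proj_comm := fun g v => by
        classical
        refine LinearMap.congr_fun (f := (TensorProduct.lid k X.V).toLinearMap ∘ₗ
            tProj (unit α) X g) (g := X.proj g ∘ₗ (TensorProduct.lid k X.V).toLinearMap)
          (tens_ext fun f u hu g v hv => ?_) v
        have hu' := isDeg_unit (α := α) u
        simp only [LinearMap.comp_apply, tProj_tmul hu' hv, LinearEquiv.coe_coe,
          TensorProduct.lid_tmul, map_smul, hv.proj, one_mul]
        split_ifs <;> simp
      act_comm := fun a v => by
        refine LinearMap.congr_fun (f := (TensorProduct.lid k X.V).toLinearMap ∘ₗ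
            tAct (unit α) X a) (g := X.act a ∘ₗ (TensorProduct.lid k X.V).toLinearMap)
          (tens_ext fun f u hu g v hv => ?_) v
        have hu' := isDeg_unit (α := α) u
        simp [tAct_tmul hu' hv] }
    (TensorProduct.lid k X.V).symm.toLinearMap (by ext; simp) (by ext; simp)

/-- The right unit constraint. -/
noncomputable def rUnit (X : ZObj α) : tensor X (unit α) ≅ X :=
  mkIso
    { lin := (TensorProduct.rid k X.V).toLinearMap
      proj_comm := fun g v => by
        classical
        refine LinearMap.congr_fun (f := (TensorProduct.rid k X.V).toLinearMap ∘ₗ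
            tProj X (unit α) g) (g := X.proj g ∘ₗ (TensorProduct.rid k X.V).toLinearMap)
          (tens_ext fun g v hv f u hu => ?_) v
        have hu' := isDeg_unit (α := α) u
        simp only [LinearMap.comp_apply, tProj_tmul hv hu', LinearEquiv.coe_coe,
          TensorProduct.rid_tmul, map_smul, hv.proj, mul_one]
        split_ifs <;> simp
      act_comm := fun a v => by
        refine LinearMap.congr_fun (f := (TensorProduct.rid k X.V).toLinearMap ∘ₗ
            tAct X (unit α) a) (g := X.act a ∘ₗ (TensorProduct.rid k X.V).toLinearMap)
          (tens_ext fun g v hv f u hu => ?_) v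
        have hu' := isDeg_unit (α := α) u
        simp [tAct_tmul hv hu'] }
    (TensorProduct.rid k X.V).symm.toLinearMap (by ext; simp) (by ext; simp)

noncomputable instance : MonoidalCategoryStruct (ZObj α) where
  tensorObj := tensor
  whiskerLeft X _ _ φ := tensorMap (𝟙 X) φ
  whiskerRight φ X := tensorMap φ (𝟙 X)
  tensorHom φ ψ := tensorMap φ ψ
  tensorUnit := unit α
  associator := assoc
  leftUnitor := lUnit
  rightUnitor := rUnit

@[simp] theorem tensorHom_lin {X Y X' Y' : ZObj α} (φ : X ⟶ X') (ψ : Y ⟶ Y') :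
    (φ ⊗ₘ ψ).lin = TensorProduct.map φ.lin ψ.lin := rfl
@[simp] theorem whiskerLeft_lin (X : ZObj α) {Y Y' : ZObj α} (ψ : Y ⟶ Y') :
    (X ◁ ψ).lin = TensorProduct.map LinearMap.id ψ.lin := rfl
@[simp] theorem whiskerRight_lin {X X' : ZObj α} (φ : X ⟶ X') (Y : ZObj α) :
    (φ ▷ Y).lin = TensorProduct.map φ.lin LinearMap.id := rfl
@[simp] theorem associator_hom_lin (X Y Z : ZObj α) :
    (α_ X Y Z).hom.lin = assocHom X Y Z := rfl
@[simp] theorem associator_inv_lin (X Y Z : ZObj α) :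
    (α_ X Y Z).inv.lin = assocInv X Y Z := rfl
@[simp] theorem leftUnitor_hom_lin (X : ZObj α) :
    (λ_ X).hom.lin = (TensorProduct.lid k X.V).toLinearMap := rfl
@[simp] theorem leftUnitor_inv_lin (X : ZObj α) :
    (λ_ X).inv.lin = (TensorProduct.lid k X.V).symm.toLinearMap := rfl
@[simp] theorem rightUnitor_hom_lin (X : ZObj α) :
    (ρ_ X).hom.lin = (TensorProduct.rid k X.V).toLinearMap := rfl
@[simp] theorem rightUnitor_inv_lin (X : ZObj α) :
    (ρ_ X).inv.lin = (TensorProduct.rid k X.V).symm.toLinearMap := rfl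

/-- `Z(G, α)` is a monoidal category. -/
noncomputable instance : MonoidalCategory (ZObj α) where
  tensorHom_def φ ψ := hom_ext <| TensorProduct.ext' fun v w => rfl
  id_tensorHom_id X Y := hom_ext <| TensorProduct.ext' fun v w => rfl
  tensorHom_comp_tensorHom _ _ _ _ := hom_ext <| TensorProduct.ext' fun v w => rfl
  whiskerLeft_id X Y := hom_ext <| TensorProduct.ext' fun v w => rfl
  id_whiskerRight X Y := hom_ext <| TensorProduct.ext' fun v w => rfl
  associator_naturality φ₁ φ₂ φ₃ := hom_ext <| tens_ext₃ fun f u hu g v hv h w hw => by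
    change assocHom _ _ _ ((φ₁.lin u ⊗ₜ φ₂.lin v) ⊗ₜ φ₃.lin w) =
      TensorProduct.map φ₁.lin (TensorProduct.map φ₂.lin φ₃.lin) (assocHom _ _ _ _)
    rw [assocHom_tmul hu hv hw, assocHom_tmul (hu.map φ₁) (hv.map φ₂) (hw.map φ₃)]
    simp
  leftUnitor_naturality φ := hom_ext <| TensorProduct.ext' fun v w => (φ.lin.map_smul v w).symm
  rightUnitor_naturality φ := hom_ext <| TensorProduct.ext' fun v w => (φ.lin.map_smul w v).symm
  pentagon W X Y Z := hom_ext <| tens_ext₄ fun e t ht f u hu g v hv h w hw => by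
    change TensorProduct.map LinearMap.id (assocHom X Y Z) (assocHom W (tensor X Y) Z
      (assocHom W X Y ((t ⊗ₜ u) ⊗ₜ v) ⊗ₜ w)) =
      assocHom W X (tensor Y Z) (assocHom (tensor W X) Y Z (((t ⊗ₜ u) ⊗ₜ v) ⊗ₜ w))
    rw [assocHom_tmul ht hu hv, assocHom_tmul (ht.tmul hu) hv hw, ← TensorProduct.smul_tmul',
      map_smul, map_smul, assocHom_tmul ht (hu.tmul hv) hw, map_smul, map_smul,
      assocHom_tmul ht hu (hv.tmul hw), TensorProduct.map_tmul, assocHom_tmul hu hv hw, TensorProduct.tmul_smul,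
      smul_smul, smul_smul, smul_smul]
    congr 1
    have := congrArg (Units.val) (α.cocycle e f g h)
    push_cast at this
    field_simp
    linear_combination -this
  triangle X Y := hom_ext <| tens_ext₃ fun f u hu g v hv h w hw => by
    change k at v
    change TensorProduct.map LinearMap.id (TensorProduct.lid k Y.V).toLinearMap
      (assocHom X (unit α) Y ((u ⊗ₜ v) ⊗ₜ w)) = (v • u) ⊗ₜ w
    rw [assocHom_tmul hu (isDeg_unit v) hw, α.one_mid, map_smul, TensorProduct.map_tmul]
    simp [TensorProduct.smul_tmul]

/-! ### The braiding -/

/-- `x ⊗ y ↦ f.y ⊗ x` for `x` of degree `f`. -/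
def braidHom (X Y : ZObj α) : X.V ⊗[k] Y.V →ₗ[k] Y.V ⊗[k] X.V :=
  ∑ f, (TensorProduct.comm k X.V Y.V).toLinearMap ∘ₗ TensorProduct.map (X.proj f) (Y.act f)

/-- The inverse of `braidHom`. -/
def braidInv (X Y : ZObj α) : Y.V ⊗[k] X.V →ₗ[k] X.V ⊗[k] Y.V :=
  ∑ h, ∑ f, (α.two f⁻¹ f (f⁻¹ * h * f) : k) • ((TensorProduct.comm k Y.V X.V).toLinearMap ∘ₗ
    TensorProduct.map (Y.act f⁻¹ ∘ₗ Y.proj h) (X.proj f))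

theorem braidHom_tmul {f : G} {v : X.V} (hv : X.IsDeg f v) (w : Y.V) :
    braidHom X Y (v ⊗ₜ w) = Y.act f w ⊗ₜ v := by
  simp only [braidHom, LinearMap.sum_apply, LinearMap.comp_apply, TensorProduct.map_tmul,
    LinearEquiv.coe_coe, TensorProduct.comm_tmul]
  exact hv.sum (fun f' v' => Y.act f' w ⊗ₜ[k] v') (by simp)

theorem braidInv_tmul {f h : G} {v : X.V} {w : Y.V} (hv : X.IsDeg f v) (hw : Y.IsDeg h w) :
    braidInv X Y (w ⊗ₜ v) = (α.two f⁻¹ f (f⁻¹ * h * f) : k) • (v ⊗ₜ Y.act f⁻¹ w) := by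
  simp only [braidInv, LinearMap.sum_apply, LinearMap.smul_apply, LinearMap.comp_apply,
    TensorProduct.map_tmul, LinearEquiv.coe_coe, TensorProduct.comm_tmul]
  rw [hw.sum (fun h' w' => ∑ f', (α.two f'⁻¹ f' (f'⁻¹ * h' * f') : k) •
      (X.proj f' v ⊗ₜ[k] Y.act f'⁻¹ w')) (by simp),
    hv.sum (fun f' v' => (α.two f'⁻¹ f' (f'⁻¹ * h * f') : k) • (v' ⊗ₜ[k] Y.act f'⁻¹ w))
      (by simp)]

theorem IsDeg.inv_act {h : G} {v : X.V} (hv : X.IsDeg h v) (f : G) :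
    (α.two f⁻¹ f h : k) • X.act f⁻¹ (X.act f v) = v := by
  rw [← hv.act_mul, inv_mul_cancel, X.act_one]

theorem act_injective (X : ZObj α) (f : G) : Function.Injective (X.act f) := by
  refine (LinearMap.ker_eq_bot (f := X.act f)).1 (LinearMap.ker_eq_bot'.2 fun v hv => ?_)
  rw [← X.sum_proj v]
  refine Finset.sum_eq_zero fun g _ => ?_
  rw [← (X.isDeg_proj g v).inv_act f, X.act_proj, hv]
  simp

theorem IsDeg.act_inv {h : G} {v : X.V} (hv : X.IsDeg h v) (f : G) :
    (α.two f⁻¹ f (f⁻¹ * h * f) : k) • X.act f (X.act f⁻¹ v) = v := by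
  refine X.act_injective f⁻¹ ?_
  have := (hv.act f⁻¹).inv_act f
  rwa [inv_inv, ← map_smul] at this

/-- The braiding of `Z(G, α)`. -/
def braid (X Y : ZObj α) : tensor X Y ≅ tensor Y X :=
  mkIso
    { lin := braidHom X Y
      proj_comm := fun g v => by
        classical
        refine LinearMap.congr_fun (f := braidHom X Y ∘ₗ tProj X Y g)
          (g := tProj Y X g ∘ₗ braidHom X Y) (tens_ext fun f u hu g v hv => ?_) v
        simp only [LinearMap.comp_apply, tProj_tmul hu hv, braidHom_tmul hu,
          tProj_tmul (hv.act f) hu, inv_mul_cancel_right]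
        split_ifs <;> simp [braidHom_tmul hu]
      act_comm := fun a v => by
        refine LinearMap.congr_fun (f := braidHom X Y ∘ₗ tAct X Y a)
          (g := tAct Y X a ∘ₗ braidHom X Y) (tens_ext fun f u hu g v hv => ?_) v
        simp only [LinearMap.comp_apply, tAct_tmul hu hv, braidHom_tmul hu, map_smul,
          tAct_tmul (hv.act f) hu, braidHom_tmul (hu.act a)]
        have e : Y.act (a * f * a⁻¹) (Y.act a v) = ((α.two (a * f * a⁻¹) a g)⁻¹ : k) •
            (α.two a f g : k) • Y.act a (Y.act f v) := by
          rw [← hv.act_mul a f, show a * f = a * f * a⁻¹ * a by group, hv.act_mul]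
          simp [smul_smul]
        rw [e]
        simp only [← TensorProduct.smul_tmul', smul_smul]
        congr 1
        have := α.one_two_braid a f g
        have := congrArg (Units.val) this
        push_cast at this
        field_simp
        linear_combination this }
    (braidInv X Y)
    (tens_ext fun f u hu g v hv => by
      have : f⁻¹ * (f * g * f⁻¹) * f = g := by group
      simp [braidHom_tmul hu, braidInv_tmul hu (hv.act f), ← TensorProduct.tmul_smul, this,
        hv.inv_act])
    (tens_ext fun g v hv f u hu => by
      rw [LinearMap.comp_apply, braidInv_tmul hu hv, map_smul]
      change _ • braidHom X Y _ = _
      rw [braidHom_tmul hu, TensorProduct.smul_tmul', hv.act_inv]; rfl)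

/-- `Z(G, α)` is a braided monoidal category. -/
noncomputable instance : BraidedCategory (ZObj α) where
  braiding := braid
  braiding_naturality_right X Y Z φ := hom_ext <| tens_ext fun f u hu g v hv => by
    change braidHom X Z (u ⊗ₜ φ.lin v) = TensorProduct.map φ.lin LinearMap.id
      (braidHom X Y (u ⊗ₜ v))
    simp [braidHom_tmul hu, φ.act_comm]
  braiding_naturality_left φ Z := hom_ext <| tens_ext fun f u hu g v hv => by
    change braidHom _ Z (φ.lin u ⊗ₜ v) = TensorProduct.map LinearMap.id φ.lin
      (braidHom _ Z (u ⊗ₜ v))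
    simp [braidHom_tmul hu, braidHom_tmul (hu.map φ)]
  hexagon_forward X Y Z := hom_ext <| tens_ext₃ fun f u hu g v hv h w hw => by
    change assocHom Y Z X (braidHom X (tensor Y Z) (assocHom X Y Z ((u ⊗ₜ v) ⊗ₜ w))) =
      TensorProduct.map LinearMap.id (braidHom X Z) (assocHom Y X Z (braidHom X Y (u ⊗ₜ v) ⊗ₜ w))
    rw [assocHom_tmul hu hv hw, map_smul, braidHom_tmul hu, braidHom_tmul hu,
      assocHom_tmul (hv.act f) hu hw, act_tmul hv hw, ← TensorProduct.smul_tmul', map_smul,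
      map_smul, assocHom_tmul (hv.act f) (hw.act f) hu, map_smul, TensorProduct.map_tmul,
      braidHom_tmul hu, smul_smul, smul_smul]
    simp only [LinearMap.id_apply, Cocycle3.one]
    congr 1
    push_cast
    field_simp
  hexagon_reverse X Y Z := hom_ext <| tens_ext₃' fun f u hu g v hv h w hw => by
    change assocInv Z X Y (braidHom (tensor X Y) Z (assocInv X Y Z (u ⊗ₜ (v ⊗ₜ w)))) =
      TensorProduct.map (braidHom X Z) LinearMap.id (assocInv X Z Y (u ⊗ₜ braidHom Y Z (v ⊗ₜ w)))
    rw [assocInv_tmul hu hv hw, map_smul, braidHom_tmul (hu.tmul hv), braidHom_tmul hv,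
      assocInv_tmul hu (hw.act g) hv, hw.act_mul, ← TensorProduct.smul_tmul', map_smul,
      map_smul, assocInv_tmul ((hw.act g).act f) hu hv, map_smul, TensorProduct.map_tmul,
      braidHom_tmul hu, smul_smul, smul_smul]
    simp only [LinearMap.id_apply, Cocycle3.two, mul_inv_rev, ← mul_assoc]
    congr 1
    push_cast
    field_simp

end ZObj

namespace ZObj

variable {k G : Type u} [Field k] [Group G] [Fintype G] {α : Cocycle3 k G}

/-! ### The twist -/

/-- `x ↦ f.x` for `x` of degree `f`. -/
def twistLin (X : ZObj α) : X.V →ₗ[k] X.V := ∑ f, X.act f ∘ₗ X.proj f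

theorem twistLin_apply {X : ZObj α} {f : G} {v : X.V} (hv : X.IsDeg f v) :
    twistLin X v = X.act f v := by
  simp only [twistLin, LinearMap.sum_apply, LinearMap.comp_apply]
  exact hv.sum (fun f' v' => X.act f' v') (by simp)

/-- The inverse of the twist. -/
def twistInv (X : ZObj α) : X.V →ₗ[k] X.V := ∑ f, (α.two f⁻¹ f f : k) • (X.act f⁻¹ ∘ₗ X.proj f)

theorem twistInv_apply {X : ZObj α} {f : G} {v : X.V} (hv : X.IsDeg f v) :
    twistInv X v = (α.two f⁻¹ f f : k) • X.act f⁻¹ v := by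
  simp only [twistInv, LinearMap.sum_apply, LinearMap.comp_apply, LinearMap.smul_apply]
  exact hv.sum (fun f' v' => (α.two f'⁻¹ f' f' : k) • X.act f'⁻¹ v') (by simp)

theorem IsDeg.act_self {X : ZObj α} {f : G} {v : X.V} (hv : X.IsDeg f v) :
    X.IsDeg f (X.act f v) := by
  have := hv.act f
  rwa [mul_inv_cancel_right] at this

/-- The twist of an object. -/
def twistIso (X : ZObj α) : X ≅ X :=
  mkIso
    (mkHom (twistLin X) (fun g v hv => by rw [twistLin_apply hv]; exact hv.act_self)
      fun f g v hv => by
        rw [twistLin_apply hv, twistLin_apply (hv.act f)]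
        have h := hv.act_mul f g
        rw [show f * g = f * g * f⁻¹ * f by group, hv.act_mul] at h
        have e : α.two (f * g * f⁻¹) f g = α.two f g g := by
          simp [Cocycle3.two, ← mul_assoc]
        rw [e] at h
        exact smul_right_injective _ (Units.ne_zero _) h)
    (twistInv X)
    (lin_ext fun g v hv => by
      simp only [mkHom, LinearMap.comp_apply, twistLin_apply hv, twistInv_apply hv.act_self]
      exact hv.inv_act g)
    (lin_ext fun g v hv => by
      have h : X.IsDeg g (X.act g⁻¹ v) := by
        have := hv.act g⁻¹
        simpa using this
      simp only [mkHom, LinearMap.comp_apply, twistInv_apply hv, map_smul, twistLin_apply h]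
      have := hv.act_inv g
      simpa using this)

/-- The canonical twist `θ_X(x) = f.x`, for `x` of degree `f`, of `Z(G, α)`. -/
def twist (α : Cocycle3 k G) : 𝟭 (ZObj α) ≅ 𝟭 (ZObj α) :=
  NatIso.ofComponents twistIso fun {X Y} φ => hom_ext <| lin_ext fun g v hv => by
    change X.V at v
    change X.IsDeg g v at hv
    change twistLin Y (φ.lin v) = φ.lin (twistLin X v)
    rw [twistLin_apply hv, twistLin_apply (hv.map φ), φ.act_comm]

/-! ### Duals -/

/-- The action of a group element as an invertible map. -/
noncomputable def actEquiv (X : ZObj α) (g : G) : X.V ≃ₗ[k] X.V :=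
  LinearEquiv.ofInjectiveEndo (X.act g) (X.act_injective g)

/-- The contragredient action. -/
noncomputable def dAct (X : ZObj α) (g : G) : Module.Dual k X.V →ₗ[k] Module.Dual k X.V :=
  ∑ f, ((α.one g f f⁻¹)⁻¹ : k) • (X.proj f⁻¹ ∘ₗ (X.actEquiv g).symm.toLinearMap).dualMap

theorem dual_deg {X : ZObj α} {f : G} {l : Module.Dual k X.V} (hl : (X.proj f⁻¹).dualMap l = l)
    {h : G} {v : X.V} (hv : X.IsDeg h v) (hn : h ≠ f⁻¹) : l v = 0 := by
  rw [← hl, LinearMap.dualMap_apply, hv.proj_ne hn.symm, map_zero]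

theorem dAct_apply {X : ZObj α} {f : G} {l : Module.Dual k X.V}
    (hl : (X.proj f⁻¹).dualMap l = l) (g : G) (v : X.V) :
    dAct X g l (X.act g v) = ((α.one g f f⁻¹)⁻¹ : k) * l v := by
  have e : (X.actEquiv g).symm (X.act g v) = v := (X.actEquiv g).symm_apply_apply v
  simp only [dAct, LinearMap.sum_apply, LinearMap.smul_apply, LinearMap.dualMap_apply,
    LinearMap.comp_apply, LinearEquiv.coe_coe, e, smul_eq_mul]
  rw [Finset.sum_eq_single f]
  · congr 1; exact LinearMap.congr_fun hl v
  · intro h _ hn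
    rw [dual_deg hl (X.isDeg_proj _ _) (by simpa using hn), mul_zero]
  · simp

theorem sum_proj_inv (X : ZObj α) (v : X.V) : ∑ g, X.proj g⁻¹ v = v :=
  (Equiv.sum_comp (Equiv.inv G) (fun g => X.proj g v)).trans (X.sum_proj v)

theorem dual_induction {X : ZObj α} {P : Module.Dual k X.V → Prop} (h0 : P 0)
    (ha : ∀ v w, P v → P w → P (v + w))
    (hd : ∀ g l, (X.proj g⁻¹).dualMap l = l → P l) (l : Module.Dual k X.V) : P l := by
  have e : ∑ g, (X.proj g⁻¹).dualMap l = l := by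
    ext v
    simp only [LinearMap.sum_apply, LinearMap.dualMap_apply, ← map_sum]
    rw [X.sum_proj_inv]
  rw [← e]
  exact Finset.sum_induction _ P ha h0 fun g _ => hd g _ <| by
    ext v; simp [LinearMap.dualMap_apply, X.proj_self]

theorem dAct_proj (X : ZObj α) (f g : G) (l : Module.Dual k X.V) :
    dAct X f ((X.proj g⁻¹).dualMap l) = (X.proj (f * g * f⁻¹)⁻¹).dualMap (dAct X f l) := by
  induction l using dual_induction with
  | h0 => simp
  | ha v w hv hw => simp only [map_add, hv, hw]
  | hd h l hl =>
    refine LinearMap.ext fun w => ?_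
    obtain ⟨v, rfl⟩ := (X.actEquiv f).surjective w
    change dAct X f ((X.proj g⁻¹).dualMap l) (X.act f v) = dAct X f l (X.proj _ (X.act f v))
    rw [show (f * g * f⁻¹)⁻¹ = f * g⁻¹ * f⁻¹ by group, ← X.act_proj, dAct_apply hl]
    by_cases e : g = h
    · rw [e, hl, dAct_apply hl, ← LinearMap.dualMap_apply, hl]
    · have e' : (X.proj g⁻¹).dualMap l = 0 := by
        ext v
        rw [LinearMap.dualMap_apply, dual_deg hl (X.isDeg_proj _ _) (by simpa using e)]; rfl
      rw [e', map_zero]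
      have := LinearMap.congr_fun e' v
      rw [LinearMap.dualMap_apply] at this
      rw [this]; simp

/-- The dual object. -/
@[reducible] noncomputable def dual (X : ZObj α) : ZObj α where
  V := Module.Dual k X.V
  proj g := (X.proj g⁻¹).dualMap
  proj_self g l := by ext v; simp [LinearMap.dualMap_apply, X.proj_self]
  proj_ne g h hn l := by
    ext v
    simp [LinearMap.dualMap_apply, X.proj_ne h⁻¹ g⁻¹ (by simpa using hn.symm)]
  sum_proj l := by
    ext v
    simp only [LinearMap.sum_apply, LinearMap.dualMap_apply, ← map_sum]
    rw [X.sum_proj_inv]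
  act := dAct X
  act_one l := by
    induction l using dual_induction with
    | h0 => simp
    | ha v w hv hw => simp only [map_add, hv, hw]
    | hd h l hl =>
      ext v
      have := dAct_apply hl 1 v
      simpa [X.act_one] using this
  act_proj := dAct_proj X
  act_mul f g h l := by
    have hl : (X.proj h⁻¹).dualMap ((X.proj h⁻¹).dualMap l) = (X.proj h⁻¹).dualMap l := by
      ext v; simp [LinearMap.dualMap_apply, X.proj_self]
    have hl' := dAct_proj X g h ((X.proj h⁻¹).dualMap l)
    rw [hl] at hl'
    generalize (X.proj h⁻¹).dualMap l = m at hl hl'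
    refine LinearMap.ext fun w => ?_
    obtain ⟨v, rfl⟩ := (X.actEquiv (f * g)).surjective w
    change dAct X (f * g) m (X.act (f * g) v) = _ * dAct X f (dAct X g m) (X.act (f * g) v)
    rw [dAct_apply hl]
    induction v using deg_induction with
    | h0 => simp
    | ha v w hv hw => simp only [map_add, mul_add, hv, hw]
    | hd a v hv =>
      rw [hv.act_mul f g, map_smul, dAct_apply hl'.symm, dAct_apply hl]
      by_cases e : a = h⁻¹
      · subst e
        have := congrArg (Units.val) (α.one_two f g h h⁻¹)
        rw [mul_inv_cancel, α.two_one, one_mul] at this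
        push_cast at this
        rw [show (g * h * g⁻¹)⁻¹ = g * h⁻¹ * g⁻¹ by group]
        simp only [smul_eq_mul]
        field_simp
        linear_combination (-(m v)) * this
      · rw [dual_deg hl hv e]; simp

/-- The evaluation `Xᵛ ⊗ X ⟶ 1`. -/
noncomputable def ev (X : ZObj α) : tensor (dual X) X ⟶ unit α where
  lin := contractLeft k X.V
  proj_comm g t := by
    classical
    refine LinearMap.congr_fun (f := contractLeft k X.V ∘ₗ tProj (dual X) X g)
      (g := (unit α).proj g ∘ₗ contractLeft k X.V) (tens_ext fun a l hl b v hv => ?_) t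
    simp only [LinearMap.comp_apply, tProj_tmul hl hv]
    by_cases e : b = a⁻¹
    · subst e
      by_cases e' : g = 1 <;> simp [e']
    · have := dual_deg hl hv e
      split_ifs <;> simp [contractLeft_apply, this]
  act_comm g t := by
    refine LinearMap.congr_fun (f := contractLeft k X.V ∘ₗ tAct (dual X) X g)
      (g := contractLeft k X.V) (tens_ext fun a l hl b v hv => ?_) t
    simp only [LinearMap.comp_apply, tAct_tmul hl hv, map_smul, contractLeft_apply]
    have h : (dual X).act g l (X.act g v) = ((α.one g a a⁻¹)⁻¹ : k) * l v := dAct_apply hl g v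
    by_cases e : b = a⁻¹
    · subst e
      rw [h]; simp
    · rw [h, dual_deg hl hv e]; simp

/-- The image of `1` under the coevaluation. -/
noncomputable def coevEl (X : ZObj α) : X.V ⊗[k] Module.Dual k X.V :=
  ∑ f, ∑ i, (α f f⁻¹ f : k) •
    (X.proj f (Module.finBasis k X.V i) ⊗ₜ ((Module.finBasis k X.V).coord i ∘ₗ X.proj f))

theorem isDeg_coord (X : ZObj α) (f : G) (l : Module.Dual k X.V) :
    (dual X).IsDeg f⁻¹ (l ∘ₗ X.proj f) := by
  change (X.proj (f⁻¹)⁻¹).dualMap _ = _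
  ext v
  simp [LinearMap.dualMap_apply, X.proj_self]

theorem coord_sum (X : ZObj α) (v : X.V) :
    ∑ i, (Module.finBasis k X.V).coord i v • Module.finBasis k X.V i = v :=
  (Module.finBasis k X.V).sum_repr v

theorem contract_coord {W : Type*} [AddCommGroup W] [Module k W] (X : ZObj α) (T : X.V →ₗ[k] W)
    (v : X.V) : ∑ i, (Module.finBasis k X.V).coord i v • T (Module.finBasis k X.V i) = T v := by
  conv_rhs => rw [← X.coord_sum v]
  simp only [map_sum, map_smul]

theorem dualTensorHom_injective (V : Type*) [AddCommGroup V] [Module k V] [Module.Finite k V] :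
    Function.Injective (dualTensorHom k V V ∘ₗ (TensorProduct.comm k V (Module.Dual k V)).toLinearMap)
    := by
  rw [LinearMap.coe_comp]
  exact (dualTensorHomEquiv k V V).injective.comp (TensorProduct.comm k _ _).injective

theorem coevEl_act (X : ZObj α) (g : G) : tAct X (dual X) g X.coevEl = X.coevEl := by
  refine dualTensorHom_injective X.V (LinearMap.ext fun w => ?_)
  obtain ⟨v, rfl⟩ := (X.actEquiv g).surjective w
  have key : ∀ (f : G) (i), (α f f⁻¹ f : k) •
      ((dualTensorHom k X.V X.V ∘ₗ (TensorProduct.comm k X.V (Module.Dual k X.V)).toLinearMap)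
        (tAct X (dual X) g (X.proj f (Module.finBasis k X.V i) ⊗ₜ
          ((Module.finBasis k X.V).coord i ∘ₗ X.proj f))) (X.act g v)) =
      (α (g * f * g⁻¹) (g * f * g⁻¹)⁻¹ (g * f * g⁻¹) : k) •
      ((Module.finBasis k X.V).coord i (X.proj f v) • X.act g (X.proj f (Module.finBasis k X.V i)))
      := by
    intro f i
    rw [tAct_tmul (X.isDeg_proj _ _) (X.isDeg_coord _ _)]
    have h := dAct_apply (X.isDeg_coord f ((Module.finBasis k X.V).coord i)) g v
    simp only [map_smul, LinearMap.smul_apply, LinearMap.comp_apply, LinearEquiv.coe_coe,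
      TensorProduct.comm_tmul, dualTensorHom_apply] at h ⊢
    rw [h, inv_inv]
    simp only [smul_smul]
    congr 1
    have := congrArg (Units.val) (α.one_assoc g f f⁻¹ f)
    rw [mul_inv_cancel, inv_mul_cancel, α.one_one_left, α.one_one_right,
      show g * f⁻¹ * g⁻¹ = (g * f * g⁻¹)⁻¹ by group] at this
    push_cast at this
    field_simp
    linear_combination ((Module.finBasis k X.V).coord i (X.proj f v)) * this
  have key' : ∀ (f : G), ∑ i, (α f f⁻¹ f : k) •
      ((dualTensorHom k X.V X.V ∘ₗ (TensorProduct.comm k X.V (Module.Dual k X.V)).toLinearMap)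
        (X.proj f (Module.finBasis k X.V i) ⊗ₜ
          ((Module.finBasis k X.V).coord i ∘ₗ X.proj f)) (X.act g v)) =
      (α f f⁻¹ f : k) • X.proj f (X.act g v) := by
    intro f
    simp only [LinearMap.comp_apply, LinearEquiv.coe_coe,
      TensorProduct.comm_tmul, dualTensorHom_apply]
    rw [← Finset.smul_sum, X.contract_coord (X.proj f), X.proj_self]
  change (dualTensorHom k X.V X.V ∘ₗ
    (TensorProduct.comm k X.V (Module.Dual k X.V)).toLinearMap) _ (X.act g v) =
    (dualTensorHom k X.V X.V ∘ₗ
    (TensorProduct.comm k X.V (Module.Dual k X.V)).toLinearMap) _ (X.act g v)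
  simp only [coevEl, map_sum, map_smul, LinearMap.sum_apply, LinearMap.smul_apply, key, key']
  rw [← Equiv.sum_comp (MulAut.conj g).toEquiv
    (fun f => (α f f⁻¹ f : k) • X.proj f (X.act g v))]
  refine Finset.sum_congr rfl fun f _ => ?_
  have h := X.contract_coord (X.act g ∘ₗ X.proj f) (X.proj f v)
  simp only [LinearMap.comp_apply] at h
  rw [← Finset.smul_sum, h]
  simp [X.proj_self, X.act_proj]

/-- The coevaluation `1 ⟶ X ⊗ Xᵛ`. -/
noncomputable def coev (X : ZObj α) : unit α ⟶ tensor X (dual X) where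
  lin := LinearMap.toSpanSingleton k _ X.coevEl
  proj_comm g c := by
    classical
    have : tProj X (dual X) g X.coevEl = if g = 1 then X.coevEl else 0 := by
      simp only [coevEl, map_sum, map_smul,
        tProj_tmul (X.isDeg_proj _ _) (X.isDeg_coord _ _), mul_inv_cancel]
      split_ifs <;> simp
    simp only [LinearMap.toSpanSingleton_apply, map_smul, this]
    by_cases e : g = 1 <;> simp [e]
  act_comm g c := by
    simp only [LinearMap.toSpanSingleton_apply, map_smul]
    rw [show (tensor X (dual X)).act g X.coevEl = X.coevEl from X.coevEl_act g]
    rfl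

/-- `Xᵛ` is dual to `X`. -/
noncomputable instance exactPairing (X : ZObj α) : ExactPairing X (dual X) where
  coevaluation' := coev X
  evaluation' := ev X
  coevaluation_evaluation' := hom_ext <| tens_ext fun a l hl b c _ => by
    change k at c
    change TensorProduct.map (contractLeft k X.V) LinearMap.id
      (assocInv (dual X) X (dual X) (l ⊗ₜ (c • X.coevEl))) = (1 : k) ⊗ₜ[k] (c • l)
    simp only [coevEl, TensorProduct.tmul_smul, TensorProduct.tmul_sum, map_smul, map_sum]
    congr 1
    have h : ∀ f i, (α f f⁻¹ f : k) • TensorProduct.map (contractLeft k X.V) LinearMap.id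
        (assocInv (dual X) X (dual X) (l ⊗ₜ ((X.proj f (Module.finBasis k X.V i)) ⊗ₜ
          ((Module.finBasis k X.V).coord i ∘ₗ X.proj f)))) =
        (α f f⁻¹ f * α a f f⁻¹ : k) • ((1 : k) ⊗ₜ[k] (l (X.proj f (Module.finBasis k X.V i)) •
          (Module.finBasis k X.V).coord i ∘ₗ X.proj f)) := by
      intro f i
      rw [assocInv_tmul hl (X.isDeg_proj _ _) (X.isDeg_coord _ _), map_smul, smul_smul,
        TensorProduct.map_tmul]
      congr 1
      rw [← TensorProduct.smul_tmul]
      simp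
    simp only [h]
    rw [Finset.sum_eq_single a⁻¹]
    · rw [inv_inv, ← Units.val_mul, α.mul_inv_self a]
      simp only [Units.val_one, one_smul]
      rw [← TensorProduct.tmul_sum]
      congr 1
      refine LinearMap.ext fun v => ?_
      have h' := X.contract_coord (l ∘ₗ X.proj a⁻¹) (X.proj a⁻¹ v)
      simp only [LinearMap.comp_apply, X.proj_self] at h'
      have h2 : l (X.proj a⁻¹ v) = l v := LinearMap.congr_fun hl v
      rw [← h2, ← h']
      simp [mul_comm]
    · intro f _ hn
      simp [dual_deg hl (X.isDeg_proj _ _) hn]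
    · simp
  evaluation_coevaluation' := hom_ext <| tens_ext fun b c _ a v hv => by
    change k at c
    change TensorProduct.map LinearMap.id (contractLeft k X.V)
      (assocHom X (dual X) X ((c • X.coevEl) ⊗ₜ v)) = (c • v) ⊗ₜ[k] (1 : k)
    rw [← TensorProduct.smul_tmul', map_smul, map_smul, ← TensorProduct.smul_tmul']
    congr 1
    have h : ∀ f i, (α f f⁻¹ f : k) • TensorProduct.map LinearMap.id (contractLeft k X.V)
        (assocHom X (dual X) X (((X.proj f (Module.finBasis k X.V i)) ⊗ₜ
          ((Module.finBasis k X.V).coord i ∘ₗ X.proj f)) ⊗ₜ v)) =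
        ((α f f⁻¹ f : k) * (α f f⁻¹ a : k)⁻¹) • (((Module.finBasis k X.V).coord i (X.proj f v) •
          X.proj f (Module.finBasis k X.V i)) ⊗ₜ[k] (1 : k)) := by
      intro f i
      rw [assocHom_tmul (X.isDeg_proj _ _) (X.isDeg_coord _ _) hv, map_smul, smul_smul,
        TensorProduct.map_tmul, TensorProduct.smul_tmul]
      simp
    simp only [coevEl, TensorProduct.sum_tmul, ← TensorProduct.smul_tmul', map_sum, map_smul]
    simp only [h]
    rw [Finset.sum_eq_single a]
    · have h' := X.contract_coord (X.proj a) v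
      rw [mul_inv_cancel₀ (Units.ne_zero _)]
      simp only [one_smul]
      rw [← TensorProduct.sum_tmul, show X.proj a v = v from hv, h', show X.proj a v = v from hv]
    · intro f _ hn
      simp [hv.proj_ne hn]
    · simp

end ZObj

namespace ZObj

variable {k G : Type u} [Field k] [Group G] [Fintype G] {α : Cocycle3 k G}

/-! ### Coequalisers -/

/-- The quotient of an object by a subspace stable under the projections and the action. -/
@[reducible] noncomputable def quot (Y : ZObj α) (S : Submodule k Y.V)
    (hp : ∀ g, S ≤ S.comap (Y.proj g)) (ha : ∀ g, S ≤ S.comap (Y.act g)) : ZObj α where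
  V := Y.V ⧸ S
  proj g := S.mapQ S (Y.proj g) (hp g)
  proj_self g v := by
    obtain ⟨v, rfl⟩ := S.mkQ_surjective v
    simp [Y.proj_self]
  proj_ne g h hn v := by
    obtain ⟨v, rfl⟩ := S.mkQ_surjective v
    simp [Y.proj_ne g h hn]
  sum_proj v := by
    obtain ⟨v, rfl⟩ := S.mkQ_surjective v
    simp only [Submodule.mkQ_apply, Submodule.mapQ_apply]
    rw [← Submodule.mkQ_apply]
    conv_rhs => rw [← Y.sum_proj v, map_sum]
    rfl
  act g := S.mapQ S (Y.act g) (ha g)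
  act_one v := by
    obtain ⟨v, rfl⟩ := S.mkQ_surjective v
    simp [Y.act_one]
  act_proj f g v := by
    obtain ⟨v, rfl⟩ := S.mkQ_surjective v
    simp [Y.act_proj]
  act_mul f g h v := by
    obtain ⟨v, rfl⟩ := S.mkQ_surjective v
    simp [Y.act_mul]

open Limits

variable {X Y : ZObj α} (φ ψ : X ⟶ Y)

/-- The coequaliser of two morphisms. -/
noncomputable def coeq : ZObj α :=
  quot Y (LinearMap.range (φ.lin - ψ.lin))
    (by rintro g _ ⟨v, rfl⟩; exact ⟨X.proj g v, by simp [φ.proj_comm, ψ.proj_comm]⟩)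
    (by rintro g _ ⟨v, rfl⟩; exact ⟨X.act g v, by simp [φ.act_comm, ψ.act_comm]⟩)

/-- The projection to the coequaliser. -/
noncomputable def coeqπ : Y ⟶ coeq φ ψ where
  lin := Submodule.mkQ _
  proj_comm _ _ := rfl
  act_comm _ _ := rfl

theorem coeq_condition : φ ≫ coeqπ φ ψ = ψ ≫ coeqπ φ ψ := hom_ext <| by
  ext v
  exact (Submodule.Quotient.eq _).2 ⟨v, rfl⟩

/-- The universal property of the coequaliser. -/
noncomputable def coeqDesc {Z : ZObj α} (χ : Y ⟶ Z) (h : φ ≫ χ = ψ ≫ χ) : coeq φ ψ ⟶ Z where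
  lin := Submodule.liftQ _ χ.lin <| by
    rintro _ ⟨v, rfl⟩
    have := LinearMap.congr_fun (congrArg Hom.lin h) v
    simpa [sub_eq_zero] using this
  proj_comm g v := by
    obtain ⟨v, rfl⟩ := Submodule.mkQ_surjective _ v
    exact χ.proj_comm g v
  act_comm g v := by
    obtain ⟨v, rfl⟩ := Submodule.mkQ_surjective _ v
    exact χ.act_comm g v

instance : HasCoequalizers (ZObj α) :=
  haveI {X Y : ZObj α} {φ ψ : X ⟶ Y} : HasColimit (parallelPair φ ψ) :=
    ⟨⟨⟨_, Cofork.IsColimit.mk (Cofork.ofπ (coeqπ φ ψ) (coeq_condition φ ψ))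
      (fun s => coeqDesc φ ψ s.π s.condition)
      (fun s => hom_ext rfl)
      (fun s m hm => hom_ext <| LinearMap.ext fun v => by
        obtain ⟨v, rfl⟩ := Submodule.mkQ_surjective _ v
        exact LinearMap.congr_fun (congrArg Hom.lin hm) v)⟩⟩⟩
  hasCoequalizers_of_hasColimit_parallelPair _

instance (X : ZObj α) : PreservesColimitsOfSize.{0, 0} (tensorLeft X) :=
  letI := BraidedCategory.exactPairing_swap X (dual X)
  (tensorLeftAdjunction (dual X) X).leftAdjoint_preservesColimits

instance (X : ZObj α) : PreservesColimitsOfSize.{0, 0} (tensorRight X) :=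
  (tensorRightAdjunction X (dual X)).leftAdjoint_preservesColimits

end ZObj

/-! ### Right modules over a commutative algebra in a braided category -/

section Modules

open Limits MonObj

universe v₁ u₁

variable {C : Type u₁} [Category.{v₁} C] [MonoidalCategory.{v₁} C]

section Bimodules

variable [HasCoequalizers C] [∀ X : C, PreservesColimitsOfSize.{0, 0} (tensorLeft X)]
  [∀ X : C, PreservesColimitsOfSize.{0, 0} (tensorRight X)] (R : Mon C)

/-- Bimodules over `R`, with the relative tensor product, form a monoidal category. -/
noncomputable instance bimodMonoidal : MonoidalCategory (Bimod R R) where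
  tensorObj M N := M.tensorBimod N
  whiskerLeft M _ _ f := Bimod.whiskerLeft M f
  whiskerRight f N := Bimod.whiskerRight f N
  tensorUnit := Bimod.regular R
  associator M N L := Bimod.associatorBimod M N L
  leftUnitor M := Bimod.leftUnitorBimod M
  rightUnitor M := Bimod.rightUnitorBimod M
  tensorHom f g := Bimod.whiskerRight f _ ≫ Bimod.whiskerLeft _ g
  tensorHom_def _ _ := rfl
  id_tensorHom_id M N := by
    rw [Bimod.id_whiskerRight_bimod, Bimod.whiskerLeft_id_bimod]; simp
  tensorHom_comp_tensorHom f g f' g' := by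
    rw [Bimod.comp_whiskerRight_bimod, Bimod.whiskerLeft_comp_bimod]
    simp only [Category.assoc]
    congr 1
    rw [← Category.assoc, Bimod.whisker_exchange_bimod, Category.assoc]
  whiskerLeft_id _ _ := Bimod.whiskerLeft_id_bimod
  id_whiskerRight _ _ := Bimod.id_whiskerRight_bimod
  associator_naturality {X₁ X₂ X₃ Y₁ Y₂ Y₃} f g h := by
    rw [Bimod.comp_whiskerRight_bimod, Bimod.whiskerRight_comp_bimod, Bimod.whisker_assoc_bimod,
      Bimod.comp_whiskerLeft_bimod, Bimod.whiskerLeft_comp_bimod]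
    simp
  leftUnitor_naturality f := by
    rw [Bimod.id_whiskerLeft_bimod]; simp
  rightUnitor_naturality f := by
    rw [Bimod.whiskerRight_id_bimod]; simp
  pentagon := Bimod.pentagon_bimod
  triangle := Bimod.triangle_bimod

variable {R}

theorem id_tensor_id_comp {X Y Z : C} (h : X ⊗ Y ⟶ Z) : (𝟙 X ⊗ₘ 𝟙 Y) ≫ h = h := by simp

theorem comp_glue {a b c c' d d' x y : C} {p : a ⟶ b} {q : b ⟶ c} {q' : b ⟶ c'} {i : c ⟶ c'}
    {s : c' ⟶ d'} {j : d' ⟶ d} {r' : y ⟶ d'} {r : y ⟶ d} {t : a ⟶ x} {l : x ⟶ y}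
    (h₁ : q ≫ i = q') (h₂ : r' ≫ j = r) (h₃ : p ≫ q' ≫ s = t ≫ l ≫ r') :
    p ≫ q ≫ i ≫ s ≫ j = t ≫ l ≫ r := by
  rw [← h₂, ← Category.assoc q, h₁, ← Category.assoc q', ← Category.assoc p, h₃]
  simp

/-- The projection from the tensor product of bimodules to the relative tensor product. -/
noncomputable def bimodπ (P Q : Bimod R R) : P.X ⊗ Q.X ⟶ Bimod.X (P ⊗ Q) :=
  coequalizer.π (P.actRight ▷ Q.X) ((α_ _ _ _).hom ≫ P.X ◁ Q.actLeft)

theorem bimodπ_tensorHom {P P' Q Q' : Bimod R R} (f : P ⟶ P') (g : Q ⟶ Q') :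
    bimodπ P Q ≫ Bimod.Hom.hom (f ⊗ₘ g) = (f.hom ⊗ₘ g.hom) ≫ bimodπ P' Q' := by
  have h₁ : bimodπ P Q ≫ (Bimod.whiskerRight f Q).hom = f.hom ▷ Q.X ≫ bimodπ P' Q :=
    ι_colimMap _ _
  have h₂ : bimodπ P' Q ≫ (Bimod.whiskerLeft P' g).hom = P'.X ◁ g.hom ≫ bimodπ P' Q' :=
    ι_colimMap _ _
  rw [MonoidalCategory.tensorHom_def f.hom, Category.assoc, ← h₂, ← Category.assoc,
    ← h₁, Category.assoc]
  rfl

theorem bimodπ_associator (P Q L : Bimod R R) :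
    bimodπ P Q ▷ L.X ≫ bimodπ (P ⊗ Q) L ≫ (α_ P Q L).hom.hom =
      (α_ P.X Q.X L.X).hom ≫ P.X ◁ bimodπ Q L ≫ bimodπ P (Q ⊗ L) := by
  have h₁ : bimodπ (P ⊗ Q) L ≫ (α_ P Q L).hom.hom = Bimod.AssociatorBimod.homAux P Q L :=
    coequalizer.π_desc _ _
  rw [h₁]
  exact π_tensor_id_preserves_coequalizer_inv_desc _ _ _ _

theorem bimodπ_leftUnitor (P : Bimod R R) :
    bimodπ (𝟙_ _) P ≫ (λ_ P).hom.hom = P.actLeft :=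
  coequalizer.π_desc _ _

theorem bimodπ_rightUnitor (P : Bimod R R) :
    bimodπ P (𝟙_ _) ≫ (ρ_ P).hom.hom = P.actRight :=
  coequalizer.π_desc _ _

end Bimodules

/-- Right modules over an algebra `A` in a monoidal category. -/
structure RMod (A : C) [MonObj A] where
  /-- The underlying object. -/
  X : C
  act : X ⊗ A ⟶ X
  act_one : X ◁ η[A] ≫ act = (ρ_ X).hom
  act_mul : X ◁ μ[A] ≫ act = (α_ X A A).inv ≫ act ▷ A ≫ act

namespace RMod

variable {A : C} [MonObj A]

/-- Morphisms of right modules. -/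
@[ext]
structure Hom (M N : RMod A) where
  hom : M.X ⟶ N.X
  act_hom : M.act ≫ hom = hom ▷ A ≫ N.act

instance : Category (RMod A) where
  Hom := Hom
  id M := ⟨𝟙 M.X, by simp⟩
  comp f g := ⟨f.hom ≫ g.hom, by rw [← Category.assoc, f.act_hom]; simp [g.act_hom]⟩

@[ext] theorem hom_ext {M N : RMod A} {f g : M ⟶ N} (h : f.hom = g.hom) : f = g := Hom.ext h
@[simp] theorem id_hom (M : RMod A) : Hom.hom (𝟙 M) = 𝟙 M.X := rfl
@[simp] theorem comp_hom {M N L : RMod A} (f : M ⟶ N) (g : N ⟶ L) :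
    (f ≫ g).hom = f.hom ≫ g.hom := rfl

variable [BraidedCategory C]

/-- The left action on a right module given by the braiding. -/
def actLeft (M : RMod A) : A ⊗ M.X ⟶ M.X := (β_ A M.X).hom ≫ M.act

/-- A right module is local if its action is unchanged by the double braiding. -/
def IsLocal (A : C) [MonObj A] : ObjectProperty (RMod A) :=
  fun M => (β_ M.X A).hom ≫ (β_ A M.X).hom ≫ M.act = M.act

variable [IsCommMonObj A]

theorem actLeft_hom {M N : RMod A} (f : M ⟶ N) :
    M.actLeft ≫ f.hom = A ◁ f.hom ≫ N.actLeft := by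
  simp only [actLeft, Category.assoc]
  rw [f.act_hom, BraidedCategory.braiding_naturality_right_assoc]

/-- A right module over a commutative algebra as a bimodule. -/
@[simps, reducible]
def toBimodObj (M : RMod A) : Bimod (Mon.mk A) (Mon.mk A) where
  X := M.X
  actLeft := M.actLeft
  actRight := M.act
  one_actLeft := by
    simp only [actLeft]
    rw [BraidedCategory.braiding_naturality_left_assoc, M.act_one, braiding_rightUnitor]
  left_assoc := by
    simp only [actLeft]
    rw [BraidedCategory.braiding_naturality_left_assoc, ← IsCommMonObj.mul_comm A,
      whiskerLeft_comp_assoc, M.act_mul]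
    simp only [whiskerLeft_comp, Category.assoc]
    rw [BraidedCategory.braiding_naturality_right_assoc,
      BraidedCategory.braiding_tensor_right_hom, BraidedCategory.braiding_tensor_left_hom]
    simp only [Category.assoc]
  actRight_one := M.act_one
  right_assoc := M.act_mul
  middle_assoc := by
    simp only [actLeft, comp_whiskerRight, whiskerLeft_comp, Category.assoc]
    rw [BraidedCategory.braiding_naturality_right_assoc,
      BraidedCategory.braiding_tensor_right_hom]
    simp only [Category.assoc, Iso.hom_inv_id_assoc]
    rw [← M.act_mul, ← whiskerLeft_comp_assoc, IsCommMonObj.mul_comm, M.act_mul]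
    simp

variable (A) in
/-- Right modules over a commutative algebra embed into bimodules. -/
@[simps, reducible]
def toBimod : RMod A ⥤ Bimod (Mon.mk A) (Mon.mk A) where
  obj M := M.toBimodObj
  map {M N} f :=
    { hom := f.hom
      left_act_hom := actLeft_hom f
      right_act_hom := f.act_hom }

variable (A) in
/-- The embedding of right modules into bimodules is fully faithful. -/
def toBimodFullyFaithful : (toBimod A).FullyFaithful where
  preimage f := ⟨f.hom, f.right_act_hom⟩

instance : (toBimod A).Faithful := (toBimodFullyFaithful A).faithful

section Monoidal

variable [HasCoequalizers C] [∀ X : C, PreservesColimitsOfSize.{0, 0} (tensorLeft X)]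
  [∀ X : C, PreservesColimitsOfSize.{0, 0} (tensorRight X)]

/-- The relative tensor product `M ⊗_A N`, with the action of `A` coming from `N`. -/
@[reducible]
noncomputable def tensor (M N : RMod A) : RMod A where
  X := Bimod.TensorBimod.X M.toBimodObj N.toBimodObj
  act := Bimod.TensorBimod.actRight M.toBimodObj N.toBimodObj
  act_one := Bimod.TensorBimod.actRight_one' M.toBimodObj N.toBimodObj
  act_mul := Bimod.TensorBimod.right_assoc' M.toBimodObj N.toBimodObj

/-- The projection from the tensor product to the relative tensor product. -/
noncomputable def π (M N : RMod A) : M.X ⊗ N.X ⟶ (tensor M N).X :=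
  coequalizer.π (M.act ▷ N.X) ((α_ _ _ _).hom ≫ M.X ◁ N.actLeft)

instance (M N : RMod A) : Epi (π M N) := inferInstanceAs (Epi (coequalizer.π _ _))

instance {X : C} (M N : RMod A) : Epi (π M N ▷ X) :=
  inferInstanceAs (Epi ((tensorRight X).map (π M N)))

instance {X : C} (M N : RMod A) : Epi (X ◁ π M N) :=
  inferInstanceAs (Epi ((tensorLeft X).map (π M N)))

theorem π_cond (M N : RMod A) :
    M.act ▷ N.X ≫ π M N = (α_ _ _ _).hom ≫ M.X ◁ N.actLeft ≫ π M N := by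
  have h := coequalizer.condition (M.act ▷ N.X) ((α_ _ _ _).hom ≫ M.X ◁ N.actLeft)
  rw [Category.assoc] at h
  exact h

theorem π_act (M N : RMod A) :
    π M N ▷ A ≫ (tensor M N).act = (α_ _ _ _).hom ≫ M.X ◁ N.act ≫ π M N :=
  Bimod.TensorBimod.π_tensor_id_actRight M.toBimodObj N.toBimodObj

theorem π_bimodActLeft (M N : RMod A) :
    A ◁ π M N ≫ Bimod.TensorBimod.actLeft M.toBimodObj N.toBimodObj =
      (α_ _ _ _).inv ≫ M.actLeft ▷ N.X ≫ π M N :=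
  Bimod.TensorBimod.whiskerLeft_π_actLeft M.toBimodObj N.toBimodObj

theorem π_actLeft (M N : RMod A) :
    A ◁ π M N ≫ (tensor M N).actLeft = (α_ _ _ _).inv ≫ M.actLeft ▷ N.X ≫ π M N := by
  rw [actLeft, BraidedCategory.braiding_naturality_right_assoc, π_act,
    BraidedCategory.braiding_tensor_right_hom]
  simp only [Category.assoc, Iso.inv_hom_id_assoc]
  rw [← whiskerLeft_comp_assoc]
  simp only [actLeft, comp_whiskerRight, Category.assoc]
  rw [π_cond]
  rfl

theorem tensor_actLeft (M N : RMod A) :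
    (tensor M N).actLeft = Bimod.TensorBimod.actLeft M.toBimodObj N.toBimodObj := by
  exact (cancel_epi (A ◁ π M N)).1 ((π_actLeft M N).trans (π_bimodActLeft M N).symm)

/-- The embedding into bimodules takes the relative tensor product to that of bimodules. -/
noncomputable def toBimodTensor (M N : RMod A) :
    M.toBimodObj.tensorBimod N.toBimodObj ≅ (tensor M N).toBimodObj :=
  Bimod.isoOfIso (Iso.refl _)
    ((Category.comp_id _).trans <| (tensor_actLeft M N).symm.trans <| by
      exact ((congrArg (· ≫ _) (whiskerLeft_id _ _)).trans (Category.id_comp _)).symm)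
    ((Category.comp_id _).trans <| by
      exact ((congrArg (· ≫ _) (id_whiskerRight _ _)).trans (Category.id_comp _)).symm)

/-- The unit for the relative tensor product: `A` acting on itself by multiplication. -/
@[reducible]
def unit (A : C) [MonObj A] : RMod A where
  X := A
  act := μ
  act_one := MonObj.mul_one A
  act_mul := by simp

theorem unit_actLeft : (unit A).actLeft = μ := IsCommMonObj.mul_comm A

/-- The embedding into bimodules takes the unit to the unit. -/
def toBimodUnit : Bimod.regular (Mon.mk A) ≅ (unit A).toBimodObj :=
  Bimod.isoOfIso (Iso.refl _)
    ((Category.comp_id _).trans <| unit_actLeft.symm.trans <| by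
      exact ((congrArg (· ≫ _) (whiskerLeft_id _ _)).trans (Category.id_comp _)).symm)
    ((Category.comp_id _).trans <| by
      exact ((congrArg (· ≫ _) (id_whiskerRight _ _)).trans (Category.id_comp _)).symm)

noncomputable instance : MonoidalCategoryStruct (RMod A) where
  tensorObj := tensor
  tensorUnit := unit A
  whiskerLeft M _ _ f := (toBimodFullyFaithful A).preimage
    ((toBimodTensor _ _).inv ≫ (M.toBimodObj ◁ (toBimod A).map f :) ≫ (toBimodTensor _ _).hom)
  whiskerRight f M := (toBimodFullyFaithful A).preimage
    ((toBimodTensor _ _).inv ≫ ((toBimod A).map f ▷ M.toBimodObj :) ≫ (toBimodTensor _ _).hom)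
  tensorHom f g := (toBimodFullyFaithful A).preimage
    ((toBimodTensor _ _).inv ≫ ((toBimod A).map f ⊗ₘ (toBimod A).map g) ≫ (toBimodTensor _ _).hom)
  associator M N L := (toBimodFullyFaithful A).preimageIso
    ((((toBimodTensor (tensor M N) L).symm ≪≫ ((toBimodTensor M N).symm ⊗ᵢ .refl _))
        ≪≫ α_ (M.toBimodObj) N.toBimodObj L.toBimodObj
        ≪≫ ((.refl _ ⊗ᵢ toBimodTensor N L) ≪≫ toBimodTensor M (tensor N L))))
  leftUnitor M := (toBimodFullyFaithful A).preimageIso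
    (((toBimodTensor _ _).symm ≪≫ (toBimodUnit.symm ⊗ᵢ .refl _)) ≪≫ λ_ M.toBimodObj)
  rightUnitor M := (toBimodFullyFaithful A).preimageIso
    (((toBimodTensor _ _).symm ≪≫ (.refl _ ⊗ᵢ toBimodUnit.symm)) ≪≫ ρ_ M.toBimodObj)

noncomputable instance : MonoidalCategory (RMod A) :=
  Monoidal.induced (toBimod A)
    { μIso := toBimodTensor
      εIso := toBimodUnit
      whiskerLeft_eq := fun _ _ _ _ => rfl
      whiskerRight_eq := fun _ _ => rfl
      tensorHom_eq := fun _ _ => rfl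
      associator_eq := fun _ _ _ => rfl
      leftUnitor_eq := fun _ => rfl
      rightUnitor_eq := fun _ => rfl }

theorem π_whiskerRight {M N : RMod A} (f : M ⟶ N) (L : RMod A) :
    π M L ≫ (f ▷ L).hom = f.hom ▷ L.X ≫ π N L := by
  have h : (f ▷ L).hom = (Bimod.whiskerRight ((toBimod A).map f) L.toBimodObj).hom :=
    (Category.id_comp _).trans (Category.comp_id _)
  exact (congrArg (π M L ≫ ·) h).trans (ι_colimMap _ _)

theorem π_whiskerLeft (L : RMod A) {M N : RMod A} (f : M ⟶ N) :
    π L M ≫ (L ◁ f).hom = L.X ◁ f.hom ≫ π L N := by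
  have h : (L ◁ f).hom = (Bimod.whiskerLeft L.toBimodObj ((toBimod A).map f)).hom :=
    (Category.id_comp _).trans (Category.comp_id _)
  exact (congrArg (π L M ≫ ·) h).trans (ι_colimMap _ _)

theorem leftUnitor_hom_hom (M : RMod A) :
    π (𝟙_ _) M ≫ (λ_ M).hom.hom = M.actLeft := by
  have h : π (𝟙_ _) M ≫ Bimod.Hom.hom (toBimodUnit.inv ⊗ₘ 𝟙 M.toBimodObj) =
      bimodπ (𝟙_ _) M.toBimodObj := by
    refine (bimodπ_tensorHom toBimodUnit.inv (𝟙 M.toBimodObj)).trans ?_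
    exact id_tensor_id_comp _
  refine Eq.trans ?_ (bimodπ_leftUnitor M.toBimodObj)
  refine Eq.trans ?_ (congrArg (· ≫ _) h)
  refine Eq.trans ?_ (Category.assoc _ _ _).symm
  exact congrArg (_ ≫ ·) ((congrArg (· ≫ _) (Category.id_comp _)))

theorem rightUnitor_hom_hom (M : RMod A) :
    π M (𝟙_ _) ≫ (ρ_ M).hom.hom = M.act := by
  have h : π M (𝟙_ _) ≫ Bimod.Hom.hom (𝟙 M.toBimodObj ⊗ₘ toBimodUnit.inv) =
      bimodπ M.toBimodObj (𝟙_ _) := by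
    refine (bimodπ_tensorHom (𝟙 M.toBimodObj) toBimodUnit.inv).trans ?_
    exact id_tensor_id_comp _
  refine Eq.trans ?_ (bimodπ_rightUnitor M.toBimodObj)
  refine Eq.trans ?_ (congrArg (· ≫ _) h)
  refine Eq.trans ?_ (Category.assoc _ _ _).symm
  exact congrArg (_ ≫ ·) ((congrArg (· ≫ _) (Category.id_comp _)))

theorem π_associator (M N L : RMod A) :
    π M N ▷ L.X ≫ π (M ⊗ N) L ≫ (α_ M N L).hom.hom =
      (α_ M.X N.X L.X).hom ≫ M.X ◁ π N L ≫ π M (N ⊗ L) := by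
  have h₁ : π (M ⊗ N) L ≫ Bimod.Hom.hom ((toBimodTensor M N).inv ⊗ₘ 𝟙 L.toBimodObj) =
      bimodπ (M.toBimodObj ⊗ N.toBimodObj) L.toBimodObj := by
    refine (bimodπ_tensorHom (toBimodTensor M N).inv (𝟙 L.toBimodObj)).trans ?_
    exact id_tensor_id_comp _
  have h₂ : bimodπ M.toBimodObj (N.toBimodObj ⊗ L.toBimodObj) ≫
      Bimod.Hom.hom (𝟙 M.toBimodObj ⊗ₘ (toBimodTensor N L).hom) = π M (N ⊗ L) := by
    refine (bimodπ_tensorHom (𝟙 M.toBimodObj) (toBimodTensor N L).hom).trans ?_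
    exact id_tensor_id_comp _
  have h₃ := bimodπ_associator M.toBimodObj N.toBimodObj L.toBimodObj
  have h₄ : (α_ M N L).hom.hom =
      Bimod.Hom.hom ((toBimodTensor M N).inv ⊗ₘ 𝟙 L.toBimodObj) ≫
        Bimod.Hom.hom (α_ M.toBimodObj N.toBimodObj L.toBimodObj).hom ≫
          Bimod.Hom.hom (𝟙 M.toBimodObj ⊗ₘ (toBimodTensor N L).hom) := by
    refine (congrArg₂ (· ≫ ·) (Category.id_comp _) (congrArg (_ ≫ ·) (Category.comp_id _)))
  exact (congrArg (fun z => π M N ▷ L.X ≫ π (M ⊗ N) L ≫ z) h₄).trans (comp_glue h₁ h₂ h₃)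

theorem isLocal_iff (M : RMod A) : IsLocal A M ↔ (β_ M.X A).hom ≫ M.actLeft = M.act := Iff.rfl

theorem isLocal_tensor {M N : RMod A} (hM : IsLocal A M) (hN : IsLocal A N) :
    IsLocal A (M ⊗ N) := by
  rw [isLocal_iff] at hM hN
  refine (cancel_epi (π M N ▷ A)).1 ?_
  have h₁ : π M N ▷ A ≫ (β_ (tensor M N).X A).hom = (β_ (M.X ⊗ N.X) A).hom ≫ A ◁ π M N :=
    BraidedCategory.braiding_naturality_left _ _
  calc π M N ▷ A ≫ (β_ (tensor M N).X A).hom ≫ (tensor M N).actLeft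
      = (β_ (M.X ⊗ N.X) A).hom ≫ (α_ _ _ _).inv ≫ M.actLeft ▷ N.X ≫ π M N := by
        rw [← Category.assoc, h₁, Category.assoc, π_actLeft]
    _ = (α_ _ _ _).hom ≫ M.X ◁ (β_ N.X A).hom ≫ (α_ _ _ _).inv ≫ M.act ▷ N.X ≫ π M N := by
        rw [BraidedCategory.braiding_tensor_left_hom, ← hM]
        simp
    _ = (α_ _ _ _).hom ≫ M.X ◁ N.act ≫ π M N := by
        rw [π_cond, ← hN]
        simp
    _ = π M N ▷ A ≫ (tensor M N).act := (π_act M N).symm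

instance : (IsLocal A).IsMonoidal where
  prop_unit := by
    change (β_ A A).hom ≫ (β_ A A).hom ≫ μ = μ
    rw [IsCommMonObj.mul_comm, IsCommMonObj.mul_comm]
  prop_tensor _ _ hM hN := isLocal_tensor hM hN

end Monoidal

end RMod

/-- Local right modules: the full subcategory of `RMod A` on the local modules. It is a monoidal
category with respect to the relative tensor product. -/
abbrev LocMod [BraidedCategory C] (A : C) [MonObj A] := (RMod.IsLocal A).FullSubcategory

namespace LocMod

open RMod

variable [BraidedCategory C] {A : C} [MonObj A] [IsCommMonObj A]
  [HasCoequalizers C] [∀ X : C, PreservesColimitsOfSize.{0, 0} (tensorLeft X)]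
  [∀ X : C, PreservesColimitsOfSize.{0, 0} (tensorRight X)]

/-- The braid reversing the order of three tensor factors. -/
def reverse (X Y Z : C) : (X ⊗ Y) ⊗ Z ≅ (Z ⊗ Y) ⊗ X :=
  α_ X Y Z ≪≫ β_ X (Y ⊗ Z) ≪≫ whiskerRightIso (β_ Y Z) X

theorem reverse_eq (X Y Z : C) : (reverse X Y Z).hom =
    (β_ (X ⊗ Y) Z).hom ≫ Z ◁ (β_ X Y).hom ≫ (α_ Z Y X).inv := by
  simp only [reverse, Iso.trans_hom, whiskerRightIso_hom]
  rw [← BraidedCategory.braiding_naturality_right, BraidedCategory.braiding_tensor_right_hom,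
    BraidedCategory.braiding_tensor_left_hom]
  simp

theorem reverse_left {M : RMod A} (hM : IsLocal A M) (N : RMod A) :
    M.act ▷ N.X ≫ (β_ M.X N.X).hom =
      (reverse M.X A N.X).hom ≫ (α_ _ _ _).hom ≫ N.X ◁ M.actLeft := by
  rw [isLocal_iff] at hM
  rw [reverse_eq, BraidedCategory.braiding_naturality_left, ← hM]
  simp

theorem reverse_right (M N : RMod A) :
    (α_ _ _ _).hom ≫ M.X ◁ N.actLeft ≫ (β_ M.X N.X).hom =
      (reverse M.X A N.X).hom ≫ N.act ▷ M.X := by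
  simp only [actLeft, reverse, whiskerLeft_comp, Category.assoc, Iso.trans_hom,
    whiskerRightIso_hom]
  rw [BraidedCategory.braiding_naturality_right, BraidedCategory.braiding_naturality_right_assoc]

/-- The braiding of `C` descends to the relative tensor product of local modules. -/
noncomputable def braidAux {M : RMod A} (hM : IsLocal A M) (N : RMod A) :
    (RMod.tensor M N).X ⟶ (RMod.tensor N M).X :=
  coequalizer.desc ((β_ M.X N.X).hom ≫ π N M) (by
    have h₁ := congrArg (· ≫ π N M) (reverse_left hM N)
    have h₂ := congrArg (· ≫ π N M) (reverse_right M N)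
    simp only [Category.assoc] at h₁ h₂
    refine h₁.trans ?_
    refine Eq.trans ?_ (h₂.symm.trans (Category.assoc _ _ _).symm)
    exact congrArg (_ ≫ ·) (π_cond N M).symm)

/-- The inverse of the braiding of `C` descends to the relative tensor product. -/
noncomputable def braidAuxInv {M : RMod A} (hM : IsLocal A M) (N : RMod A) :
    (RMod.tensor N M).X ⟶ (RMod.tensor M N).X :=
  coequalizer.desc ((β_ M.X N.X).inv ≫ π M N) (by
    refine (cancel_epi (reverse M.X A N.X).hom).1 ?_
    have h₁ := congrArg (· ≫ (β_ M.X N.X).inv ≫ π M N) (reverse_left hM N)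
    have h₂ := congrArg (· ≫ (β_ M.X N.X).inv ≫ π M N) (reverse_right M N)
    simp only [Category.assoc, Iso.hom_inv_id_assoc] at h₁ h₂
    refine h₂.symm.trans ?_
    refine Eq.trans (π_cond M N).symm (h₁.trans ?_)
    exact congrArg (_ ≫ ·) (Category.assoc _ _ _).symm)

theorem π_braidAux {M : RMod A} (hM : IsLocal A M) (N : RMod A) :
    π M N ≫ braidAux hM N = (β_ M.X N.X).hom ≫ π N M :=
  coequalizer.π_desc _ _

theorem π_braidAuxInv {M : RMod A} (hM : IsLocal A M) (N : RMod A) :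
    π N M ≫ braidAuxInv hM N = (β_ M.X N.X).inv ≫ π M N :=
  coequalizer.π_desc _ _

theorem braidAux_inv {M : RMod A} (hM : IsLocal A M) (N : RMod A) :
    braidAux hM N ≫ braidAuxInv hM N = 𝟙 _ := by
  rw [← cancel_epi (π M N), ← Category.assoc, π_braidAux, Category.assoc, π_braidAuxInv]
  simp

theorem braidAuxInv_hom {M : RMod A} (hM : IsLocal A M) (N : RMod A) :
    braidAuxInv hM N ≫ braidAux hM N = 𝟙 _ := by
  rw [← cancel_epi (π N M), ← Category.assoc, π_braidAuxInv, Category.assoc, π_braidAux]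
  simp

theorem braidAux_act {M : RMod A} (hM : IsLocal A M) (N : RMod A) :
    (RMod.tensor M N).act ≫ braidAux hM N = braidAux hM N ▷ A ≫ (RMod.tensor N M).act := by
  have h := hM
  rw [isLocal_iff] at h
  rw [← cancel_epi (π M N ▷ A)]
  calc π M N ▷ A ≫ (RMod.tensor M N).act ≫ braidAux hM N
      = (α_ _ _ _).hom ≫ M.X ◁ N.act ≫ (β_ M.X N.X).hom ≫ π N M := by
        rw [← Category.assoc, π_act, Category.assoc, Category.assoc, π_braidAux]
    _ = (α_ _ _ _).hom ≫ (β_ M.X (N.X ⊗ A)).hom ≫ N.act ▷ M.X ≫ π N M := by simp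
    _ = (α_ _ _ _).hom ≫ (β_ M.X (N.X ⊗ A)).hom ≫ (α_ _ _ _).hom ≫ N.X ◁ M.actLeft ≫ π N M := by
        rw [π_cond]
    _ = (β_ M.X N.X).hom ▷ A ≫ (α_ _ _ _).hom ≫ N.X ◁ M.act ≫ π N M := by
        rw [BraidedCategory.braiding_tensor_right_hom, ← h]
        simp
    _ = π M N ▷ A ≫ braidAux hM N ▷ A ≫ (RMod.tensor N M).act := by
        rw [← comp_whiskerRight_assoc, π_braidAux, comp_whiskerRight_assoc, π_act]

/-- The braiding on local modules. -/
noncomputable def braid (M N : LocMod A) : M ⊗ N ≅ N ⊗ M :=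
  (IsLocal A).isoMk
    { hom := ⟨braidAux M.property N.obj, braidAux_act M.property N.obj⟩
      inv := ⟨braidAuxInv M.property N.obj, by
        have h₁ := braidAux_inv M.property N.obj
        have h₂ := braidAuxInv_hom M.property N.obj
        have h₃ := braidAux_act M.property N.obj
        have h₄ : braidAuxInv M.property N.obj ▷ A ≫ braidAux M.property N.obj ▷ A = 𝟙 _ := by
          rw [← comp_whiskerRight, h₂, id_whiskerRight]
        have h₅ := congrArg (fun z => braidAuxInv M.property N.obj ▷ A ≫ z ≫
          braidAuxInv M.property N.obj) h₃
        simp only [Category.assoc, h₁, Category.comp_id] at h₅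
        refine (h₅.trans ((Category.assoc _ _ _).symm.trans ?_)).symm
        exact (congrArg (· ≫ _) h₄).trans (Category.id_comp _)⟩
      hom_inv_id := RMod.hom_ext (braidAux_inv M.property _)
      inv_hom_id := RMod.hom_ext (braidAuxInv_hom M.property _) }

/-- The projection from the tensor product to the relative tensor product of local modules. -/
noncomputable def locπ (M N : LocMod A) : M.obj.X ⊗ N.obj.X ⟶ (M ⊗ N).obj.X := π M.obj N.obj

instance (M N : LocMod A) : Epi (locπ M N) := inferInstanceAs (Epi (π _ _))

instance {X : C} (M N : LocMod A) : Epi (locπ M N ▷ X) := inferInstanceAs (Epi (π _ _ ▷ _))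

instance {X : C} (M N : LocMod A) : Epi (X ◁ locπ M N) := inferInstanceAs (Epi (_ ◁ π _ _))

theorem locHom_ext {M N : LocMod A} {f g : M ⟶ N} (h : f.hom.hom = g.hom.hom) : f = g :=
  ObjectProperty.hom_ext _ (RMod.hom_ext h)

theorem locComp {M N L : LocMod A} (f : M ⟶ N) (g : N ⟶ L) :
    (f ≫ g).hom.hom = f.hom.hom ≫ g.hom.hom := rfl

theorem locπ_braid (M N : LocMod A) :
    locπ M N ≫ (braid M N).hom.hom.hom = (β_ M.obj.X N.obj.X).hom ≫ locπ N M :=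
  π_braidAux M.property _

theorem locπ_whiskerRight {M N : LocMod A} (f : M ⟶ N) (L : LocMod A) :
    locπ M L ≫ (f ▷ L).hom.hom = f.hom.hom ▷ L.obj.X ≫ locπ N L :=
  π_whiskerRight _ _

theorem locπ_whiskerLeft (L : LocMod A) {M N : LocMod A} (f : M ⟶ N) :
    locπ L M ≫ (L ◁ f).hom.hom = L.obj.X ◁ f.hom.hom ≫ locπ L N :=
  π_whiskerLeft _ _

theorem locπ_associator (M N L : LocMod A) :
    locπ M N ▷ L.obj.X ≫ locπ (M ⊗ N) L ≫ (α_ M N L).hom.hom.hom =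
      (α_ M.obj.X N.obj.X L.obj.X).hom ≫ M.obj.X ◁ locπ N L ≫ locπ M (N ⊗ L) :=
  π_associator _ _ _

theorem locπ_associator_inv (M N L : LocMod A) :
    M.obj.X ◁ locπ N L ≫ locπ M (N ⊗ L) ≫ (α_ M N L).inv.hom.hom =
      (α_ M.obj.X N.obj.X L.obj.X).inv ≫ locπ M N ▷ L.obj.X ≫ locπ (M ⊗ N) L := by
  have h₁ := congrArg (fun z => (α_ M.obj.X N.obj.X L.obj.X).inv ≫ z ≫ (α_ M N L).inv.hom.hom)
    (locπ_associator M N L)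
  have h₂ : (α_ M N L).hom.hom.hom ≫ (α_ M N L).inv.hom.hom = 𝟙 _ :=
    (locComp _ _).symm.trans (by rw [Iso.hom_inv_id]; rfl)
  simp only [Category.assoc, Iso.inv_hom_id_assoc, h₂] at h₁
  rw [← h₁, Category.comp_id]

noncomputable instance : BraidedCategory (LocMod A) where
  braiding := braid
  braiding_naturality_right L M N f := by
    apply locHom_ext
    rw [← cancel_epi (locπ L M), locComp, locComp, ← Category.assoc, locπ_whiskerLeft,
      Category.assoc, locπ_braid, ← Category.assoc (locπ L M), locπ_braid, Category.assoc,
      locπ_whiskerRight]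
    simp
  braiding_naturality_left {M N} f L := by
    apply locHom_ext
    rw [← cancel_epi (locπ M L), locComp, locComp, ← Category.assoc, locπ_whiskerRight,
      Category.assoc, locπ_braid, ← Category.assoc (locπ M L), locπ_braid, Category.assoc,
      locπ_whiskerLeft]
    simp
  hexagon_forward M N L := by
    apply locHom_ext
    rw [← cancel_epi (locπ (M ⊗ N) L), ← cancel_epi (locπ M N ▷ L.obj.X)]
    simp only [locComp]
    rw [reassoc_of% (locπ_associator M N L), reassoc_of% (locπ_braid M (N ⊗ L)),
      BraidedCategory.braiding_naturality_right_assoc, locπ_associator N L M,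
      reassoc_of% (locπ_whiskerRight (braid M N).hom L), ← comp_whiskerRight_assoc,
      locπ_braid, comp_whiskerRight_assoc, reassoc_of% (locπ_associator N M L),
      locπ_whiskerLeft, ← whiskerLeft_comp_assoc, locπ_braid,
      BraidedCategory.braiding_tensor_right_hom]
    simp
  hexagon_reverse M N L := by
    apply locHom_ext
    rw [← cancel_epi (locπ M (N ⊗ L)), ← cancel_epi (M.obj.X ◁ locπ N L)]
    simp only [locComp]
    rw [reassoc_of% (locπ_associator_inv M N L), reassoc_of% (locπ_braid (M ⊗ N) L),
      BraidedCategory.braiding_naturality_left_assoc, locπ_associator_inv L M N,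
      reassoc_of% (locπ_whiskerLeft M (braid N L).hom), ← whiskerLeft_comp_assoc,
      locπ_braid, whiskerLeft_comp_assoc, reassoc_of% (locπ_associator_inv M L N),
      locπ_whiskerRight, ← comp_whiskerRight_assoc, locπ_braid,
      BraidedCategory.braiding_tensor_left_hom]
    simp

end LocMod
end Modules

/-! ### The algebra `k[F, γ, ε]` and the reduced cocycle -/

/-- The data of the commutative algebra `k[F, γ, ε]` of `Z(H, α)`, for a normal subgroup `F` of
`H`: a normalised cochain `γ` on `F` whose coboundary is the restriction of `α`, and
`ε : H × F → kˣ` such that `h(e_f) = ε_h(f) e_{hfh⁻¹}` is a multiplicative `α`-projective action for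
which `e_f e_g = γ(f, g) e_{fg}` is commutative. Here `MulAut.conjNormal h f` is `hfh⁻¹`. -/
structure AlgData {k H : Type u} [Field k] [Group H] (α : Cocycle3 k H) (F : Subgroup H)
    [F.Normal] where
  γ : F → F → kˣ
  ε : H → F → kˣ
  γ_one_left : ∀ f, γ 1 f = 1
  γ_one_right : ∀ f, γ f 1 = 1
  coboundary : ∀ f g h : F, γ g h * γ f (g * h) = α f g h * γ f g * γ (f * g) h
  ε_mul : ∀ (g h : H) (f : F), ε (g * h) f = α.two g h f * ε g (MulAut.conjNormal h f) * ε h f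
  γ_ε : ∀ (h : H) (f g : F), γ f g * ε h (f * g) =
    α.one h f g * ε h f * ε h g * γ (MulAut.conjNormal h f) (MulAut.conjNormal h g)
  comm : ∀ f g : F, γ f g = ε f g * γ (MulAut.conjNormal (f : H) g) f

namespace AlgData

variable {k H : Type u} [Field k] [Group H] {α : Cocycle3 k H} {F : Subgroup H} [F.Normal]
  (D : AlgData α F)

theorem ε_one (f : F) : D.ε 1 f = 1 := by
  have := D.ε_mul 1 1 f
  simpa using this

theorem ε_one_right (h : H) : D.ε h 1 = 1 := by
  have := D.γ_ε h 1 1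
  simpa [D.γ_one_left] using this

section Algebra

variable [Fintype H]

/-- The basis vector `e_f`. -/
noncomputable def e (k : Type u) [Field k] {H : Type u} [Group H] {F : Subgroup H} (f : F) :
    F →₀ k := Finsupp.single f 1

theorem e_ext {W : Type*} [AddCommMonoid W] [Module k W] {φ ψ : (F →₀ k) →ₗ[k] W}
    (h : ∀ f, φ (e k f) = ψ (e k f)) : φ = ψ :=
  Finsupp.lhom_ext' fun f => LinearMap.ext_ring (h f)

/-- The linear map with prescribed values on the basis vectors `e_f`. -/
noncomputable def eLin {W : Type*} [AddCommMonoid W] [Module k W] (φ : F → W) :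
    (F →₀ k) →ₗ[k] W := Finsupp.linearCombination k φ

@[simp] theorem eLin_e {W : Type*} [AddCommMonoid W] [Module k W] (φ : F → W) (f : F) :
    eLin φ (e k f) = φ f := by simp [eLin, e]

open Classical in
/-- The projection of `k[F, γ, ε]` onto degree `g`. -/
noncomputable def eProj (k : Type u) [Field k] {H : Type u} [Group H] (F : Subgroup H) (g : H) :
    (F →₀ k) →ₗ[k] (F →₀ k) := eLin fun f => if (f : H) = g then e k f else 0

/-- The action `h(e_f) = ε_h(f) e_{hfh⁻¹}`. -/
noncomputable def eAct (h : H) : (F →₀ k) →ₗ[k] (F →₀ k) :=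
  eLin fun f => (D.ε h f : k) • e k (MulAut.conjNormal h f)

theorem eProj_e [DecidableEq H] (g : H) (f : F) :
    eProj k F g (e k f) = if (f : H) = g then e k f else 0 := by
  rw [eProj, eLin_e]
  congr

theorem eAct_e (h : H) (f : F) :
    D.eAct h (e k f) = (D.ε h f : k) • e k (MulAut.conjNormal h f) := by rw [eAct, eLin_e]

/-- The underlying object of `k[F, γ, ε]`: it has the basis `e_f`, of degree `f`. -/
@[reducible] noncomputable def obj : ZObj α where
  V := F →₀ k
  proj := eProj k F
  proj_self g v := by
    classical
    refine LinearMap.congr_fun (f := eProj k F g ∘ₗ eProj k F g) (e_ext fun f => ?_) v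
    by_cases h : (f : H) = g <;> simp [h, eProj_e]
  proj_ne g g' hn v := by
    classical
    refine LinearMap.congr_fun (f := eProj k F g ∘ₗ eProj k F g') (g := 0) (e_ext fun f => ?_) v
    by_cases h : (f : H) = g'
    · simp [h, hn.symm, eProj_e]
    · simp [h, eProj_e]
  sum_proj v := by
    classical
    rw [← LinearMap.sum_apply]
    refine LinearMap.congr_fun (g := LinearMap.id) (e_ext fun f => ?_) v
    simp [LinearMap.sum_apply, eProj_e]
  act := D.eAct
  act_one v := by
    refine LinearMap.congr_fun (g := LinearMap.id) (e_ext fun f => ?_) v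
    simp [D.ε_one, D.eAct_e]
  act_proj h g v := by
    classical
    refine LinearMap.congr_fun (f := D.eAct h ∘ₗ eProj k F g)
      (g := eProj k F (h * g * h⁻¹) ∘ₗ D.eAct h) (e_ext fun f => ?_) v
    by_cases hf : (f : H) = g
    · simp [hf, eProj_e, D.eAct_e]
    · simp [hf, eProj_e, D.eAct_e]
  act_mul g h l v := by
    classical
    refine LinearMap.congr_fun (f := D.eAct (g * h) ∘ₗ eProj k F l)
      (g := (α.two g h l : k) • (D.eAct g ∘ₗ D.eAct h ∘ₗ eProj k F l)) (e_ext fun f => ?_) v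
    by_cases hf : (f : H) = l
    · subst hf
      simp only [LinearMap.comp_apply, LinearMap.smul_apply, eProj_e, if_true, D.eAct_e, map_smul,
        smul_smul, D.ε_mul, map_mul, MulAut.mul_apply]
      congr 1
      push_cast
      ring
    · simp [hf, eProj_e]

theorem isDeg_e (f : F) : D.obj.IsDeg (f : H) (e k f) := by
  classical
  simp [ZObj.IsDeg, obj, eProj_e]

theorem act_e (h : H) (f : F) :
    D.obj.act h (e k f) = (D.ε h f : k) • e k (MulAut.conjNormal h f) := D.eAct_e h f

/-- The multiplication `e_f e_g = γ(f, g) e_{fg}`. -/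
noncomputable def mulLin : (F →₀ k) ⊗[k] (F →₀ k) →ₗ[k] (F →₀ k) :=
  TensorProduct.lift (eLin fun f => eLin fun g => (D.γ f g : k) • e k (f * g))

theorem mulLin_e (f g : F) : D.mulLin (e k f ⊗ₜ e k g) = (D.γ f g : k) • e k (f * g) := by
  simp [mulLin]

theorem e_ext₂ {W : Type*} [AddCommGroup W] [Module k W]
    {φ ψ : (F →₀ k) ⊗[k] (F →₀ k) →ₗ[k] W}
    (h : ∀ f g, φ (e k f ⊗ₜ e k g) = ψ (e k f ⊗ₜ e k g)) : φ = ψ :=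
  TensorProduct.ext (e_ext fun f => e_ext fun g => h f g)

theorem e_ext₃ {W : Type*} [AddCommGroup W] [Module k W]
    {φ ψ : ((F →₀ k) ⊗[k] (F →₀ k)) ⊗[k] (F →₀ k) →ₗ[k] W}
    (h : ∀ f g l, φ ((e k f ⊗ₜ e k g) ⊗ₜ e k l) = ψ ((e k f ⊗ₜ e k g) ⊗ₜ e k l)) : φ = ψ :=
  TensorProduct.ext (e_ext₂ fun f g => e_ext fun l => h f g l)

/-- The multiplication as a morphism of `Z(H, α)`. -/
noncomputable def mul : D.obj ⊗ D.obj ⟶ D.obj where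
  lin := D.mulLin
  proj_comm g v := by
    classical
    refine LinearMap.congr_fun (f := D.mulLin ∘ₗ ZObj.tProj D.obj D.obj g)
      (g := D.obj.proj g ∘ₗ D.mulLin) (e_ext₂ fun a b => ?_) v
    simp only [LinearMap.comp_apply, ZObj.tProj_tmul (D.isDeg_e a) (D.isDeg_e b), D.mulLin_e,
      map_smul, (D.isDeg_e (a * b)).proj]
    by_cases h : g = a * b <;> simp [h, D.mulLin_e]
  act_comm h v := by
    refine LinearMap.congr_fun (f := D.mulLin ∘ₗ ZObj.tAct D.obj D.obj h)
      (g := D.obj.act h ∘ₗ D.mulLin) (e_ext₂ fun a b => ?_) v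
    simp only [LinearMap.comp_apply, ZObj.tAct_tmul (D.isDeg_e a) (D.isDeg_e b), D.mulLin_e,
      map_smul, D.act_e, TensorProduct.tmul_smul, ← TensorProduct.smul_tmul', smul_smul, map_mul]
    congr 1
    have := congrArg Units.val (D.γ_ε h a b)
    push_cast at this
    linear_combination -this

/-- The unit as a morphism of `Z(H, α)`. -/
noncomputable def one : 𝟙_ (ZObj α) ⟶ D.obj where
  lin := LinearMap.toSpanSingleton k _ (e k (1 : F))
  proj_comm g v := by
    classical
    have h := D.isDeg_e 1
    change k at v
    change ((if g = 1 then LinearMap.id else (0 : k →ₗ[k] k)) v) • e k (1 : F) =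
      D.obj.proj g (v • e k (1 : F))
    rw [map_smul, h.proj]
    by_cases hg : g = 1 <;> simp [hg]
  act_comm h v := by
    change k at v
    change v • e k (1 : F) = D.eAct h (v • e k (1 : F))
    rw [map_smul, D.eAct_e, D.ε_one_right, map_one, Units.val_one, one_smul]

/-- The algebra `k[F, γ, ε]` in `Z(H, α)`. -/
noncomputable instance : MonObj D.obj where
  one := D.one
  mul := D.mul
  one_mul := ZObj.hom_ext <| TensorProduct.ext <| LinearMap.ext_ring <| e_ext fun f => by
    change D.mulLin (((1 : k) • e k (1 : F)) ⊗ₜ e k f) = (1 : k) • e k f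
    rw [one_smul, D.mulLin_e, D.γ_one_left]
    simp
  mul_one := ZObj.hom_ext <| TensorProduct.ext <| e_ext fun f => LinearMap.ext_ring <| by
    change D.mulLin (e k f ⊗ₜ ((1 : k) • e k (1 : F))) = (1 : k) • e k f
    rw [one_smul, D.mulLin_e, D.γ_one_right]
    simp
  mul_assoc := ZObj.hom_ext <| e_ext₃ fun f g l => by
    change D.mulLin (D.mulLin (e k f ⊗ₜ e k g) ⊗ₜ e k l) =
      D.mulLin (TensorProduct.map LinearMap.id D.mulLin
        (ZObj.assocHom D.obj D.obj D.obj ((e k f ⊗ₜ e k g) ⊗ₜ e k l)))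
    rw [ZObj.assocHom_tmul (D.isDeg_e f) (D.isDeg_e g) (D.isDeg_e l), map_smul,
      TensorProduct.map_tmul, D.mulLin_e, D.mulLin_e, ← TensorProduct.smul_tmul',
      TensorProduct.tmul_smul, map_smul, map_smul, map_smul, D.mulLin_e, LinearMap.id_apply,
      D.mulLin_e, smul_smul, smul_smul, smul_smul, mul_assoc]
    congr 1
    have := congrArg Units.val (D.coboundary f g l)
    push_cast at this
    field_simp
    linear_combination -this

instance : IsCommMonObj D.obj where
  mul_comm := ZObj.hom_ext <| e_ext₂ fun f g => by
    change D.mulLin (ZObj.braidHom D.obj D.obj (e k f ⊗ₜ e k g)) = D.mulLin (e k f ⊗ₜ e k g)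
    rw [ZObj.braidHom_tmul (D.isDeg_e f), D.act_e, ← TensorProduct.smul_tmul', map_smul,
      D.mulLin_e, D.mulLin_e, smul_smul, D.comm f g, Units.val_mul]
    congr 2
    ext
    simp

end Algebra

/-- An element of `H` that is trivial in `H ⧸ F`, as an element of `F`. -/
def toF (F : Subgroup H) [F.Normal] (h : H) (hh : (h : H ⧸ F) = 1) : F :=
  ⟨h, (QuotientGroup.eq_one_iff h).1 hh⟩

/-- `τ(x, y) = s(y)⁻¹ s(x)⁻¹ s(xy)`, for a section `s` of `H → H ⧸ F`. -/
def τ (F : Subgroup H) [F.Normal] (s : H ⧸ F → H) (hs : ∀ x, (s x : H ⧸ F) = x) (x y : H ⧸ F) : F :=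
  toF F ((s y)⁻¹ * (s x)⁻¹ * s (x * y)) (by
    rw [QuotientGroup.mk_mul, QuotientGroup.mk_mul, QuotientGroup.mk_inv, QuotientGroup.mk_inv,
      hs, hs, hs, ← mul_inv_rev, inv_mul_cancel])

/-- The 3-cochain of `H ⧸ F` defined by `α`, `γ`, `ε` and a section `s` of `H → H ⧸ F`: the scalar
that compares the two bracketings of `M_{s(x)} ⊗ N_{s(y)} ⊗ L_{s(z)}` for local modules, when
`M_{s(x)} ⊗ N_{s(y)}` is identified with the component of degree `s(xy)` of the relative tensor
product by `m ⊗ n ↦ m ⊗ n e_{τ(x, y)}`. -/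
def reduced (s : H ⧸ F → H) (hs : ∀ x, (s x : H ⧸ F) = x) (x y z : H ⧸ F) : kˣ :=
  let a : F := τ F s hs y z
  let b : F := τ F s hs x (y * z)
  let c : F := τ F s hs x y
  let d : F := τ F s hs (x * y) z
  let h : H := (s (x * y))⁻¹ * s (x * y * z)
  let c' : F := MulAut.conjNormal h⁻¹ c
  α (s x) (s y) ((s y)⁻¹ * (s x)⁻¹ * s (x * y * z)) * D.γ a b * D.ε h c' * (D.γ d c')⁻¹ *
    α (s x * s y) c h * α (s z) d c' *
    (α (s z) a b * α (s y) (s z * a) b * α (s x) (s y) c)⁻¹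

end AlgData

/-! ### Ribbon structures -/

/-- `θ` makes the braided monoidal category `C` a ribbon category: `C` is rigid, and `θ` is a
balanced twist that is compatible with duality. -/
structure IsRibbonTwist {C : Type*} [Category C] [MonoidalCategory C] [BraidedCategory C]
    (θ : 𝟭 C ≅ 𝟭 C) : Prop where
  rigid : Nonempty (RigidCategory C)
  balance : ∀ X Y : C, θ.hom.app (X ⊗ Y) =
    (β_ X Y).hom ≫ (β_ Y X).hom ≫ (θ.hom.app X ⊗ₘ θ.hom.app Y)
  dual : ∀ (X Y : C) [ExactPairing X Y],
    η_ X Y ≫ θ.hom.app X ▷ Y = η_ X Y ≫ X ◁ θ.hom.app Y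

/-! Up to a coboundary, the data `γ` and `ε` turn `α` into a cocycle inflated from H/F. More
precisely, there are a cocycle ω of H/F and a 2-cochain ψ on H such that α differs from the
inflation of ω by the coboundary of ψ, such that ψ = γ on F × F, and such that ψ(h, f) = ε_h(f)
ψ(hfh⁻¹, h) for f in F (`Trivialization`). A change of gauge by ψ then reduces everything to the
case of an inflated cocycle with γ = ε = 1. There A is the group algebra of F, and e_f moves degree
g to degree gf. Locality forces f in F to act on degree g as translation by g⁻¹fgf⁻¹, so that the
coinvariants of these translations form an object over H/F.

To find ψ, take a free right A-module with one generator u_t in the degree t of each coset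
representative, and with basis m_g = u_r e_a, where g = ra, r = `rep s g` and a = `res s hs g`. The
right and the left action of A on this basis have the structure constants `freeRight` and
`freeLeft`. The products u_t m_l are normalised to be m_{tl} when tl is a representative and are
extended by right linearity (`freeGen`). Then ψ = `trivCochain` is the constant in m_g m_h = ψ(g, h)
m_{gh}. This product is right linear, balanced and left linear over A (`trivCochain_mul_right`,
`trivCochain_mul_mid`, `trivCochain_mul_left`), so its associativity defect `inflated` is 1 as soon
as one argument lies in F. A 3-cocycle with this property is constant on cosets in each variable and
descends to H/F. Its values are those of `reduced`, by `deflated_eq_reduced`.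

Given ψ, the corrected action `act` is ω-projective and the corrected multiplication `shift` is a
strict right action of F. The two are compatible (`act_shift`), and on local modules F acts by
shifts (`act_coe`). Hence the coinvariants `redV` carry a grading and an ω-projective action of H/F.
Each component M_g maps isomorphically to the component of the coset gF, which gives full
faithfulness. Sections of the pullback along H → H/F give essential surjectivity. The tensorator is
v ⊗ w ↦ ψ(g, h)⁻¹ [v ⊗ w] in degrees g, h: its associativity is the coboundary equation, its
compatibility with the braiding is the definition of `corr`, and the twist is respected because
`corr g g` is 1. The ribbon axioms are checked directly in Z(G, α) and pulled back to the local
modules along the equivalence. -/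

namespace AlgData

/-! ### The cochain that makes `α` an inflation -/

section Cochain

variable {k H : Type u} [Field k] [Group H] {α : Cocycle3 k H} {F : Subgroup H} [F.Normal]
  (D : AlgData α F) (s : H ⧸ F → H) (hs : ∀ x, (s x : H ⧸ F) = x)

/-- The chosen representative of the coset of `g`. -/
def rep (g : H) : H := s (g : H ⧸ F)

/-- The element of `F` with `rep g * res g = g`. -/
def res (g : H) : F := toF F ((rep s g)⁻¹ * g) (by
  rw [QuotientGroup.mk_mul, QuotientGroup.mk_inv, rep, hs, inv_mul_cancel])

theorem rep_mul_res (g : H) : rep s g * (res s hs g : H) = g := by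
  simp [res, toF]

theorem rep_mul (g : H) (f : F) : rep s (g * f) = rep s g := by
  simp [rep]

theorem res_mul (g : H) (f : F) : res s hs (g * f) = res s hs g * f := by
  ext
  simp [res, toF, rep_mul, mul_assoc]

theorem rep_section (hs : ∀ x, (s x : H ⧸ F) = x) (x : H ⧸ F) : rep s (s x) = s x := by
  simp [rep, hs]

theorem res_section (x : H ⧸ F) : res s hs (s x) = 1 := by
  ext
  simp [res, toF, rep, hs]

theorem rep_coe (hs₁ : s 1 = 1) (f : F) : rep s (f : H) = 1 := by
  rw [rep, (QuotientGroup.eq_one_iff (f : H)).2 f.2, hs₁]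

theorem res_coe (hs₁ : s 1 = 1) (f : F) : res s hs (f : H) = f := by
  ext
  simp [res, toF, rep_coe s hs₁]

/-- The scalar by which the basis vector of degree `f` of `k[F, γ, ε]` takes the basis vector of
degree `g` of a free module of rank one to the basis vector of degree `gf`. -/
def freeRight (g : H) (f : F) : kˣ :=
  (α (rep s g) (res s hs g) f)⁻¹ * D.γ (res s hs g) f

/-- The analogue of `freeRight` for the left action, of the basis vector of degree `gfg⁻¹`. -/
def freeLeft (g : H) (f : F) : kˣ := (D.ε g f)⁻¹ * D.freeRight s hs g f

/-- The scalar for the product of a generator of degree `t` with a basis vector of degree `l`. -/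
def freeGen (t l : H) : kˣ :=
  α t (t⁻¹ * rep s (t * l)) (res s hs (t * l)) *
    (D.freeRight s hs (t⁻¹ * rep s (t * l)) (res s hs (t * l)))⁻¹

/-- The cochain that relates `α` to the inflation of the reduced cocycle. -/
def trivCochain (g h : H) : kˣ :=
  (α (rep s g) (res s hs g) h)⁻¹ * D.freeLeft s hs h (MulAut.conjNormal h⁻¹ (res s hs g)) *
    D.freeGen s hs (rep s g) (res s hs g * h)

/-- Associativity of the right action on m_g = u e_a: the cocycle identity at (`rep s g`, `res s hs
g`, f, l) rebrackets, and the coboundary equation of `γ` multiplies out in the algebra. Here and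
below identities in `kˣ` are written additively, so that each is an integral combination of known
ones. -/
theorem freeRight_mul (g : H) (f l : F) :
    D.freeRight s hs g f * D.freeRight s hs (g * f) l * α g f l =
      D.γ f l * D.freeRight s hs g (f * l) := by
  have h₁ := congrArg Additive.ofMul (α.cocycle (rep s g) (res s hs g) f l)
  have h₂ := congrArg Additive.ofMul (D.coboundary (res s hs g) f l)
  rw [rep_mul_res] at h₁
  apply Additive.ofMul.injective
  simp only [freeRight, rep_mul, res_mul, ofMul_mul, ofMul_inv, Subgroup.coe_mul] at *
  linear_combination (norm := abel) -h₁ - h₂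

/-- Right linearity of the product of the generator u_t with m_l. The vector m_l is obtained from
the basis vector of degree t⁻¹ `rep s (t * l)` by the right action of `res s hs (t * l)`, and the
product of u_t with the former is normalised to be a basis vector; the cocycle identity moves the
brackets. -/
theorem freeGen_mul (t l : H) (f : F) :
    D.freeGen s hs t l * D.freeRight s hs (t * l) f * α t l f =
      D.freeRight s hs l f * D.freeGen s hs t (l * f) := by
  have e₁ : t * (t⁻¹ * rep s (t * l)) = rep s (t * l) := by group
  have e₂ : t⁻¹ * rep s (t * l) * (res s hs (t * l) : H) = l := by
    rw [mul_assoc, rep_mul_res]; group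
  have h₁ := congrArg Additive.ofMul
    (α.cocycle t (t⁻¹ * rep s (t * l)) (res s hs (t * l)) f)
  have h₂ := congrArg Additive.ofMul
    (D.freeRight_mul s hs (t⁻¹ * rep s (t * l)) (res s hs (t * l)) f)
  rw [e₁, e₂] at h₁
  rw [e₂] at h₂
  have h₃ : D.freeRight s hs (t * l) f = (α (rep s (t * l)) (res s hs (t * l)) f)⁻¹ *
    D.γ (res s hs (t * l)) f := rfl
  rw [h₃]
  apply Additive.ofMul.injective
  simp only [freeGen, ← mul_assoc, rep_mul, res_mul, ofMul_mul, ofMul_inv, Subgroup.coe_mul] at *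
  linear_combination (norm := abel) h₁ - h₂

/-- The left and the right action of the algebra commute up to the associator. `ε_mul` at (h, f) and
commutativity express the left action through the right one; both sides then become right
multiplications, compared through fb = (fbf⁻¹)f. -/
theorem freeLeft_mul_right (h : H) (f b : F) :
    D.freeRight s hs h f * D.freeLeft s hs (h * f) b =
      α (h * (f * b * f⁻¹) * h⁻¹) h f * D.freeLeft s hs h (f * b * f⁻¹) *
        D.freeRight s hs (h * (f * b * f⁻¹ : F)) f := by
  have e : MulAut.conjNormal (f : H) b = f * b * f⁻¹ := by ext; simp
  have h₁ := congrArg Additive.ofMul (D.ε_mul h f b)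
  have h₂ := congrArg Additive.ofMul (D.comm f b)
  have h₃ := congrArg Additive.ofMul (D.freeRight_mul s hs h f b)
  have h₄ := congrArg Additive.ofMul (D.freeRight_mul s hs h (f * b * f⁻¹) f)
  rw [inv_mul_cancel_right] at h₄
  rw [e] at h₁ h₂
  apply Additive.ofMul.injective
  simp only [freeLeft, Cocycle3.two, ← mul_assoc, mul_inv_rev, ofMul_mul, ofMul_inv,
    Subgroup.coe_mul, Subgroup.coe_inv] at *
  linear_combination (norm := abel) -h₁ + h₂ + h₃ - h₄

/-- Associativity of the left action. Compared with `freeLeft_mul_right`, the product is now formed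
in the algebra after conjugation by h, so `γ_ε`, the multiplicativity of the action of h on the
algebra, is needed as well. -/
theorem freeLeft_mul_left (h : H) (u v : F) :
    D.freeLeft s hs h v * D.freeLeft s hs (h * v) u =
      α (h * (v * u * v⁻¹) * h⁻¹) (h * v * h⁻¹) h *
        D.γ (MulAut.conjNormal h (v * u * v⁻¹)) (MulAut.conjNormal h v) *
        D.freeLeft s hs h (v * u) := by
  have e : MulAut.conjNormal (v : H) u = v * u * v⁻¹ := by ext; simp
  have h₁ := congrArg Additive.ofMul (D.ε_mul h v u)
  have h₂ := congrArg Additive.ofMul (D.comm v u)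
  have h₃ := congrArg Additive.ofMul (D.freeRight_mul s hs h v u)
  have h₄ := congrArg Additive.ofMul (D.γ_ε h (v * u * v⁻¹) v)
  rw [inv_mul_cancel_right] at h₄
  rw [e] at h₁ h₂
  apply Additive.ofMul.injective
  simp only [freeLeft, Cocycle3.two, Cocycle3.one, ← mul_assoc, mul_inv_rev, ofMul_mul, ofMul_inv,
    Subgroup.coe_mul, Subgroup.coe_inv] at *
  linear_combination (norm := abel) -h₁ + h₂ + h₃ + h₄

theorem freeRight_section (x : H ⧸ F) (f : F) : D.freeRight s hs (s x) f = 1 := by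
  simp [freeRight, rep_section s hs, res_section s hs, D.γ_one_left, α.one_mid]

theorem freeRight_coe (hs₁ : s 1 = 1) (f l : F) : D.freeRight s hs f l = D.γ f l := by
  simp [freeRight, rep_coe s hs₁, res_coe s hs hs₁, α.one_left]

theorem freeRight_one (g : H) : D.freeRight s hs g 1 = 1 := by
  simp [freeRight, D.γ_one_right, α.one_right]

theorem freeLeft_coe (hs₁ : s 1 = 1) (f l : F) :
    D.freeLeft s hs f l = D.γ (MulAut.conjNormal (f : H) l) f := by
  rw [freeLeft, freeRight_coe D s hs hs₁, D.comm f l]; simp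

theorem freeGen_section (t l : H) (x : H ⧸ F) (h : t * l = s x) : D.freeGen s hs t l = 1 := by
  simp [freeGen, h, res_section s hs, freeRight_one, α.one_right]

theorem freeGen_one (l : H) : D.freeGen s hs 1 l = 1 := by
  have : D.freeRight s hs (rep s l) (res s hs l) = 1 := D.freeRight_section s hs _ _
  simp [freeGen, this, α.one_left]

/-- The vectors m_f with f in F are the e_f themselves, so multiplication by them has to be the
action of the algebra. The factor `freeGen` is trivial because gf has the same representative as g.
-/
theorem trivCochain_coe_right (hs₁ : s 1 = 1) (g : H) (f : F) :
    D.trivCochain s hs g f = D.freeRight s hs g f := by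
  have e : rep s g * ((res s hs g : H) * f) = g * f := by rw [← mul_assoc, rep_mul_res]
  have h : D.freeGen s hs (rep s g) (res s hs g * f) = 1 := by
    rw [freeGen, e, rep_mul, inv_mul_cancel, ← Subgroup.coe_one F, freeRight_coe D s hs hs₁,
      D.γ_one_left, Subgroup.coe_one, α.one_mid]
    simp
  rw [trivCochain, h, freeLeft_coe D s hs hs₁, ← MulAut.mul_apply, ← map_mul]
  simp [freeRight]

theorem trivCochain_coe_left (hs₁ : s 1 = 1) (f : F) (h : H) :
    D.trivCochain s hs f h = D.freeLeft s hs h (MulAut.conjNormal h⁻¹ f) := by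
  simp [trivCochain, rep_coe s hs₁, res_coe s hs hs₁, freeGen_one, α.one_left]

theorem trivCochain_section (x : H ⧸ F) (h : H) :
    D.trivCochain s hs (s x) h = D.freeGen s hs (s x) h := by
  simp [trivCochain, rep_section s hs, res_section s hs, α.one_mid, freeLeft, freeRight_one,
    D.ε_one_right]

/-- The product m_g m_h is formed as u_r(e_a m_h). Its right linearity combines that of `freeGen`,
the commutation of the left with the right action, and the cocycle identity at (r, a, h, f). -/
theorem trivCochain_mul_right (hs₁ : s 1 = 1) (g h : H) (f : F) :
    α g h f * D.trivCochain s hs g h * D.trivCochain s hs (g * h) f =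
      D.trivCochain s hs h f * D.trivCochain s hs g (h * f) := by
  rw [trivCochain_coe_right D s hs hs₁, trivCochain_coe_right D s hs hs₁]
  set a := res s hs g
  set r := rep s g
  have e : r * (a : H) = g := rep_mul_res s hs g
  have e₂ : f * MulAut.conjNormal ((h * f : H)⁻¹) a * f⁻¹ = MulAut.conjNormal h⁻¹ a := by
    ext; simp; group
  have e₃ : h * ((MulAut.conjNormal h⁻¹ a : F) : H) = a * h := by simp; group
  have h₁ := congrArg Additive.ofMul (D.freeGen_mul s hs r (a * h) f)
  have h₂ := congrArg Additive.ofMul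
    (D.freeLeft_mul_right s hs h f (MulAut.conjNormal ((h * f : H)⁻¹) a))
  have h₃ := congrArg Additive.ofMul (α.cocycle r a h f)
  have e₄ : h * ((f : H) * (MulAut.conjNormal ((h * f : H)⁻¹) a : F) * (f⁻¹ : F)) * h⁻¹ = a := by
    simp; group
  rw [e₄, e₂, e₃] at h₂
  rw [e] at h₃
  rw [← mul_assoc, e] at h₁
  apply Additive.ofMul.injective
  simp only [trivCochain, ofMul_mul, ofMul_inv, mul_assoc] at *
  linear_combination (norm := abel) h₁ - h₂ - h₃

/-- Both (m_g e_f)m_h and m_g(e_f m_h) reduce to u_r applied to the action of e_{af} on m_h, with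
the same factor `freeGen`. The comparison is associativity of the left action and the cocycle
identity at (r, a, f, h). -/
theorem trivCochain_mul_mid (hs₁ : s 1 = 1) (g : H) (f : F) (h : H) :
    α g f h * D.trivCochain s hs g f * D.trivCochain s hs (g * f) h =
      D.trivCochain s hs f h * D.trivCochain s hs g (f * h) := by
  rw [trivCochain_coe_right D s hs hs₁, trivCochain_coe_left D s hs hs₁]
  simp only [trivCochain, freeRight, rep_mul, res_mul]
  set a := res s hs g
  set r := rep s g
  have e : r * (a : H) = g := rep_mul_res s hs g
  have h₁ := congrArg Additive.ofMul (D.freeLeft_mul_left s hs h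
    (MulAut.conjNormal (f * h : H)⁻¹ a) (MulAut.conjNormal h⁻¹ f))
  have h₃ := congrArg Additive.ofMul (α.cocycle r a f h)
  have e₁ : h * (MulAut.conjNormal h⁻¹ f : F) = f * h := by simp; group
  have e₂ : h * (MulAut.conjNormal h⁻¹ f : F) * h⁻¹ = f := by simp; group
  have e₃ : MulAut.conjNormal h⁻¹ f * MulAut.conjNormal (f * h : H)⁻¹ a =
      MulAut.conjNormal h⁻¹ (a * f) := by
    ext; simp; group
  have e₄ : MulAut.conjNormal h (MulAut.conjNormal h⁻¹ (a * f) * (MulAut.conjNormal h⁻¹ f)⁻¹) = a := by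
    ext; simp
  have e₅ : MulAut.conjNormal h (MulAut.conjNormal h⁻¹ f) = f := by
    ext; simp
  have e₆ : h * ((MulAut.conjNormal h⁻¹ f : F) * (MulAut.conjNormal (f * h : H)⁻¹ a : F) *
      ((MulAut.conjNormal h⁻¹ f)⁻¹ : F)) * h⁻¹ = (a : H) := by
    simp; group
  rw [e₆, e₂, e₁, e₃, e₄, e₅] at h₁
  rw [e] at h₃
  apply Additive.ofMul.injective
  simp only [ofMul_mul, ofMul_inv, mul_assoc, Subgroup.coe_mul] at *
  linear_combination (norm := abel) -h₁ - h₃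

/-- `freeLeft` was defined as the right action transported through the braiding. This relation
between the two is the form in which locality enters the cochain. -/
theorem ε_mul_trivCochain (hs₁ : s 1 = 1) (h : H) (f : F) :
    D.trivCochain s hs h f = D.ε h f * D.trivCochain s hs (h * f * h⁻¹) h := by
  have e : h * f * h⁻¹ = (MulAut.conjNormal h f : F) := by simp
  have e' : MulAut.conjNormal h⁻¹ (MulAut.conjNormal h f) = f := by ext; simp
  rw [e, trivCochain_coe_right D s hs hs₁, trivCochain_coe_left D s hs hs₁, e', freeLeft]
  simp

/-- An element of F on the left can be carried to the right past g and h with `ε_mul_trivCochain`,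
at the cost of values of `ε` that cancel by `ε_mul`. The claim thus follows from the two cases with
the element of F in the middle and on the right. -/
theorem trivCochain_mul_left (hs₁ : s 1 = 1) (f : F) (g h : H) :
    α f g h * D.trivCochain s hs f g * D.trivCochain s hs (f * g) h =
      D.trivCochain s hs g h * D.trivCochain s hs f (g * h) := by
  -- Conjugates are chosen so that the element can be moved first past g and then past h.
  obtain ⟨f', rfl⟩ : ∃ f', f = MulAut.conjNormal g f' :=
    ⟨MulAut.conjNormal g⁻¹ f, by ext; simp⟩
  obtain ⟨f'', rfl⟩ : ∃ l, f' = MulAut.conjNormal h l :=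
    ⟨MulAut.conjNormal h⁻¹ f', by ext; simp⟩
  have h₁ := congrArg Additive.ofMul (D.ε_mul_trivCochain s hs hs₁ g (MulAut.conjNormal h f''))
  have h₂ := congrArg Additive.ofMul (D.ε_mul_trivCochain s hs hs₁ h f'')
  have h₃ := congrArg Additive.ofMul (D.ε_mul_trivCochain s hs hs₁ (g * h) f'')
  have h₄ := congrArg Additive.ofMul (D.ε_mul g h f'')
  have h₅ := congrArg Additive.ofMul
    (D.trivCochain_mul_mid s hs hs₁ g (MulAut.conjNormal h f'') h)
  have h₆ := congrArg Additive.ofMul (D.trivCochain_mul_right s hs hs₁ g h f'')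
  apply Additive.ofMul.injective
  simp only [ofMul_mul, ofMul_inv, MulAut.conjNormal_apply, ← mul_assoc, mul_inv_rev,
    inv_mul_cancel_right, Cocycle3.two] at *
  linear_combination (norm := abel) -h₁ - h₂ + h₃ + h₄ + h₅ - h₆

/-- The coboundary of `trivCochain`, times `α`. -/
def inflated (g h l : H) : kˣ :=
  α g h l * D.trivCochain s hs g h * D.trivCochain s hs (g * h) l *
    (D.trivCochain s hs h l * D.trivCochain s hs g (h * l))⁻¹

/-- The ψ-terms form a coboundary and cancel, which leaves the cocycle identity of `α`. -/
theorem inflated_cocycle (f g h l : H) :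
    D.inflated s hs g h l * D.inflated s hs f (g * h) l * D.inflated s hs f g h =
      D.inflated s hs (f * g) h l * D.inflated s hs f g (h * l) := by
  have h₁ := congrArg Additive.ofMul (α.cocycle f g h l)
  apply Additive.ofMul.injective
  simp only [inflated, ofMul_mul, ofMul_inv, ← mul_assoc] at *
  linear_combination (norm := abel) h₁

theorem inflated_coe_right (hs₁ : s 1 = 1) (g h : H) (f : F) : D.inflated s hs g h f = 1 := by
  rw [inflated, trivCochain_mul_right D s hs hs₁, mul_inv_cancel]

theorem inflated_coe_mid (hs₁ : s 1 = 1) (g : H) (f : F) (h : H) :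
    D.inflated s hs g f h = 1 := by
  rw [inflated, trivCochain_mul_mid D s hs hs₁, mul_inv_cancel]

theorem inflated_coe_left (hs₁ : s 1 = 1) (f : F) (g h : H) : D.inflated s hs f g h = 1 := by
  rw [inflated, trivCochain_mul_left D s hs hs₁, mul_inv_cancel]

theorem inflated_mul_right (hs₁ : s 1 = 1) (g h l : H) (f : F) :
    D.inflated s hs g h (l * f) = D.inflated s hs g h l := by
  simpa [inflated_coe_right D s hs hs₁] using (D.inflated_cocycle s hs g h l f).symm

/-- In the cocycle identity at (g, h, f, l) three terms are 1. The element f left in front of l is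
conjugated to its right, where `inflated_mul_right` absorbs it. The first variable is treated in the
same way afterwards. -/
theorem inflated_mul_mid (hs₁ : s 1 = 1) (g h l : H) (f : F) :
    D.inflated s hs g (h * f) l = D.inflated s hs g h l := by
  have h₁ := D.inflated_cocycle s hs g h f l
  rw [inflated_coe_mid D s hs hs₁, inflated_coe_mid D s hs hs₁, inflated_coe_right D s hs hs₁,
    show (f : H) * l = l * (MulAut.conjNormal l⁻¹ f : F) by simp; group,
    inflated_mul_right D s hs hs₁] at h₁
  simpa using h₁

theorem inflated_mul_left (hs₁ : s 1 = 1) (g h l : H) (f : F) :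
    D.inflated s hs (g * f) h l = D.inflated s hs g h l := by
  have h₁ := D.inflated_cocycle s hs g f h l
  rw [inflated_coe_mid D s hs hs₁, inflated_coe_mid D s hs hs₁, inflated_coe_left D s hs hs₁,
    show (f : H) * h = h * (MulAut.conjNormal h⁻¹ f : F) by simp; group,
    inflated_mul_mid D s hs hs₁] at h₁
  simpa using h₁.symm

theorem inflated_mk (hs₁ : s 1 = 1) (g h l : H) :
    D.inflated s hs (rep s g) (rep s h) (rep s l) = D.inflated s hs g h l := by
  conv_rhs => rw [← rep_mul_res s hs g, ← rep_mul_res s hs h, ← rep_mul_res s hs l]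
  rw [inflated_mul_left D s hs hs₁, inflated_mul_mid D s hs hs₁, inflated_mul_right D s hs hs₁]

/-- The cocycle of `H ⧸ F` whose inflation is cohomologous to `α`. -/
def deflated (hs₁ : s 1 = 1) : Cocycle3 k (H ⧸ F) where
  toFun x y z := D.inflated s hs (s x) (s y) (s z)
  cocycle x y z w := by
    obtain ⟨f, rfl⟩ := QuotientGroup.mk_surjective x
    obtain ⟨g, rfl⟩ := QuotientGroup.mk_surjective y
    obtain ⟨h, rfl⟩ := QuotientGroup.mk_surjective z
    obtain ⟨l, rfl⟩ := QuotientGroup.mk_surjective w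
    have := D.inflated_cocycle s hs f g h l
    rw [← inflated_mk D s hs hs₁ g h l, ← inflated_mk D s hs hs₁ f (g * h) l,
      ← inflated_mk D s hs hs₁ f g h, ← inflated_mk D s hs hs₁ (f * g) h l,
      ← inflated_mk D s hs hs₁ f g (h * l)] at this
    exact this
  one_left y z := by rw [hs₁]; exact D.inflated_coe_left s hs hs₁ 1 _ _
  one_mid y z := by rw [hs₁]; exact D.inflated_coe_mid s hs hs₁ _ 1 _
  one_right y z := by rw [hs₁]; exact D.inflated_coe_right s hs hs₁ _ _ 1

theorem deflated_mk (hs₁ : s 1 = 1) (g h l : H) :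
    D.deflated s hs hs₁ g h l = D.inflated s hs g h l := D.inflated_mk s hs hs₁ g h l

/-- As `inflated` depends only on cosets, s(z) may be replaced by l = s(y)⁻¹s(x)⁻¹s(xyz). Then
s(x)s(y)l is a representative and one of the four values of ψ is 1; the others follow from the
normalisation of `freeGen` and `freeRight` at representatives. -/
theorem deflated_eq_reduced (hs₁ : s 1 = 1) (x y z : H ⧸ F) :
    D.deflated s hs hs₁ x y z = D.reduced s hs x y z := by
  set a : F := τ F s hs y z with ha
  set b : F := τ F s hs x (y * z) with hb
  set c : F := τ F s hs x y with hc
  set d : F := τ F s hs (x * y) z with hd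
  set h : H := (s (x * y))⁻¹ * s (x * y * z) with hh
  set c' : F := MulAut.conjNormal h⁻¹ c with hc'
  set l : H := (s y)⁻¹ * (s x)⁻¹ * s (x * y * z) with hl
  have ea : (a : H) = (s z)⁻¹ * (s y)⁻¹ * s (y * z) := rfl
  have eb : (b : H) = (s (y * z))⁻¹ * (s x)⁻¹ * s (x * y * z) := by rw [mul_assoc x]; rfl
  have ec : (c : H) = (s y)⁻¹ * (s x)⁻¹ * s (x * y) := rfl
  have ed : (d : H) = (s z)⁻¹ * (s (x * y))⁻¹ * s (x * y * z) := rfl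
  have el : l = s z * a * b := by rw [ea, eb, hl]; group
  have el' : l = c * h := by rw [ec, hh, hl]; group
  have e₀ : D.deflated s hs hs₁ x y z = D.inflated s hs (s x) (s y) l := by
    change D.inflated s hs _ _ _ = _
    rw [el, inflated_mul_right D s hs hs₁, inflated_mul_right D s hs hs₁]
  have e₁ : D.trivCochain s hs (s x) (s y * l) = 1 := by
    rw [trivCochain_section, freeGen_section D s hs _ _ (x * y * z)]
    rw [hl]; group
  -- `e₂` and `e₃` evaluate ψ(s(y), l) by means of l = s(z)ab.
  have e₂ := D.freeGen_mul s hs (s y) (s z * a) b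
  rw [freeGen_section D s hs (s y) (s z * a) (y * z) (by rw [ea]; group), ← el,
    show s y * (s z * (a : H)) = s (y * z) by rw [ea]; group, freeRight_section] at e₂
  have e₃ := D.freeRight_mul s hs (s z) a b
  rw [freeRight_section, freeRight_section] at e₃
  -- ψ(s(x), s(y)) and ψ(s(x)s(y), l), with l = ch, both involve `freeRight` at (s(x)s(y), c). This
  -- value need not be computed: it cancels between `e₄` and `e₅`.
  have e₄ := D.freeGen_mul s hs (s x) (s y) c
  rw [freeGen_section D s hs (s x) (s y * c) (x * y) (by rw [ec]; group),
    freeRight_section] at e₄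
  have e₅ := D.trivCochain_mul_mid s hs hs₁ (s x * s y) c h
  rw [← el', show s x * s y * (c : H) = s (x * y) by rw [ec]; group, trivCochain_section,
    freeGen_section D s hs _ h (x * y * z) (by rw [hh]; group),
    trivCochain_coe_right D s hs hs₁, trivCochain_coe_left D s hs hs₁, ← hc', freeLeft] at e₅
  -- The left action of c in degree h leaves the right action of c' there; since h = s(z)d, it can
  -- be traced back to the representative s(z).
  have e₆ := D.freeRight_mul s hs (s z) d c'
  rw [freeRight_section, freeRight_section, show s z * (d : H) = h by rw [ed, hh]; group] at e₆
  rw [e₀, inflated, e₁, trivCochain_section, trivCochain_section]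
  change _ = α (s x) (s y) l * D.γ a b * D.ε h c' * (D.γ d c')⁻¹ *
    α (s x * s y) c h * α (s z) d c' * (α (s z) a b * α (s y) (s z * a) b * α (s x) (s y) c)⁻¹
  replace e₂ := congrArg Additive.ofMul e₂
  replace e₃ := congrArg Additive.ofMul e₃
  replace e₄ := congrArg Additive.ofMul e₄
  replace e₅ := congrArg Additive.ofMul e₅
  replace e₆ := congrArg Additive.ofMul e₆
  apply Additive.ofMul.injective
  simp only [ofMul_mul, ofMul_inv, ofMul_one] at e₂ e₃ e₄ e₅ e₆ ⊢
  linear_combination (norm := abel) e₂ + e₃ + e₄ - e₅ - e₆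

end Cochain

/-- A cochain `ψ` that relates `α` to the inflation of a cocycle `ω` of `H ⧸ F`, `γ` to `1` and `ε`
to `1`. -/
structure Trivialization {k H : Type u} [Field k] [Group H] {α : Cocycle3 k H} {F : Subgroup H}
    [F.Normal] (D : AlgData α F) (ω : Cocycle3 k (H ⧸ F)) where
  ψ : H → H → kˣ
  coboundary : ∀ g h l : H, ω g h l * ψ h l * ψ g (h * l) = α g h l * ψ g h * ψ (g * h) l
  ψ_coe : ∀ f g : F, ψ f g = D.γ f g
  ψ_ε : ∀ (h : H) (f : F), ψ h f = D.ε h f * ψ (h * f * h⁻¹) h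
  ψ_one_left : ∀ g, ψ 1 g = 1
  ψ_one_right : ∀ g, ψ g 1 = 1

/-- The trivialization given by a section of `H → H ⧸ F`. -/
def trivialization {k H : Type u} [Field k] [Group H] {α : Cocycle3 k H} {F : Subgroup H}
    [F.Normal] (D : AlgData α F) (s : H ⧸ F → H) (hs : ∀ x, (s x : H ⧸ F) = x) (hs₁ : s 1 = 1) :
    D.Trivialization (D.deflated s hs hs₁) where
  ψ := D.trivCochain s hs
  coboundary g h l := by
    rw [deflated_mk, inflated, mul_assoc _ (D.trivCochain s hs h l), inv_mul_cancel_right]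
  ψ_coe f g := by rw [trivCochain_coe_right D s hs hs₁, freeRight_coe D s hs hs₁]
  ψ_ε := D.ε_mul_trivCochain s hs hs₁
  ψ_one_left g := by
    have := D.trivCochain_coe_left s hs hs₁ 1 g
    rw [map_one, freeLeft, freeRight_one, D.ε_one_right] at this
    simpa using this
  ψ_one_right g := by
    have := D.trivCochain_coe_right s hs hs₁ g 1
    rwa [freeRight_one] at this

end AlgData

/-! ### Transport of ribbon structures -/

namespace IsRibbonTwist

variable {C D : Type*} [Category* C] [Category* D] [MonoidalCategory C] [MonoidalCategory D]
  [BraidedCategory C] [BraidedCategory D]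

/-- Compatibility of a twist with duality can be checked on one dual. -/
theorem dual_of_exactPairing {θ : 𝟭 C ≅ 𝟭 C} {X Y : C} [p : ExactPairing X Y]
    (h : η_ X Y ≫ θ.hom.app X ▷ Y = η_ X Y ≫ X ◁ θ.hom.app Y) (Z : C) [q : ExactPairing X Z] :
    η_ X Z ≫ θ.hom.app X ▷ Z = η_ X Z ≫ X ◁ θ.hom.app Z := by
  -- The mate of the identity compares the two duals of X. It carries one coevaluation to the other,
  -- and naturality of θ along it transfers the equation.
  let f : Y ⟶ Z := @rightAdjointMate C _ _ X X ⟨Z⟩ ⟨Y⟩ (𝟙 X)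
  have e : η_ X Y ≫ X ◁ f = η_ X Z := by
    have := @coevaluation_comp_rightAdjointMate C _ _ X X ⟨Z⟩ ⟨Y⟩ (𝟙 X)
    rw [id_whiskerRight, Category.comp_id] at this
    exact this
  have n : θ.hom.app Y ≫ f = f ≫ θ.hom.app Z := (θ.hom.naturality f).symm
  calc η_ X Z ≫ θ.hom.app X ▷ Z
      = η_ X Y ≫ X ◁ f ≫ θ.hom.app X ▷ Z := by rw [← e, Category.assoc]
    _ = (η_ X Y ≫ θ.hom.app X ▷ Y) ≫ X ◁ f := by
      rw [Category.assoc]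
      exact congrArg (_ ≫ ·) (whisker_exchange (θ.hom.app X) f)
    _ = η_ X Y ≫ X ◁ (f ≫ θ.hom.app Z) := by
      rw [h, Category.assoc, ← n]
      exact congrArg (_ ≫ ·) (MonoidalCategory.whiskerLeft_comp X _ f).symm
    _ = η_ X Z ≫ X ◁ θ.hom.app Z := by
      rw [← e, Category.assoc]
      exact congrArg (_ ≫ ·) (MonoidalCategory.whiskerLeft_comp X f _)

open Functor.LaxMonoidal Functor.OplaxMonoidal in
/-- Ribbon structures can be transported along braided equivalences. -/
theorem of_equivalence {θ : 𝟭 C ≅ 𝟭 C} {θ' : 𝟭 D ≅ 𝟭 D} (h : IsRibbonTwist θ') (F : C ⥤ D)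
    [F.IsEquivalence] [F.Braided]
    (hF : ∀ X, F.map (θ.hom.app X) = θ'.hom.app (F.obj X)) : IsRibbonTwist θ where
  rigid := by
    obtain ⟨_⟩ := h.rigid
    exact ⟨rigidCategoryOfEquivalence (F := F) F.asEquivalence.toAdjunction⟩
  -- As F is faithful and its tensorator invertible, the equation may be checked in D after
  -- precomposition with the tensorator, where it becomes the balance of θ'.
  balance X Y := F.map_injective <| by
    have n : μ F X Y ≫ θ'.hom.app (F.obj (X ⊗ Y)) = θ'.hom.app (F.obj X ⊗ F.obj Y) ≫ μ F X Y :=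
      θ'.hom.naturality (μ F X Y)
    rw [← cancel_epi (μ F X Y)]
    refine (congrArg (_ ≫ ·) (hF _)).trans (n.trans ?_)
    rw [h.balance]
    simp only [Functor.map_comp, Functor.map_braiding, Functor.Monoidal.map_tensor,
      Functor.Monoidal.μ_δ_assoc, Category.assoc]
    simp only [Functor.id_obj, hF, Functor.Monoidal.μ_δ_assoc]
  dual X Z _ := by
    obtain ⟨_⟩ := h.rigid
    -- By `dual_of_exactPairing` one dual of X suffices. The preimage Y of a dual of F(X) is taken,
    -- with the pairing lifted along the fully faithful F; up to the structure maps of F, its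
    -- coevaluation is then mapped to that of F(X).
    let i : F.obj (F.inv.obj ((F.obj X)ᘁ)) ≅ (F.obj X)ᘁ :=
      F.asEquivalence.counitIso.app _
    let Y := F.inv.obj ((F.obj X)ᘁ)
    let q : ExactPairing (F.obj X) (F.obj Y) := exactPairingCongrRight i
    let p : ExactPairing X Y := .ofFullyFaithful F X Y
    refine dual_of_exactPairing (Y := Y) (F.map_injective ?_) Z
    have e : F.map (η_ X Y) = η F ≫ η_ (F.obj X) (F.obj Y) ≫ μ F X Y := F.map_preimage _
    have d := h.dual (F.obj X) (F.obj Y)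
    rw [F.map_comp, F.map_comp, e]
    simp only [Category.assoc]
    refine congrArg (η F ≫ ·) ?_
    have w₁ : μ F X Y ≫ F.map (θ.hom.app X ▷ Y) = θ'.hom.app (F.obj X) ▷ F.obj Y ≫ μ F X Y := by
      rw [← hF]
      exact (Functor.LaxMonoidal.μ_natural_left F (θ.hom.app X) Y).symm
    have w₂ : μ F X Y ≫ F.map (X ◁ θ.hom.app Y) = F.obj X ◁ θ'.hom.app (F.obj Y) ≫ μ F X Y := by
      rw [← hF]
      exact (Functor.LaxMonoidal.μ_natural_right F X (θ.hom.app Y)).symm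
    refine (congrArg (_ ≫ ·) w₁).trans (Eq.trans ?_ (congrArg (_ ≫ ·) w₂).symm)
    exact (Category.assoc _ _ _).symm.trans ((congrArg (· ≫ μ F X Y) d).trans (Category.assoc _ _ _))

end IsRibbonTwist

/-! ### The ribbon structure of `ZObj α` -/

namespace ZObj

variable {k G : Type u} [Field k] [Group G] [Fintype G] {α : Cocycle3 k G}

/-- In degrees g and h the double braiding gives (ghg⁻¹).v ⊗ g.w, and the twists then act by the new
degrees of the factors. In both factors the two group elements multiply to gh, the element by which
the twist of the tensor product acts; the multipliers cancel by a single instance of the cocycle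
identity. -/
theorem twist_balance (X Y : ZObj α) : (twist α).hom.app (X ⊗ Y) =
    (β_ X Y).hom ≫ (β_ Y X).hom ≫ ((twist α).hom.app X ⊗ₘ (twist α).hom.app Y) :=
  hom_ext <| tens_ext fun g v hv h w hw => by
    change twistLin (tensor X Y) (v ⊗ₜ w) =
      TensorProduct.map (twistLin X) (twistLin Y) (braidHom Y X (braidHom X Y (v ⊗ₜ w)))
    rw [twistLin_apply (hv.tmul hw), act_tmul hv hw, braidHom_tmul hv, braidHom_tmul (hw.act g),
      TensorProduct.map_tmul, twistLin_apply (hw.act g), twistLin_apply (hv.act (g * h * g⁻¹))]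
    have e₁ := hv.act_mul (g * h * g⁻¹ * g * (g * h * g⁻¹)⁻¹) (g * h * g⁻¹)
    rw [show g * h * g⁻¹ * g * (g * h * g⁻¹)⁻¹ * (g * h * g⁻¹) = g * h by group] at e₁
    have e₂ := hw.act_mul (g * h * g⁻¹) g
    rw [inv_mul_cancel_right] at e₂
    have h₁ := congrArg Additive.ofMul
      (α.cocycle (g * h * g⁻¹ * g * (g * h * g⁻¹)⁻¹) (g * h * g⁻¹) g h)
    have h₂ : α.one (g * h) g h * α.two (g * h * g⁻¹) g h *
        α.two (g * h * g⁻¹ * g * (g * h * g⁻¹)⁻¹) (g * h * g⁻¹) g = 1 := by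
      apply Additive.ofMul.injective
      simp only [Cocycle3.one, Cocycle3.two, inv_mul_cancel_right, ← mul_assoc, mul_inv_rev,
        inv_inv, ofMul_mul, ofMul_inv, ofMul_one, mul_inv_cancel_right] at *
      linear_combination (norm := abel) -h₁
    have h₃ := congrArg Units.val h₂
    push_cast at h₃
    rw [e₁, e₂, TensorProduct.tmul_smul, ← TensorProduct.smul_tmul', smul_smul, smul_smul, h₃,
      one_smul]

/-- Read as endomorphisms of X, both sides are the twist weighted by α(f, f⁻¹, f) in degree f: a
coordinate supported in degree f has degree f⁻¹ in the dual, and the contragredient action of f⁻¹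
precomposes it with f, up to a scalar. -/
theorem coev_twist (X : ZObj α) : η_ X (dual X) ≫ (twist α).hom.app X ▷ dual X =
    η_ X (dual X) ≫ X ◁ (twist α).hom.app (dual X) :=
  hom_ext <| LinearMap.ext_ring <| by
    change TensorProduct.map (twistLin X) LinearMap.id ((1 : k) • X.coevEl) =
      TensorProduct.map LinearMap.id (twistLin (dual X)) ((1 : k) • X.coevEl)
    rw [one_smul]
    refine dualTensorHom_injective X.V (lin_ext fun a w hw => ?_)
    have key : ∀ f, ∑ i, (α f f⁻¹ f : k) •
        ((dualTensorHom k X.V X.V ∘ₗ (TensorProduct.comm k X.V (Module.Dual k X.V)).toLinearMap)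
          (TensorProduct.map (twistLin X) LinearMap.id (X.proj f (Module.finBasis k X.V i) ⊗ₜ
            ((Module.finBasis k X.V).coord i ∘ₗ X.proj f)))) w =
        (α f f⁻¹ f : k) • X.act f (X.proj f w) := by
      intro f
      have h := X.contract_coord (X.act f ∘ₗ X.proj f) (X.proj f w)
      simp only [LinearMap.comp_apply, X.proj_self] at h
      simp only [LinearMap.comp_apply, LinearEquiv.coe_coe, TensorProduct.map_tmul,
        TensorProduct.comm_tmul, dualTensorHom_apply, twistLin_apply (X.isDeg_proj f _),
        LinearMap.id_apply, ← Finset.smul_sum]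
      rw [h]
    have key' : ∀ f, ∑ i, (α f f⁻¹ f : k) •
        ((dualTensorHom k X.V X.V ∘ₗ (TensorProduct.comm k X.V (Module.Dual k X.V)).toLinearMap)
          (TensorProduct.map LinearMap.id (twistLin (dual X))
            (X.proj f (Module.finBasis k X.V i) ⊗ₜ
            ((Module.finBasis k X.V).coord i ∘ₗ X.proj f)))) w =
        (α f f⁻¹ f : k) • X.act f (X.proj f w) := by
      intro f
      have e := hw.inv_act f
      -- `dAct_apply` evaluates the action of f⁻¹ on a functional only at vectors f⁻¹.u, so w is
      -- written as a multiple of f⁻¹.(f.w).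
      have e' : ∀ i, dAct X f⁻¹ ((Module.finBasis k X.V).coord i ∘ₗ X.proj f) w =
          (α.two f⁻¹ f a : k) * ((α.one f⁻¹ f⁻¹ f)⁻¹ : k) *
            (Module.finBasis k X.V).coord i (X.proj f (X.act f w)) := by
        intro i
        conv_lhs => rw [← e, map_smul, dAct_apply (X.isDeg_coord f _), inv_inv]
        rw [smul_eq_mul, mul_assoc]
        rfl
      have h := X.contract_coord (X.proj f) (X.proj f (X.act f w))
      simp only [X.proj_self] at h
      simp only [LinearMap.comp_apply, LinearEquiv.coe_coe, TensorProduct.map_tmul,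
        TensorProduct.comm_tmul, dualTensorHom_apply, LinearMap.id_apply,
        twistLin_apply (X.isDeg_coord f _)]
      change ∑ i, (α f f⁻¹ f : k) •
        (dAct X f⁻¹ ((Module.finBasis k X.V).coord i ∘ₗ X.proj f) w) • _ = _
      simp only [e', mul_smul, ← Finset.smul_sum]
      rw [h]
      by_cases ha : f = a
      · subst ha
        rw [show X.proj f (X.act f w) = X.act f w from hw.act_self,
          show X.proj f w = w from hw]
        congr 1
        have := α.mul_inv_self f
        -- The multiplier of the action and that of the dual agree because α(f⁻¹, f, f⁻¹) α(f, f⁻¹,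
        -- f) = 1.
        have h₂ : α.two f⁻¹ f f = α.one f⁻¹ f⁻¹ f := by
          have h₁ := congrArg Additive.ofMul this
          apply Additive.ofMul.injective
          simp only [Cocycle3.one, Cocycle3.two, inv_mul_cancel, one_mul, mul_one, inv_inv,
            ofMul_mul, ofMul_inv, ofMul_one, mul_inv_cancel_right, inv_mul_cancel_right,
            inv_one] at *
          linear_combination (norm := abel) -h₁
        rw [h₂, ← mul_smul, mul_inv_cancel₀ (Units.ne_zero _), one_smul]
      · have h₁ : X.proj f w = 0 := hw.proj_ne ha
        have h₂ : X.proj f (X.act f w) = 0 := (hw.act f).proj_ne fun e => ha <| by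
          have := congrArg (f⁻¹ * · * f) e
          simpa [mul_assoc] using this
        rw [h₁, h₂]; simp
    simp only [coevEl, map_sum, map_smul, LinearMap.sum_apply, LinearMap.smul_apply]
    refine Finset.sum_congr rfl fun f _ => ?_
    rw [key, key']

noncomputable instance : RigidCategory (ZObj α) where
  rightDual X := ⟨dual X⟩
  leftDual X := { leftDual := dual X, exact := BraidedCategory.exactPairing_swap X (dual X) }

theorem isRibbonTwist_twist : IsRibbonTwist (twist α) where
  rigid := ⟨inferInstance⟩
  balance := twist_balance
  dual X Y _ := IsRibbonTwist.dual_of_exactPairing (coev_twist X) Y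

end ZObj

namespace AlgData

/-! ### Right modules in terms of elements -/

section RightMul

variable {k H : Type u} [Field k] [Group H] [Fintype H] {α : Cocycle3 k H} {F : Subgroup H}
  [F.Normal] {D : AlgData α F}

/-- The action of `e_f` on a right module. -/
noncomputable def mulE (M : RMod D.obj) (f : F) : M.X.V →ₗ[k] M.X.V :=
  M.act.lin ∘ₗ (TensorProduct.mk k M.X.V (F →₀ k)).flip (e k f)

theorem isDeg_mulE {M : RMod D.obj} {g : H} {v : M.X.V} (hv : M.X.IsDeg g v) (f : F) :
    M.X.IsDeg (g * f) (mulE M f v) :=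
  ZObj.IsDeg.map (X := M.X ⊗ D.obj) (ZObj.IsDeg.tmul hv (D.isDeg_e f)) M.act

theorem mulE_one (M : RMod D.obj) (v : M.X.V) : mulE M 1 v = v := by
  have h := LinearMap.congr_fun (congrArg ZObj.Hom.lin M.act_one) (v ⊗ₜ[k] (1 : k))
  change M.act.lin (v ⊗ₜ[k] ((1 : k) • e k (1 : F))) = (1 : k) • v at h
  rwa [one_smul, one_smul] at h

theorem mulE_mul {M : RMod D.obj} {g : H} {v : M.X.V} (hv : M.X.IsDeg g v) (f l : F) :
    (D.γ f l : k) • mulE M (f * l) v = (α g f l : k) • mulE M l (mulE M f v) := by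
  have h := LinearMap.congr_fun (congrArg ZObj.Hom.lin M.act_mul) (v ⊗ₜ[k] (e k f ⊗ₜ[k] e k l))
  change M.act.lin (v ⊗ₜ[k] D.mulLin (e k f ⊗ₜ e k l)) =
    M.act.lin (TensorProduct.map M.act.lin LinearMap.id
      (ZObj.assocInv M.X D.obj D.obj (v ⊗ₜ[k] (e k f ⊗ₜ[k] e k l)))) at h
  rw [D.mulLin_e, ZObj.assocInv_tmul hv (D.isDeg_e f) (D.isDeg_e l), TensorProduct.tmul_smul,
    map_smul, map_smul, map_smul, TensorProduct.map_tmul] at h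
  exact h

theorem act_mulE {M : RMod D.obj} {g : H} {v : M.X.V} (hv : M.X.IsDeg g v) (h : H) (f : F) :
    M.X.act h (mulE M f v) =
      ((α.one h g f * D.ε h f : kˣ) : k) • mulE M (MulAut.conjNormal h f) (M.X.act h v) := by
  have h' := M.act.act_comm h (v ⊗ₜ[k] e k f)
  change M.act.lin (ZObj.tAct M.X D.obj h (v ⊗ₜ[k] e k f)) = M.X.act h (mulE M f v) at h'
  rw [ZObj.tAct_tmul hv (D.isDeg_e f), D.act_e, TensorProduct.tmul_smul, smul_smul, map_smul] at h'
  exact h'.symm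

/-- The first braiding conjugates f by the degree g of v, and the second lets gfg⁻¹ act on v.
Locality equates the result with v e_f. -/
theorem mulE_local {M : RMod D.obj} (hM : RMod.IsLocal D.obj M) {g : H} {v : M.X.V}
    (hv : M.X.IsDeg g v) (f : F) :
    mulE M f v = (D.ε g f : k) •
      mulE M (MulAut.conjNormal g f) (M.X.act (MulAut.conjNormal g f : F) v) := by
  have h := LinearMap.congr_fun (congrArg ZObj.Hom.lin hM) (v ⊗ₜ[k] e k f)
  change M.act.lin (ZObj.braidHom D.obj M.X (ZObj.braidHom M.X D.obj (v ⊗ₜ[k] e k f))) =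
    M.act.lin (v ⊗ₜ[k] e k f) at h
  rw [ZObj.braidHom_tmul hv, D.act_e, ← TensorProduct.smul_tmul', map_smul,
    ZObj.braidHom_tmul (D.isDeg_e _), map_smul] at h
  exact h.symm

theorem hom_mulE {M N : RMod D.obj} (φ : M ⟶ N) (f : F) (v : M.X.V) :
    φ.hom.lin (mulE M f v) = mulE N f (φ.hom.lin v) :=
  LinearMap.congr_fun (congrArg ZObj.Hom.lin φ.act_hom) (v ⊗ₜ[k] e k f)

end RightMul

namespace Trivialization

/-! ### Change of gauge by the cochain `ψ` -/

section Gauge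

variable {k H : Type u} [Field k] [Group H] {α : Cocycle3 k H} {F : Subgroup H}
  [F.Normal] {D : AlgData α F} {ω : Cocycle3 k (H ⧸ F)} (t : D.Trivialization ω)

/-- The correction of the action of `f` in degree `g`. -/
def corr (f g : H) : kˣ := t.ψ (f * g * f⁻¹) f * (t.ψ f g)⁻¹

/-- This is why the reduction takes twist to twist: the action of g on its own degree needs no
correction. -/
theorem corr_self (g : H) : t.corr g g = 1 := by simp [corr]

theorem corr_one_left (g : H) : t.corr 1 g = 1 := by
  simp [corr, t.ψ_one_left, t.ψ_one_right]

/-- By `ψ_ε`, the corrected action of H on the algebra merely permutes the e_f. -/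
theorem corr_coe (h : H) (f : F) : t.corr h f * D.ε h f = 1 := by
  rw [corr, t.ψ_ε]; simp

/-- α(f, g | h) is an alternating product of three values of `α`. The coboundary equation at these
triples replaces them by the values of `ω`, and the remaining ψ-terms assemble into `corr`. -/
theorem corr_two (f g h : H) : t.corr (f * g) h * α.two f g h =
    ω.two f g h * t.corr g h * t.corr f (g * h * g⁻¹) := by
  have h₁ := congrArg Additive.ofMul (t.coboundary f g h)
  have h₂ := congrArg Additive.ofMul (t.coboundary f (g * h * g⁻¹) g)
  have h₃ := congrArg Additive.ofMul (t.coboundary (f * g * h * (f * g)⁻¹) f g)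
  apply Additive.ofMul.injective
  simp only [corr, Cocycle3.two, inv_mul_cancel_right, ← mul_assoc, mul_inv_rev, ofMul_mul,
    ofMul_inv, QuotientGroup.mk_mul, QuotientGroup.mk_inv] at *
  linear_combination (norm := abel) h₁ - h₂ + h₃

/-- The same substitution as in `corr_two`, now for α(f | g, h). The terms ψ(g, h) and ψ(fgf⁻¹,
fhf⁻¹) that are left over are those absorbed by the tensorator. -/
theorem corr_one (f g h : H) : ω.one f g h * t.corr f g * t.corr f h * t.ψ g h =
    t.corr f (g * h) * α.one f g h * t.ψ (f * g * f⁻¹) (f * h * f⁻¹) := by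
  have h₁ := congrArg Additive.ofMul (t.coboundary f g h)
  have h₂ := congrArg Additive.ofMul (t.coboundary (f * g * f⁻¹) f h)
  have h₃ := congrArg Additive.ofMul (t.coboundary (f * g * f⁻¹) (f * h * f⁻¹) f)
  apply Additive.ofMul.injective
  simp only [corr, Cocycle3.one, inv_mul_cancel_right, ← mul_assoc, mul_inv_rev, ofMul_mul,
    ofMul_inv, QuotientGroup.mk_mul, QuotientGroup.mk_inv] at *
  linear_combination (norm := abel) h₁ - h₂ + h₃

/-- With an argument in F, the inflation of the normalised cocycle `ω` is 1, so the coboundary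
equation relates `α` and ψ alone. -/
theorem ψ_mul (g : H) (f l : F) : t.ψ f l * t.ψ g (f * l) = α g f l * t.ψ g f * t.ψ (g * f) l := by
  have := t.coboundary g f l
  rwa [(QuotientGroup.eq_one_iff (f : H)).2 f.2, ω.one_mid, one_mul] at this

/-- `corr_one` with its last argument in F: the term of `ω` disappears, and `corr` at (h, f) is the
inverse of ε_h(f). -/
theorem corr_mul (h g : H) (f : F) : t.ψ g f * t.corr h g =
    t.corr h (g * f) * α.one h g f * D.ε h f * t.ψ (h * g * h⁻¹) (h * f * h⁻¹) := by
  have h₁ := t.corr_one h g f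
  rw [(QuotientGroup.eq_one_iff (f : H)).2 f.2, ω.one_one_right, one_mul] at h₁
  replace h₁ := congrArg Additive.ofMul h₁
  have h₂ := congrArg Additive.ofMul (t.corr_coe h f)
  apply Additive.ofMul.injective
  simp only [ofMul_mul, ofMul_one] at *
  linear_combination (norm := abel) h₁ - h₂

end Gauge

/-! ### The corrected actions on a module -/

section Shift

variable {k H : Type u} [Field k] [Group H] [Fintype H] {α : Cocycle3 k H} {F : Subgroup H}
  [F.Normal] {D : AlgData α F} {ω : Cocycle3 k (H ⧸ F)} (t : D.Trivialization ω)

/-- The corrected action of a group element on an object of `Z(H, α)`. -/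
def act (X : ZObj α) (f : H) : X.V →ₗ[k] X.V := ∑ g, (t.corr f g : k) • (X.act f ∘ₗ X.proj g)

theorem act_apply {X : ZObj α} {g : H} {v : X.V} (hv : X.IsDeg g v) (f : H) :
    t.act X f v = (t.corr f g : k) • X.act f v := by
  simp only [act, LinearMap.sum_apply, LinearMap.comp_apply, LinearMap.smul_apply]
  exact hv.sum (fun g' v' => (t.corr f g' : k) • X.act f v') (by simp)

theorem isDeg_act {X : ZObj α} {g : H} {v : X.V} (hv : X.IsDeg g v) (f : H) :
    X.IsDeg (f * g * f⁻¹) (t.act X f v) := by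
  rw [t.act_apply hv]; exact (hv.act f).smul _

theorem act_one (X : ZObj α) (v : X.V) : t.act X 1 v = v := by
  refine LinearMap.congr_fun (g := LinearMap.id) (ZObj.lin_ext fun g v hv => ?_) v
  rw [t.act_apply hv, t.corr_one_left, Units.val_one, one_smul, X.act_one]; rfl

theorem act_mul {X : ZObj α} {h : H} {v : X.V} (hv : X.IsDeg h v) (f g : H) :
    t.act X (f * g) v = (ω.two f g h : k) • t.act X f (t.act X g v) := by
  rw [t.act_apply hv, hv.act_mul, t.act_apply hv, map_smul, t.act_apply (hv.act g), smul_smul,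
    smul_smul, smul_smul, ← Units.val_mul, ← Units.val_mul, ← Units.val_mul, t.corr_two]

/-- The corrected action of `e_f` on a right module. -/
noncomputable def shift (M : RMod D.obj) (f : F) : M.X.V →ₗ[k] M.X.V :=
  ∑ g, ((t.ψ g f)⁻¹ : kˣ).val • (mulE M f ∘ₗ M.X.proj g)

variable {M N : RMod D.obj} {g : H} {v : M.X.V}

theorem shift_apply (hv : M.X.IsDeg g v) (f : F) :
    t.shift M f v = ((t.ψ g f)⁻¹ : kˣ).val • mulE M f v := by
  simp only [shift, LinearMap.sum_apply, LinearMap.comp_apply, LinearMap.smul_apply]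
  exact hv.sum (fun g' v' => ((t.ψ g' f)⁻¹ : kˣ).val • mulE M f v') (by simp)

theorem mulE_eq_shift (hv : M.X.IsDeg g v) (f : F) :
    mulE M f v = (t.ψ g f : k) • t.shift M f v := by
  rw [t.shift_apply hv, smul_smul, ← Units.val_mul, mul_inv_cancel, Units.val_one, one_smul]

theorem isDeg_shift (hv : M.X.IsDeg g v) (f : F) : M.X.IsDeg (g * f) (t.shift M f v) := by
  rw [t.shift_apply hv]; exact (isDeg_mulE hv f).smul _

theorem shift_one (M : RMod D.obj) : t.shift M 1 = LinearMap.id :=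
  ZObj.lin_ext fun g v hv => by
    rw [t.shift_apply hv, mulE_one, Subgroup.coe_one, t.ψ_one_right]; simp

/-- The correction removes both `γ` and `α` from `mulE_mul`: by `ψ_mul` and ψ = γ on F, the group F
acts strictly, from the right. -/
theorem shift_mul (M : RMod D.obj) (f l : F) : t.shift M l ∘ₗ t.shift M f = t.shift M (f * l) :=
  ZObj.lin_ext fun g v hv => by
    have h := mulE_mul hv f l
    rw [LinearMap.comp_apply, t.shift_apply (t.isDeg_shift hv f), t.shift_apply hv,
      t.shift_apply hv, map_smul, smul_smul, ← Units.val_mul]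
    refine smul_right_injective _ (Units.ne_zero (D.γ f l)) ?_
    simp only []
    rw [smul_comm (D.γ f l : k) _ (mulE M (f * l) v), h, smul_smul, smul_smul, ← Units.val_mul,
      ← Units.val_mul, Subgroup.coe_mul]
    congr 2
    have h₁ := congrArg Additive.ofMul (t.ψ_mul g f l)
    rw [t.ψ_coe] at h₁
    apply Additive.ofMul.injective
    simp only [ofMul_mul, ofMul_inv] at *
    linear_combination (norm := abel) h₁

theorem hom_shift (φ : M ⟶ N) (f : F) (v : M.X.V) :
    φ.hom.lin (t.shift M f v) = t.shift N f (φ.hom.lin v) := by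
  refine LinearMap.congr_fun (f := φ.hom.lin ∘ₗ t.shift M f) (g := t.shift N f ∘ₗ φ.hom.lin)
    (ZObj.lin_ext fun g v hv => ?_) v
  rw [LinearMap.comp_apply, LinearMap.comp_apply, t.shift_apply hv, t.shift_apply (hv.map φ.hom),
    map_smul, hom_mulE]

theorem act_shift (hv : M.X.IsDeg g v) (h : H) (f : F) :
    t.act M.X h (t.shift M f v) = t.shift M (MulAut.conjNormal h f) (t.act M.X h v) := by
  rw [t.shift_apply hv, map_smul, t.act_apply (isDeg_mulE hv f), act_mulE hv, t.act_apply hv,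
    map_smul, t.shift_apply (hv.act h), smul_smul, smul_smul, smul_smul]
  simp only [← Units.val_mul]
  congr 2
  have h₁ := congrArg Additive.ofMul (t.corr_mul h g f)
  apply Additive.ofMul.injective
  simp only [ofMul_mul, ofMul_inv, MulAut.conjNormal_apply] at *
  linear_combination (norm := abel) -h₁

/-- Locality enters here. In corrected terms `mulE_local` says that the shift by g⁻¹fg is the action
of f followed by the shift by f; the latter is invertible, so the action of f is itself a shift. -/
theorem act_coe (hM : RMod.IsLocal D.obj M) (hv : M.X.IsDeg g v) (f : F) :
    t.act M.X f v = t.shift M (MulAut.conjNormal g⁻¹ f * f⁻¹) v := by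
  rw [← shift_mul, LinearMap.comp_apply]
  have e : MulAut.conjNormal g (MulAut.conjNormal g⁻¹ f) = f := by
    ext; simp
  have h : t.shift M (MulAut.conjNormal g⁻¹ f) v = t.shift M f (t.act M.X f v) := by
    have h₁ := mulE_local hM hv (MulAut.conjNormal g⁻¹ f)
    have h₂ := t.ψ_ε g (MulAut.conjNormal g⁻¹ f)
    have e' : g * (MulAut.conjNormal g⁻¹ f : F) * g⁻¹ = f := by simp [mul_assoc]
    rw [e'] at h₂
    rw [e] at h₁
    rw [t.shift_apply hv, h₁, t.act_apply hv, map_smul, t.shift_apply (hv.act f), smul_smul,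
      smul_smul, h₂]
    simp only [← Units.val_mul]
    congr 2
    apply Additive.ofMul.injective
    simp only [corr, ofMul_mul, ofMul_inv]
    abel
  rw [h, ← LinearMap.comp_apply, shift_mul, mul_inv_cancel, shift_one]; rfl

end Shift

end Trivialization
end AlgData

namespace AlgData
namespace Trivialization

/-! ### The reduction functor and its full faithfulness -/

section Reduction

variable {k H : Type u} [Field k] [Group H] [Fintype H] {α : Cocycle3 k H} {F : Subgroup H}
  [F.Normal] {D : AlgData α F} {ω : Cocycle3 k (H ⧸ F)} (t : D.Trivialization ω)
  (s : H ⧸ F → H) (hs : ∀ x, (s x : H ⧸ F) = x)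

/-- The map that moves every homogeneous component to the degree of the representative. -/
noncomputable def toRep (M : RMod D.obj) : M.X.V →ₗ[k] M.X.V :=
  ∑ g, t.shift M (res s hs g)⁻¹ ∘ₗ M.X.proj g

variable {M N : RMod D.obj} {g : H} {v : M.X.V}

theorem toRep_apply (hv : M.X.IsDeg g v) :
    t.toRep s hs M v = t.shift M (res s hs g)⁻¹ v := by
  simp only [toRep, LinearMap.sum_apply, LinearMap.comp_apply]
  exact hv.sum (fun g' v' => t.shift M (res s hs g')⁻¹ v') (by simp)

theorem isDeg_toRep (hv : M.X.IsDeg g v) : M.X.IsDeg (rep s g) (t.toRep s hs M v) := by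
  rw [t.toRep_apply s hs hv, show rep s g = g * ((res s hs g)⁻¹ : F) by
    rw [Subgroup.coe_inv, eq_mul_inv_iff_mul_eq, rep_mul_res]]
  exact t.isDeg_shift hv _

theorem toRep_shift (M : RMod D.obj) (f : F) :
    t.toRep s hs M ∘ₗ t.shift M f = t.toRep s hs M :=
  ZObj.lin_ext fun g v hv => by
    rw [LinearMap.comp_apply, t.toRep_apply s hs (t.isDeg_shift hv f), t.toRep_apply s hs hv,
      ← LinearMap.comp_apply, shift_mul, res_mul]
    simp

theorem toRep_shift_apply (f : F) (v : M.X.V) :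
    t.toRep s hs M (t.shift M f v) = t.toRep s hs M v :=
  LinearMap.congr_fun (t.toRep_shift s hs M f) v

/-- On each degree `toRep` is a shift, so shift-invariant maps do not see it. This allows its range
to serve as the space of coinvariants. -/
theorem comp_toRep {W : Type*} [AddCommGroup W] [Module k W] {φ : M.X.V →ₗ[k] W}
    (hφ : ∀ f, φ ∘ₗ t.shift M f = φ) : φ ∘ₗ t.toRep s hs M = φ :=
  ZObj.lin_ext fun g v hv => by
    rw [LinearMap.comp_apply, t.toRep_apply s hs hv]
    exact LinearMap.congr_fun (hφ _) v

theorem toRep_toRep (v : M.X.V) : t.toRep s hs M (t.toRep s hs M v) = t.toRep s hs M v :=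
  LinearMap.congr_fun (t.comp_toRep s hs (t.toRep_shift s hs M)) v

/-- The quotient of a right module by the corrected action of the basis vectors `e_f`, realised by
the components of the degrees of the representatives. -/
abbrev redV (M : RMod D.obj) : Type u := LinearMap.range (t.toRep s hs M)

/-- The projection to `redV`. -/
noncomputable def redπ (M : RMod D.obj) : M.X.V →ₗ[k] t.redV s hs M :=
  (t.toRep s hs M).rangeRestrict

/-- The section of `redπ`. -/
noncomputable def redι (M : RMod D.obj) : t.redV s hs M →ₗ[k] M.X.V :=
  (LinearMap.range (t.toRep s hs M)).subtype

theorem redι_redπ (v : M.X.V) : t.redι s hs M (t.redπ s hs M v) = t.toRep s hs M v := rfl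

theorem redπ_redι (w : t.redV s hs M) : t.redπ s hs M (t.redι s hs M w) = w := by
  obtain ⟨_, v, rfl⟩ := w
  exact Subtype.ext (t.toRep_toRep s hs v)

theorem redπ_surjective (M : RMod D.obj) : Function.Surjective (t.redπ s hs M) :=
  LinearMap.surjective_rangeRestrict _

theorem redπ_shift (f : F) (v : M.X.V) :
    t.redπ s hs M (t.shift M f v) = t.redπ s hs M v :=
  Subtype.ext (t.toRep_shift_apply s hs f v)

theorem redπ_toRep (v : M.X.V) : t.redπ s hs M (t.toRep s hs M v) = t.redπ s hs M v :=
  Subtype.ext (t.toRep_toRep s hs v)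

theorem redV_ext {W : Type*} [AddCommGroup W] [Module k W] {φ ψ : t.redV s hs M →ₗ[k] W}
    (h : ∀ g v, M.X.IsDeg g v → φ (t.redπ s hs M v) = ψ (t.redπ s hs M v)) : φ = ψ :=
  (LinearMap.cancel_right (t.redπ_surjective s hs M)).1 (ZObj.lin_ext h)

/-- The universal property of `redπ`. -/
noncomputable def redDesc {W : Type*} [AddCommGroup W] [Module k W] (φ : M.X.V →ₗ[k] W) :
    t.redV s hs M →ₗ[k] W := φ ∘ₗ t.redι s hs M

theorem redDesc_redπ {W : Type*} [AddCommGroup W] [Module k W] {φ : M.X.V →ₗ[k] W}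
    (hφ : ∀ f, φ ∘ₗ t.shift M f = φ) (v : M.X.V) :
    t.redDesc s hs φ (t.redπ s hs M v) = φ v :=
  LinearMap.congr_fun (t.comp_toRep s hs hφ) v

/-- The projections of the reduced object. -/
noncomputable def redProj (M : RMod D.obj) (x : H ⧸ F) : t.redV s hs M →ₗ[k] t.redV s hs M :=
  t.redDesc s hs (t.redπ s hs M ∘ₗ M.X.proj (s x))

theorem redProj_redπ [DecidableEq (H ⧸ F)] (hv : M.X.IsDeg g v) (x : H ⧸ F) :
    t.redProj s hs M x (t.redπ s hs M v) = if x = g then t.redπ s hs M v else 0 := by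
  classical
  rw [redProj, redDesc, LinearMap.comp_apply, redι_redπ, LinearMap.comp_apply,
    (t.isDeg_toRep s hs hv).proj]
  have : s x = rep s g ↔ x = g :=
    ⟨fun h => by rw [← hs x, h, rep, hs], fun h => by rw [h, rep]⟩
  simp only [this]
  split_ifs
  · rw [redπ_toRep]
  · rw [map_zero]

/-- The action of a coset on the reduced object. -/
noncomputable def redAct (M : RMod D.obj) (x : H ⧸ F) : t.redV s hs M →ₗ[k] t.redV s hs M :=
  t.redDesc s hs (t.redπ s hs M ∘ₗ t.act M.X (s x))

theorem redπ_act_shift (h : H) (f : F) (v : M.X.V) :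
    t.redπ s hs M (t.act M.X h (t.shift M f v)) = t.redπ s hs M (t.act M.X h v) := by
  refine LinearMap.congr_fun (f := t.redπ s hs M ∘ₗ t.act M.X h ∘ₗ t.shift M f)
    (g := t.redπ s hs M ∘ₗ t.act M.X h) (ZObj.lin_ext fun g v hv => ?_) v
  simp only [LinearMap.comp_apply]
  rw [t.act_shift hv, redπ_shift]

theorem redπ_act_coe (hM : RMod.IsLocal D.obj M) (f : F) (v : M.X.V) :
    t.redπ s hs M (t.act M.X f v) = t.redπ s hs M v := by
  refine LinearMap.congr_fun (f := t.redπ s hs M ∘ₗ t.act M.X f)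
    (g := t.redπ s hs M) (ZObj.lin_ext fun g v hv => ?_) v
  rw [LinearMap.comp_apply, t.act_coe hM hv, redπ_shift]

/-- An element f differs from the representative of its coset by a left factor in F. This factor
acts by shifts, invisibly on the quotient, and the multiplier between the two actions is ω(1, · | ·)
= 1. So the action of H on the quotient factors through H/F. -/
theorem redAct_redπ (hM : RMod.IsLocal D.obj M) (f : H) (v : M.X.V) :
    t.redAct s hs M f (t.redπ s hs M v) = t.redπ s hs M (t.act M.X f v) := by
  rw [redAct, redDesc_redπ]
  · obtain ⟨f', h⟩ : ∃ f' : F, f = f' * rep s f :=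
      ⟨toF F (f * (rep s f)⁻¹) (by rw [QuotientGroup.mk_mul, QuotientGroup.mk_inv, rep, hs,
        mul_inv_cancel]), by simp [toF]⟩
    refine LinearMap.congr_fun (f := t.redπ s hs M ∘ₗ t.act M.X (rep s f))
      (g := t.redπ s hs M ∘ₗ t.act M.X f) (ZObj.lin_ext fun g v hv => ?_) v
    have e := t.act_mul hv f' (rep s f)
    rw [← h, (QuotientGroup.eq_one_iff (f' : H)).2 f'.2, ω.two_one_left, Units.val_one,
      one_smul] at e
    rw [LinearMap.comp_apply, LinearMap.comp_apply, e, redπ_act_coe _ _ _ hM]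
  · intro f'
    exact LinearMap.ext fun v => t.redπ_act_shift s hs _ f' v

variable [Fintype (H ⧸ F)]

/-- The object of `Z(H ⧸ F, ω)` given by a local module. -/
@[reducible] noncomputable def redObj (M : LocMod D.obj) : ZObj ω where
  V := t.redV s hs M.obj
  proj := t.redProj s hs M.obj
  proj_self x w := by
    classical
    refine LinearMap.congr_fun (f := t.redProj s hs M.obj x ∘ₗ t.redProj s hs M.obj x)
      (t.redV_ext s hs fun g v hv => ?_) w
    simp only [LinearMap.comp_apply, t.redProj_redπ s hs hv]
    split_ifs with h <;> simp [t.redProj_redπ s hs hv, h]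
  proj_ne x y hn w := by
    classical
    refine LinearMap.congr_fun (f := t.redProj s hs M.obj x ∘ₗ t.redProj s hs M.obj y) (g := 0)
      (t.redV_ext s hs fun g v hv => ?_) w
    simp only [LinearMap.comp_apply, t.redProj_redπ s hs hv]
    split_ifs with h
    · rw [t.redProj_redπ s hs hv, if_neg (h ▸ hn)]; rfl
    · simp
  sum_proj w := by
    classical
    rw [← LinearMap.sum_apply]
    refine LinearMap.congr_fun (g := LinearMap.id) (t.redV_ext s hs fun g v hv => ?_) w
    simp [LinearMap.sum_apply, t.redProj_redπ s hs hv]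
  act := t.redAct s hs M.obj
  act_one w := by
    obtain ⟨v, rfl⟩ := t.redπ_surjective s hs M.obj w
    rw [← QuotientGroup.mk_one, t.redAct_redπ s hs M.property, t.act_one]
  act_proj x y w := by
    classical
    obtain ⟨f, rfl⟩ := QuotientGroup.mk_surjective x
    refine LinearMap.congr_fun (f := t.redAct s hs M.obj f ∘ₗ t.redProj s hs M.obj y)
      (g := t.redProj s hs M.obj (f * y * (f : H ⧸ F)⁻¹) ∘ₗ t.redAct s hs M.obj f)
      (t.redV_ext s hs fun g v hv => ?_) w
    simp only [LinearMap.comp_apply, t.redProj_redπ s hs hv, t.redAct_redπ s hs M.property,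
      t.redProj_redπ s hs (t.isDeg_act hv f)]
    have : (f : H ⧸ F) * y * (f : H ⧸ F)⁻¹ = (f * g * f⁻¹ : H) ↔ y = g := by
      rw [QuotientGroup.mk_mul, QuotientGroup.mk_mul, QuotientGroup.mk_inv]
      simp
    simp only [this]
    split_ifs
    · rw [t.redAct_redπ s hs M.property]
    · rw [map_zero]
  act_mul x y z w := by
    classical
    obtain ⟨f, rfl⟩ := QuotientGroup.mk_surjective x
    obtain ⟨g, rfl⟩ := QuotientGroup.mk_surjective y
    refine LinearMap.congr_fun (f := t.redAct s hs M.obj (f * g : H) ∘ₗ t.redProj s hs M.obj z)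
      (g := (ω.two f g z : k) • (t.redAct s hs M.obj f ∘ₗ t.redAct s hs M.obj g ∘ₗ
        t.redProj s hs M.obj z)) (t.redV_ext s hs fun h v hv => ?_) w
    simp only [LinearMap.comp_apply, LinearMap.smul_apply, t.redProj_redπ s hs hv]
    split_ifs with e
    · rw [e, t.redAct_redπ s hs M.property, t.redAct_redπ s hs M.property,
        t.redAct_redπ s hs M.property, t.act_mul hv, map_smul]
    · simp

theorem isDeg_redπ {M : LocMod D.obj} {g : H} {v : M.obj.X.V} (hv : M.obj.X.IsDeg g v) :
    (t.redObj s hs M).IsDeg (g : H ⧸ F) (t.redπ s hs M.obj v) := by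
  classical
  exact (t.redProj_redπ s hs hv _).trans (if_pos rfl)

theorem act_redπ {M : LocMod D.obj} {g : H} {v : M.obj.X.V} (hv : M.obj.X.IsDeg g v) (f : H) :
    (t.redObj s hs M).act (f : H ⧸ F) (t.redπ s hs M.obj v) =
      (t.corr f g : k) • t.redπ s hs M.obj (M.obj.X.act f v) := by
  refine (t.redAct_redπ s hs M.property f v).trans ?_
  rw [t.act_apply hv, map_smul]

/-- On a single degree the move to the representative is one fixed invertible shift. Hence M_g
embeds into the quotient, which gives faithfulness and lets equations between homogeneous vectors be
checked after projection. -/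
theorem redπ_injOn {v w : M.X.V} (hv : M.X.IsDeg g v) (hw : M.X.IsDeg g w)
    (h : t.redπ s hs M v = t.redπ s hs M w) : v = w := by
  have h' : t.toRep s hs M v = t.toRep s hs M w := congrArg Subtype.val h
  rw [t.toRep_apply s hs hv, t.toRep_apply s hs hw] at h'
  have h'' := congrArg (t.shift M (res s hs g)) h'
  rw [← LinearMap.comp_apply, ← LinearMap.comp_apply, shift_mul, inv_mul_cancel, shift_one] at h''
  exact h''

/-- The lift of `redπ` to degree `g`. -/
noncomputable def redLift (M : RMod D.obj) (g : H) : t.redV s hs M →ₗ[k] M.X.V :=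
  t.shift M (res s hs g) ∘ₗ t.redι s hs M

theorem redπ_redLift (g : H) (w : t.redV s hs M) :
    t.redπ s hs M (t.redLift s hs M g w) = w := by
  rw [redLift, LinearMap.comp_apply, redπ_shift, redπ_redι]

theorem isDeg_redLift {M : LocMod D.obj} {g : H} {w : t.redV s hs M.obj}
    (hw : (t.redObj s hs M).IsDeg (g : H ⧸ F) w) :
    M.obj.X.IsDeg g (t.redLift s hs M.obj g w) := by
  have h : M.obj.X.IsDeg (rep s g) (t.redι s hs M.obj w) := by
    -- `redProj` is defined through the component of degree s(x), so a vector fixed by it has its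
    -- lift in that degree, and not only in the right coset.
    have h₁ : t.redι s hs M.obj w =
        t.toRep s hs M.obj (M.obj.X.proj (rep s g) (t.redι s hs M.obj w)) :=
      (congrArg (t.redι s hs M.obj) hw).symm
    rw [h₁]
    have := t.isDeg_toRep s hs (M.obj.X.isDeg_proj (rep s g) (t.redι s hs M.obj w))
    rwa [show rep s (rep s g) = rep s g from rep_section s hs _] at this
  have := t.isDeg_shift h (res s hs g)
  rwa [rep_mul_res] at this

/-- The map between reduced objects induced by a morphism of local modules. -/
noncomputable def redMapLin {M N : LocMod D.obj} (φ : M ⟶ N) :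
    t.redV s hs M.obj →ₗ[k] t.redV s hs N.obj :=
  t.redDesc s hs (t.redπ s hs N.obj ∘ₗ φ.hom.hom.lin)

theorem redMapLin_redπ {M N : LocMod D.obj} (φ : M ⟶ N) (v : M.obj.X.V) :
    t.redMapLin s hs φ (t.redπ s hs M.obj v) = t.redπ s hs N.obj (φ.hom.hom.lin v) := by
  rw [redMapLin, redDesc_redπ]
  · rfl
  · intro f
    ext v
    simp [t.hom_shift φ.hom f v, redπ_shift]

/-- A linear map out of a reduced object is a morphism if it is homogeneous and equivariant on the
images of the homogeneous elements. -/
noncomputable def redMk {M : LocMod D.obj} {X : ZObj ω} (φ : t.redV s hs M.obj →ₗ[k] X.V)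
    (hp : ∀ g v, M.obj.X.IsDeg g v → X.IsDeg (g : H ⧸ F) (φ (t.redπ s hs M.obj v)))
    (ha : ∀ (f : H) g v, M.obj.X.IsDeg g v → φ ((t.redObj s hs M).act f (t.redπ s hs M.obj v)) =
      X.act f (φ (t.redπ s hs M.obj v))) : t.redObj s hs M ⟶ X where
  lin := φ
  proj_comm x w := by
    classical
    refine LinearMap.congr_fun (f := φ ∘ₗ t.redProj s hs M.obj x)
      (g := X.proj x ∘ₗ φ) (t.redV_ext s hs fun g v hv => ?_) w
    rw [LinearMap.comp_apply, LinearMap.comp_apply, t.redProj_redπ s hs hv, (hp g v hv).proj,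
      apply_ite φ, map_zero]
  act_comm x w := by
    obtain ⟨f, rfl⟩ := QuotientGroup.mk_surjective x
    exact LinearMap.congr_fun (f := φ ∘ₗ t.redAct s hs M.obj f)
      (g := X.act f ∘ₗ φ) (t.redV_ext s hs fun g v hv => ha f g v hv) w

/-- The functor from local modules to `Z(H ⧸ F, ω)`. -/
noncomputable def redFunctor : LocMod D.obj ⥤ ZObj ω where
  obj := t.redObj s hs
  map {M N} φ := t.redMk s hs (X := t.redObj s hs N) (t.redMapLin s hs φ)
    (fun g v hv => by rw [redMapLin_redπ]; exact t.isDeg_redπ s hs (hv.map φ.hom.hom))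
    (fun f g v hv => by
      rw [t.act_redπ s hs hv, map_smul, redMapLin_redπ, redMapLin_redπ,
        t.act_redπ s hs (hv.map φ.hom.hom), φ.hom.hom.act_comm])
  map_id M := ZObj.hom_ext <| t.redV_ext s hs fun g v hv => t.redMapLin_redπ s hs (𝟙 M) v
  map_comp φ ψ := ZObj.hom_ext <| t.redV_ext s hs fun g v hv => by
    change t.redMapLin s hs (φ ≫ ψ) _ = t.redMapLin s hs ψ (t.redMapLin s hs φ _)
    rw [redMapLin_redπ, redMapLin_redπ, redMapLin_redπ]
    rfl

theorem redFunctor_map_redπ {M N : LocMod D.obj} (φ : M ⟶ N) (v : M.obj.X.V) :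
    ((t.redFunctor s hs).map φ).lin (t.redπ s hs M.obj v) = t.redπ s hs N.obj (φ.hom.hom.lin v) :=
  t.redMapLin_redπ s hs φ v

instance : (t.redFunctor s hs).Faithful where
  map_injective {M N} φ ψ h := LocMod.locHom_ext <| ZObj.hom_ext <| ZObj.lin_ext fun g v hv =>
    t.redπ_injOn s hs (hv.map φ.hom.hom) (hv.map ψ.hom.hom) <| by
      rw [← redFunctor_map_redπ, ← redFunctor_map_redπ, h]

/-- The map between local modules induced by a map between the reduced objects. -/
noncomputable def redPreimage (M : RMod D.obj) {N : RMod D.obj}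
    (φ : t.redV s hs M →ₗ[k] t.redV s hs N) : M.X.V →ₗ[k] N.X.V :=
  ∑ g, t.redLift s hs N g ∘ₗ φ ∘ₗ t.redπ s hs M ∘ₗ M.X.proj g

theorem redPreimage_apply {φ : t.redV s hs M →ₗ[k] t.redV s hs N} (hv : M.X.IsDeg g v) :
    t.redPreimage s hs M φ v = t.redLift s hs N g (φ (t.redπ s hs M v)) := by
  simp only [redPreimage, LinearMap.sum_apply, LinearMap.comp_apply]
  exact hv.sum (fun g' v' => t.redLift s hs N g' (φ (t.redπ s hs M v'))) (by simp)

theorem redπ_redPreimage {φ : t.redV s hs M →ₗ[k] t.redV s hs N} (hv : M.X.IsDeg g v) :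
    t.redπ s hs N (t.redPreimage s hs M φ v) = φ (t.redπ s hs M v) := by
  rw [t.redPreimage_apply s hs hv, redπ_redLift]

theorem isDeg_redPreimage {M N : LocMod D.obj} (φ : t.redObj s hs M ⟶ t.redObj s hs N) {g : H}
    {v : M.obj.X.V} (hv : M.obj.X.IsDeg g v) :
    N.obj.X.IsDeg g (t.redPreimage s hs M.obj φ.lin v) := by
  rw [t.redPreimage_apply s hs hv]
  exact t.isDeg_redLift s hs ((t.isDeg_redπ s hs hv).map φ)

/-- The morphism of local modules induced by a morphism between the reduced objects. -/
noncomputable def redPreimageHom {M N : LocMod D.obj} (φ : t.redObj s hs M ⟶ t.redObj s hs N) :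
    M ⟶ N :=
  ObjectProperty.homMk
    { hom := ZObj.mkHom (t.redPreimage s hs M.obj φ.lin)
        (fun g v hv => t.isDeg_redPreimage s hs φ hv) fun f g v hv => by
          have hd := t.isDeg_redPreimage s hs φ hv
          -- Both sides have degree fgf⁻¹, where `redπ` is injective; after projection the claim is
          -- the equivariance of `φ`, with a common factor `corr f g`.
          refine t.redπ_injOn s hs (t.isDeg_redPreimage s hs φ (hv.act f)) (hd.act f) ?_
          have h₁ := φ.act_comm (f : H ⧸ F) (t.redπ s hs M.obj v)
          have h₂ := t.act_redπ s hs hd f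
          have h₃ := t.redπ_redPreimage s hs (φ := φ.lin) hv
          rw [h₃] at h₂
          rw [t.act_redπ s hs hv, map_smul] at h₁
          rw [t.redπ_redPreimage s hs (hv.act f)]
          exact smul_right_injective _ (Units.ne_zero (t.corr f g)) (h₁.trans h₂)
      act_hom := by
        refine ZObj.hom_ext (TensorProduct.ext (ZObj.lin_ext fun g v hv => e_ext fun f => ?_))
        change t.redPreimage s hs M.obj φ.lin (mulE M.obj f v) =
          mulE N.obj f (t.redPreimage s hs M.obj φ.lin v)
        have hd := t.isDeg_redPreimage s hs φ hv
        refine t.redπ_injOn s hs (t.isDeg_redPreimage s hs φ (isDeg_mulE hv f))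
          (isDeg_mulE hd f) ?_
        rw [t.redπ_redPreimage s hs (isDeg_mulE hv f), t.mulE_eq_shift hv,
          t.mulE_eq_shift hd, map_smul, map_smul, map_smul, redπ_shift, redπ_shift,
          t.redπ_redPreimage s hs hv] }

instance : (t.redFunctor s hs).Full where
  map_surjective φ := ⟨t.redPreimageHom s hs φ, ZObj.hom_ext <| t.redV_ext s hs fun _ _ hv =>
    (t.redFunctor_map_redπ s hs _ _).trans (t.redπ_redPreimage s hs hv)⟩

end Reduction

end Trivialization
end AlgData

namespace AlgData

theorem tmul_e_ext {k H : Type u} [Field k] [Group H] [Fintype H] {α : Cocycle3 k H}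
    {F : Subgroup H} [F.Normal] {X : ZObj α} {W : Type*} [AddCommGroup W] [Module k W]
    {φ ψ : X.V ⊗[k] (F →₀ k) →ₗ[k] W}
    (h : ∀ g v, X.IsDeg g v → ∀ f : F, φ (v ⊗ₜ e k f) = ψ (v ⊗ₜ e k f)) : φ = ψ :=
  TensorProduct.ext (ZObj.lin_ext fun g v hv => e_ext fun f => h g v hv f)

namespace Trivialization

/-! ### Induction from `H ⧸ F` and essential surjectivity -/

section Induction

variable {k H : Type u} [Field k] [Group H] [Fintype H] {α : Cocycle3 k H} {F : Subgroup H}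
  [F.Normal] [Fintype (H ⧸ F)] {D : AlgData α F} {ω : Cocycle3 k (H ⧸ F)}
  (t : D.Trivialization ω)

/-- The space of sections of the pullback along `H → H ⧸ F` of an object of `Z(H ⧸ F, ω)`. -/
def indV (X : ZObj ω) : Submodule k (H → X.V) where
  carrier := {v | ∀ h : H, X.proj h (v h) = v h}
  add_mem' hv hw h := by simp only [Pi.add_apply, map_add, hv h, hw h]
  zero_mem' h := by simp
  smul_mem' c v hv h := by simp only [Pi.smul_apply, map_smul, hv h]

variable (X : ZObj ω)

theorem indV_isDeg (v : indV X) (h : H) : X.IsDeg (h : H ⧸ F) (v.1 h) := v.2 h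

open Classical in
/-- The projections of the induced object. -/
noncomputable def indProj (g : H) : indV X →ₗ[k] indV X where
  toFun v := ⟨fun h => if h = g then v.1 h else 0, fun h => by
    dsimp only
    split_ifs
    · exact v.2 h
    · simp⟩
  map_add' v w := Subtype.ext <| funext fun h => by
    by_cases e : h = g <;> simp [e]
  map_smul' c v := Subtype.ext <| funext fun h => by
    by_cases e : h = g <;> simp [e]

theorem indProj_apply [DecidableEq H] (g : H) (v : indV X) (h : H) :
    (indProj X g v).1 h = if h = g then v.1 h else 0 := by
  refine (show (indProj X g v).1 h =
    @ite _ (h = g) (Classical.propDecidable _) (v.1 h) 0 from rfl).trans ?_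
  congr

/-- The action on the induced object. -/
def indAct (f : H) : indV X →ₗ[k] indV X where
  toFun v := ⟨fun h => ((t.corr f (f⁻¹ * h * f))⁻¹ : kˣ).val • X.act f (v.1 (f⁻¹ * h * f)),
    fun h => by
      have := ((indV_isDeg X v (f⁻¹ * h * f)).act (f : H ⧸ F)).smul
        ((t.corr f (f⁻¹ * h * f))⁻¹ : kˣ).val
      rwa [show (f : H ⧸ F) * (f⁻¹ * h * f : H) * (f : H ⧸ F)⁻¹ = h by
        rw [QuotientGroup.mk_mul, QuotientGroup.mk_mul, QuotientGroup.mk_inv]; group] at this⟩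
  map_add' v w := Subtype.ext <| funext fun h => by simp
  map_smul' c v := Subtype.ext <| funext fun h => by
    simp [smul_comm c]

theorem indAct_apply (f : H) (v : indV X) (h : H) : (t.indAct X f v).1 h =
    ((t.corr f (f⁻¹ * h * f))⁻¹ : kˣ).val • X.act f (v.1 (f⁻¹ * h * f)) := rfl

/-- The induced object. -/
@[reducible] noncomputable def indObj : ZObj α where
  V := indV X
  proj := indProj X
  proj_self g v := Subtype.ext <| funext fun h => by
    classical
    rw [indProj_apply, indProj_apply]
    split_ifs <;> rfl
  proj_ne g g' hn v := Subtype.ext <| funext fun h => by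
    classical
    rw [indProj_apply, indProj_apply]
    split_ifs with h₁ h₂
    · exact absurd (h₁.symm.trans h₂) hn
    · rfl
    · rfl
  sum_proj v := Subtype.ext <| funext fun h => by
    classical
    rw [AddSubmonoidClass.coe_finsetSum, Finset.sum_apply]
    simp [indProj_apply]
  act := t.indAct X
  act_one v := Subtype.ext <| funext fun h => by
    rw [indAct_apply, t.corr_one_left, QuotientGroup.mk_one, X.act_one]
    simp
  act_proj f g v := Subtype.ext <| funext fun h => by
    classical
    rw [indAct_apply, indProj_apply, indProj_apply, indAct_apply]
    have : f⁻¹ * h * f = g ↔ h = f * g * f⁻¹ :=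
      ⟨fun e => by rw [← e]; group, fun e => by rw [e]; group⟩
    simp only [this]
    split_ifs <;> simp
  act_mul f g h v := Subtype.ext <| funext fun l => by
    classical
    change _ = (α.two f g h : k) • (t.indAct X f (t.indAct X g (indProj X h v))).1 l
    rw [indAct_apply, indAct_apply, indAct_apply, indProj_apply, indProj_apply]
    have e₁ : (f * g)⁻¹ * l * (f * g) = g⁻¹ * (f⁻¹ * l * f) * g := by group
    rw [e₁]
    split_ifs with e
    · have h₁ := indV_isDeg X v (g⁻¹ * (f⁻¹ * l * f) * g)
      rw [show ((f * g : H) : H ⧸ F) = f * g from rfl, h₁.act_mul, map_smul, smul_smul, smul_smul, smul_smul, e]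
      simp only [← Units.val_mul]
      congr 2
      have h₂ := congrArg Additive.ofMul (t.corr_two f g h)
      rw [show g * h * g⁻¹ = f⁻¹ * l * f by rw [← e]; group] at h₂
      apply Additive.ofMul.injective
      simp only [ofMul_mul, ofMul_inv] at *
      linear_combination (norm := abel) -h₂
    · simp

variable {X}

theorem indObj_isDeg [DecidableEq H] {g : H} {v : (t.indObj X).V} (hv : (t.indObj X).IsDeg g v)
    (h : H) : v.1 h = if h = g then v.1 g else 0 := by
  have e := congrFun (congrArg Subtype.val hv) h
  change (indProj X g v).1 h = v.1 h at e
  rw [indProj_apply] at e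
  split_ifs at e with h'
  · rw [h', if_pos rfl]
  · rw [← e, if_neg h']

theorem indObj_isDeg_of {g : H} {v : (t.indObj X).V} (hv : ∀ h, h ≠ g → v.1 h = 0) :
    (t.indObj X).IsDeg g v := Subtype.ext <| funext fun h => by
  classical
  change (indProj X g v).1 h = v.1 h
  rw [indProj_apply]
  split_ifs with h'
  · rfl
  · rw [hv h h']

theorem indObj_ext {g : H} {v w : (t.indObj X).V} (hv : (t.indObj X).IsDeg g v)
    (hw : (t.indObj X).IsDeg g w) (h : v.1 g = w.1 g) : v = w :=
  Subtype.ext <| funext fun h' => by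
    classical
    rw [t.indObj_isDeg hv, t.indObj_isDeg hw, h]

variable (X)

/-- The action of `e_f` on the induced object. -/
def indMul (f : F) : indV X →ₗ[k] indV X where
  toFun v := ⟨fun h => (t.ψ (h * (f : H)⁻¹) f : k) • v.1 (h * (f : H)⁻¹), fun h => by
    have := (indV_isDeg X v (h * (f : H)⁻¹)).smul (t.ψ (h * (f : H)⁻¹) f : k)
    rwa [show ((h * (f : H)⁻¹ : H) : H ⧸ F) = h by
      rw [QuotientGroup.mk_mul, QuotientGroup.mk_inv, (QuotientGroup.eq_one_iff (f : H)).2 f.2]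
      simp] at this⟩
  map_add' v w := Subtype.ext <| funext fun h => by simp
  map_smul' c v := Subtype.ext <| funext fun h => by simp [smul_comm c]

theorem indMul_apply (f : F) (v : indV X) (h : H) :
    (t.indMul X f v).1 h = (t.ψ (h * (f : H)⁻¹) f : k) • v.1 (h * (f : H)⁻¹) := rfl

variable {X}

theorem isDeg_indMul {g : H} {v : (t.indObj X).V} (hv : (t.indObj X).IsDeg g v) (f : F) :
    (t.indObj X).IsDeg (g * f) (t.indMul X f v) := t.indObj_isDeg_of fun h hn => by
  classical
  rw [indMul_apply, t.indObj_isDeg hv, if_neg, smul_zero]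
  exact fun e => hn (by rw [← e]; group)

variable (X)

/-- The right action of the algebra on the induced object. -/
noncomputable def indMulLin : indV X ⊗[k] (F →₀ k) →ₗ[k] indV X :=
  TensorProduct.lift (eLin fun f => t.indMul X f).flip

theorem indMulLin_e (v : indV X) (f : F) :
    t.indMulLin X (v ⊗ₜ e k f) = t.indMul X f v := by
  simp [indMulLin]

/-- The right action of the algebra as a morphism. -/
noncomputable def indMulHom : t.indObj X ⊗ D.obj ⟶ t.indObj X where
  lin := t.indMulLin X
  proj_comm g w := by
    classical
    refine LinearMap.congr_fun (f := t.indMulLin X ∘ₗ ZObj.tProj (t.indObj X) D.obj g)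
      (g := (t.indObj X).proj g ∘ₗ t.indMulLin X)
      (tmul_e_ext fun h v hv f => ?_) w
    change t.indMulLin X (ZObj.tProj (t.indObj X) D.obj g (v ⊗ₜ[k] e k f)) =
      (t.indObj X).proj g (t.indMulLin X (v ⊗ₜ[k] e k f))
    rw [ZObj.tProj_tmul hv (D.isDeg_e f), indMulLin_e, (t.isDeg_indMul hv f).proj,
      apply_ite (t.indMulLin X), indMulLin_e, map_zero]
  act_comm h w := by
    refine LinearMap.congr_fun (f := t.indMulLin X ∘ₗ ZObj.tAct (t.indObj X) D.obj h)
      (g := (t.indObj X).act h ∘ₗ t.indMulLin X)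
      (tmul_e_ext fun g v hv f => ?_) w
    change t.indMulLin X (ZObj.tAct (t.indObj X) D.obj h (v ⊗ₜ[k] e k f)) =
      t.indAct X h (t.indMulLin X (v ⊗ₜ[k] e k f))
    rw [ZObj.tAct_tmul hv (D.isDeg_e f), D.act_e, indMulLin_e, TensorProduct.tmul_smul, smul_smul,
      map_smul, indMulLin_e]
    have h₁ := (t.isDeg_indMul hv f).act h
    have h₂ := (t.isDeg_indMul (hv.act h) (MulAut.conjNormal h f)).smul
      ((α.one h g f : k) * (D.ε h f : k))
    rw [show h * g * h⁻¹ * (MulAut.conjNormal h f : F) = h * (g * f) * h⁻¹ by simp] at h₂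
    refine t.indObj_ext h₂ h₁ ?_
    change ((α.one h g f : k) * (D.ε h f : k)) • (t.indMul X _ (t.indAct X h v)).1 _ =
      (t.indAct X h (t.indMul X f v)).1 _
    rw [indAct_apply, indMul_apply, indMul_apply, indAct_apply,
      show h * (g * (f : H)) * h⁻¹ * ((MulAut.conjNormal h f : F) : H)⁻¹ = h * g * h⁻¹ by
        simp [mul_assoc],
      show h⁻¹ * (h * (g * (f : H)) * h⁻¹) * h = g * f by group,
      show h⁻¹ * (h * g * h⁻¹) * h = g by group, mul_inv_cancel_right, map_smul]
    simp only [smul_smul, ← Units.val_mul]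
    congr 2
    have h₃ := congrArg Additive.ofMul (t.corr_mul h g f)
    apply Additive.ofMul.injective
    simp only [ofMul_mul, ofMul_inv, MulAut.conjNormal_apply] at *
    linear_combination (norm := abel) -h₃

/-- The induced right module. -/
@[reducible] noncomputable def indMod : RMod D.obj where
  X := t.indObj X
  act := t.indMulHom X
  act_one := ZObj.hom_ext <| TensorProduct.ext <| LinearMap.ext fun v => LinearMap.ext_ring <| by
    change t.indMulLin X (v ⊗ₜ[k] ((1 : k) • e k (1 : F))) = (1 : k) • v
    rw [one_smul, one_smul, indMulLin_e]
    exact Subtype.ext <| funext fun h => by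
      rw [indMul_apply]; simp [t.ψ_one_right]
  act_mul := ZObj.hom_ext <| TensorProduct.ext <| ZObj.lin_ext fun g v hv => e_ext₂ fun f l => by
    change t.indMulLin X (v ⊗ₜ[k] D.mulLin (e k f ⊗ₜ e k l)) =
      t.indMulLin X (TensorProduct.map (t.indMulLin X) LinearMap.id
        (ZObj.assocInv (t.indObj X) D.obj D.obj (v ⊗ₜ[k] (e k f ⊗ₜ[k] e k l))))
    rw [D.mulLin_e, ZObj.assocInv_tmul hv (D.isDeg_e f) (D.isDeg_e l), TensorProduct.tmul_smul,
      map_smul, map_smul, map_smul, TensorProduct.map_tmul, indMulLin_e, indMulLin_e,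
      LinearMap.id_apply, indMulLin_e]
    have h₁ := (t.isDeg_indMul hv (f * l)).smul (D.γ f l : k)
    have h₂ := (t.isDeg_indMul (t.isDeg_indMul hv f) l).smul (α g f l : k)
    rw [Subgroup.coe_mul, ← mul_assoc] at h₁
    refine t.indObj_ext h₁ h₂ ?_
    change (D.γ f l : k) • (t.indMul X _ v).1 _ =
      (α g f l : k) • (t.indMul X l (t.indMul X f v)).1 _
    rw [indMul_apply, indMul_apply, indMul_apply, Subgroup.coe_mul, mul_inv_rev,
      mul_inv_cancel_right, mul_inv_cancel_right,
      show g * (f : H) * l * ((l : H)⁻¹ * (f : H)⁻¹) = g by group]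
    simp only [smul_smul, ← Units.val_mul]
    congr 2
    have h₃ := congrArg Additive.ofMul (t.ψ_mul g f l)
    rw [t.ψ_coe] at h₃
    apply Additive.ofMul.injective
    simp only [ofMul_mul] at *
    linear_combination (norm := abel) h₃

/-- An element of F acts on X through the identity of H/F, so both sides are multiples of the same
vector. The scalars agree by `ψ_ε`. -/
theorem isLocal_indMod : RMod.IsLocal D.obj (t.indMod X) :=
  ZObj.hom_ext <| tmul_e_ext fun g v hv f => by
    change t.indMulLin X (ZObj.braidHom D.obj (t.indObj X)
      (ZObj.braidHom (t.indObj X) D.obj (v ⊗ₜ[k] e k f))) = t.indMulLin X (v ⊗ₜ[k] e k f)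
    rw [ZObj.braidHom_tmul hv, D.act_e, ← TensorProduct.smul_tmul', map_smul,
      ZObj.braidHom_tmul (D.isDeg_e _), map_smul, indMulLin_e, indMulLin_e]
    have h₁ := t.isDeg_indMul hv f
    have h₂ := (t.isDeg_indMul (hv.act (MulAut.conjNormal g f : F))
      (MulAut.conjNormal g f)).smul (D.ε g f : k)
    rw [inv_mul_cancel_right, show ((MulAut.conjNormal g f : F) : H) * g = g * f by simp] at h₂
    refine t.indObj_ext h₂ h₁ ?_
    change (D.ε g f : k) • (t.indMul X _ (t.indAct X (MulAut.conjNormal g f : F) v)).1 _ =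
      (t.indMul X f v).1 _
    rw [indMul_apply, indMul_apply, indAct_apply, mul_inv_cancel_right,
      (QuotientGroup.eq_one_iff ((MulAut.conjNormal g f : F) : H)).2 (MulAut.conjNormal g f : F).2,
      X.act_one]
    have e : ((MulAut.conjNormal g f : F) : H)⁻¹ * (g * (f : H) * ((MulAut.conjNormal g f : F) : H)⁻¹) *
      (MulAut.conjNormal g f : F) = g := by simp [mul_assoc]
    rw [e]
    simp only [smul_smul, ← Units.val_mul]
    congr 2
    have h₃ := congrArg Additive.ofMul (t.ψ_ε g f)
    have e' : (MulAut.conjNormal g f : F) * g * ((MulAut.conjNormal g f : F) : H)⁻¹ =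
      g * (f : H) * ((MulAut.conjNormal g f : F) : H)⁻¹ := by simp
    rw [corr, e']
    rw [← MulAut.conjNormal_apply] at h₃
    apply Additive.ofMul.injective
    simp only [ofMul_mul, ofMul_inv] at *
    linear_combination (norm := abel) -h₃

/-- The induced local module. -/
@[reducible] noncomputable def indLoc : LocMod D.obj := ⟨t.indMod X, t.isLocal_indMod X⟩

/-- The sum of the values of a section. -/
def indSum : indV X →ₗ[k] X.V where
  toFun v := ∑ h, v.1 h
  map_add' v w := Finset.sum_add_distrib
  map_smul' c v := by simp [Finset.smul_sum]

variable {X}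

theorem indSum_apply {g : H} {v : (t.indObj X).V} (hv : (t.indObj X).IsDeg g v) :
    indSum X v = v.1 g := by
  classical
  change ∑ h, v.1 h = v.1 g
  rw [Finset.sum_congr rfl fun h _ => t.indObj_isDeg hv h]
  simp

/-- The factor ψ built into `indMul` is the one divided out in `shift`, so that shifts are plain
translations of sections. -/
theorem shift_indMod {g : H} {v : (t.indObj X).V} (hv : (t.indObj X).IsDeg g v) (f : F) :
    (t.shift (t.indMod X) f v).1 (g * f) = v.1 g := by
  have h : mulE (t.indMod X) f v = t.indMul X f v := t.indMulLin_e X v f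
  rw [t.shift_apply (M := t.indMod X) hv, h]
  change ((t.ψ g f)⁻¹ : kˣ).val • (t.indMul X f v).1 (g * f) = _
  rw [indMul_apply, mul_inv_cancel_right, smul_smul]
  simp

/-- Translation moves the support of a homogeneous section but keeps its value, so the sum of the
values descends to the quotient. -/
theorem indSum_shift (f : F) : indSum X ∘ₗ t.shift (t.indMod X) f = indSum X :=
  ZObj.lin_ext fun g v hv => by
    rw [LinearMap.comp_apply, t.indSum_apply (t.isDeg_shift (M := t.indMod X) hv f),
      shift_indMod t hv, t.indSum_apply hv]

open Classical in
/-- The section with one value. -/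
noncomputable def indSingle (X : ZObj ω) (g : H) : X.V →ₗ[k] indV X where
  toFun x := ⟨fun h => if h = g then X.proj h x else 0, fun h => by
    dsimp only
    split_ifs
    · exact X.proj_self h x
    · simp⟩
  map_add' v w := Subtype.ext <| funext fun h => by
    by_cases e : h = g <;> simp [e]
  map_smul' c v := Subtype.ext <| funext fun h => by
    by_cases e : h = g <;> simp [e]

theorem indSingle_self (g : H) (x : X.V) : (indSingle X g x).1 g = X.proj g x := if_pos rfl

theorem isDeg_indSingle (g : H) (x : X.V) : (t.indObj X).IsDeg g (indSingle X g x) :=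
  t.indObj_isDeg_of fun _ hn => if_neg hn

variable (s : H ⧸ F → H) (hs : ∀ x, (s x : H ⧸ F) = x) (X)

/-- The object given by the induced module is the original one. -/
noncomputable def redIndIso : t.redObj s hs (t.indLoc X) ≅ X :=
  have hd : ∀ v, t.redDesc s hs (M := t.indMod X) (indSum X) (t.redπ s hs (t.indMod X) v) =
      indSum X v := t.redDesc_redπ s hs t.indSum_shift
  ZObj.mkIso
    (t.redMk s hs (t.redDesc s hs (M := t.indMod X) (indSum X))
      (fun g v hv => by
        refine (congrArg _ ((hd v).trans (t.indSum_apply hv))).trans ?_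
        exact (indV_isDeg X v g).trans ((hd v).trans (t.indSum_apply hv)).symm)
      (fun f g v hv => by
        have h₁ := t.act_redπ s hs (M := t.indLoc X) hv f
        rw [h₁, map_smul]
        refine (congrArg _ ((hd _).trans (t.indSum_apply (hv.act f)))).trans ?_
        refine Eq.trans ?_ (congrArg _ ((hd v).trans (t.indSum_apply hv)).symm)
        change (t.corr f g : k) • (t.indAct X f v).1 (f * g * f⁻¹) = _
        rw [indAct_apply, show f⁻¹ * (f * g * f⁻¹) * f = g by group, smul_smul, ← Units.val_mul,
          mul_inv_cancel, Units.val_one, one_smul]))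
    -- The inverse places the component of each coset at its representative.
    (∑ x, t.redπ s hs (t.indMod X) ∘ₗ indSingle X (s x))
    (t.redV_ext s hs fun g v hv => by
      classical
      change (∑ x, t.redπ s hs (t.indMod X) ∘ₗ indSingle X (s x))
        (t.redDesc s hs (M := t.indMod X) (indSum X) (t.redπ s hs (t.indMod X) v)) =
        t.redπ s hs (t.indMod X) v
      rw [hd, t.indSum_apply hv, LinearMap.sum_apply, Finset.sum_eq_single (g : H ⧸ F)]
      -- Replacing v by its image under `toRep` gives both sections the degree of the
      -- representative, where it suffices to compare one value.
      · rw [LinearMap.comp_apply, ← t.redπ_toRep s hs v]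
        congr 1
        refine t.indObj_ext (t.isDeg_indSingle _ _) (t.isDeg_toRep s hs hv) ?_
        rw [indSingle_self, hs, t.toRep_apply s hs hv]
        have e : s g = g * ((res s hs g)⁻¹ : F) := by
          rw [Subgroup.coe_inv, eq_mul_inv_iff_mul_eq]
          exact rep_mul_res s hs g
        rw [e, shift_indMod t hv]
        exact indV_isDeg X v g
      · intro x _ hx
        have : indSingle X (s x) (v.1 g) = 0 :=
          t.indObj_ext (t.isDeg_indSingle _ _) (map_zero _) <| by
            rw [indSingle_self, hs, (indV_isDeg X v g).proj_ne hx]; rfl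
        rw [LinearMap.comp_apply, this, map_zero]
      · simp)
    (LinearMap.ext fun x => by
      change t.redDesc s hs (M := t.indMod X) (indSum X)
        ((∑ x, t.redπ s hs (t.indMod X) ∘ₗ indSingle X (s x)) x) = x
      rw [LinearMap.sum_apply, map_sum]
      conv_rhs => rw [← X.sum_proj x]
      refine Finset.sum_congr rfl fun y _ => ?_
      rw [LinearMap.comp_apply, hd, t.indSum_apply (t.isDeg_indSingle _ _), indSingle_self, hs])

instance : (t.redFunctor s hs).EssSurj where
  mem_essImage X := ⟨t.indLoc X, ⟨t.redIndIso X s hs⟩⟩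

instance : (t.redFunctor s hs).IsEquivalence where

end Induction

end Trivialization
end AlgData

/-! ### Coequalisers as quotient spaces -/

namespace ZObj

open Limits

variable {k G : Type u} [Field k] [Group G] [Fintype G] {α : Cocycle3 k G} {X Y : ZObj α}
  (φ ψ : X ⟶ Y)

/-- The relative tensor product is built on the abstract coequaliser. Comparison with the explicit
quotient `coeq` makes its elements accessible. -/
theorem coequalizer_π_surjective : Function.Surjective (coequalizer.π φ ψ).lin := by
  intro w
  let u : coequalizer φ ψ ⟶ coeq φ ψ := coequalizer.desc (coeqπ φ ψ) (coeq_condition φ ψ)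
  let v : coeq φ ψ ⟶ coequalizer φ ψ :=
    coeqDesc φ ψ (coequalizer.π φ ψ) (coequalizer.condition φ ψ)
  have h : u ≫ v = 𝟙 _ := coequalizer.hom_ext <| by
    rw [← Category.assoc, coequalizer.π_desc, Category.comp_id]
    exact hom_ext rfl
  obtain ⟨y, hy⟩ := Submodule.mkQ_surjective _ (u.lin w)
  refine ⟨y, ?_⟩
  have h' : v.lin (u.lin w) = w := LinearMap.congr_fun (congrArg Hom.lin h) w
  rw [← hy] at h'
  exact h'

/-- Linear maps descend to the coequaliser. -/
theorem coequalizer_exists_desc {W : Type*} [AddCommGroup W] [Module k W] {χ : Y.V →ₗ[k] W}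
    (h : χ ∘ₗ φ.lin = χ ∘ₗ ψ.lin) :
    ∃ χ' : (coequalizer φ ψ).V →ₗ[k] W, χ' ∘ₗ (coequalizer.π φ ψ).lin = χ := by
  let u : coequalizer φ ψ ⟶ coeq φ ψ := coequalizer.desc (coeqπ φ ψ) (coeq_condition φ ψ)
  have hu : coequalizer.π φ ψ ≫ u = coeqπ φ ψ := coequalizer.π_desc _ _
  let l : (coeq φ ψ).V →ₗ[k] W := Submodule.liftQ (LinearMap.range (φ.lin - ψ.lin)) χ <| by
    rintro _ ⟨v, rfl⟩
    have := LinearMap.congr_fun h v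
    simpa [sub_eq_zero] using this
  refine ⟨l ∘ₗ u.lin, LinearMap.ext fun y => ?_⟩
  have h' : u.lin ((coequalizer.π φ ψ).lin y) = (coeqπ φ ψ).lin y :=
    LinearMap.congr_fun (congrArg Hom.lin hu) y
  change l (u.lin ((coequalizer.π φ ψ).lin y)) = χ y
  rw [h']
  exact Submodule.liftQ_apply _ _ _

end ZObj

namespace AlgData

/-! ### The relative tensor product in terms of elements -/

section LocTensor

variable {k H : Type u} [Field k] [Group H] [Fintype H] {α : Cocycle3 k H} {F : Subgroup H}
  [F.Normal] {D : AlgData α F}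

/-- The projection from the tensor product to the relative tensor product, as a linear map. -/
noncomputable def locT (M N : LocMod D.obj) :
    M.obj.X.V ⊗[k] N.obj.X.V →ₗ[k] (M ⊗ N).obj.X.V := (LocMod.locπ M N).lin

variable {M N : LocMod D.obj} {g h : H} {v : M.obj.X.V} {w : N.obj.X.V}

theorem locT_surjective (M N : LocMod D.obj) : Function.Surjective (locT M N) :=
  ZObj.coequalizer_π_surjective _ _

theorem isDeg_locT (hv : M.obj.X.IsDeg g v) (hw : N.obj.X.IsDeg h w) :
    (M ⊗ N).obj.X.IsDeg (g * h) (locT M N (v ⊗ₜ w)) :=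
  ZObj.IsDeg.map (X := M.obj.X ⊗ N.obj.X) (hv.tmul hw) (LocMod.locπ M N)

theorem act_locT (hv : M.obj.X.IsDeg g v) (hw : N.obj.X.IsDeg h w) (f : H) :
    (M ⊗ N).obj.X.act f (locT M N (v ⊗ₜ w)) =
      (α.one f g h : k) • locT M N (M.obj.X.act f v ⊗ₜ N.obj.X.act f w) := by
  have e := (LocMod.locπ M N).act_comm f (v ⊗ₜ w)
  change locT M N (ZObj.tAct M.obj.X N.obj.X f (v ⊗ₜ w)) = _ at e
  rw [ZObj.tAct_tmul hv hw, map_smul] at e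
  exact e.symm

theorem locT_ext {W : Type*} [AddCommGroup W] [Module k W] {φ ψ : (M ⊗ N).obj.X.V →ₗ[k] W}
    (e : ∀ g v, M.obj.X.IsDeg g v → ∀ h w, N.obj.X.IsDeg h w →
      φ (locT M N (v ⊗ₜ w)) = ψ (locT M N (v ⊗ₜ w))) : φ = ψ :=
  (LinearMap.cancel_right (locT_surjective M N)).1 (ZObj.tens_ext e)

theorem actLeft_lin (M : RMod D.obj) (f : F) (v : M.X.V) :
    M.actLeft.lin (e k f ⊗ₜ[k] v) = mulE M f (M.X.act f v) := by
  change M.act.lin (ZObj.braidHom D.obj M.X (e k f ⊗ₜ[k] v)) = _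
  rw [ZObj.braidHom_tmul (D.isDeg_e f)]
  rfl

theorem mulE_locT (hv : M.obj.X.IsDeg g v) (hw : N.obj.X.IsDeg h w) (f : F) :
    mulE (M ⊗ N).obj f (locT M N (v ⊗ₜ w)) =
      ((α g h f)⁻¹ : k) • locT M N (v ⊗ₜ mulE N.obj f w) := by
  have e := LinearMap.congr_fun (congrArg ZObj.Hom.lin (RMod.π_act M.obj N.obj))
    ((v ⊗ₜ[k] w) ⊗ₜ[k] AlgData.e k f)
  refine Eq.trans e ?_
  change locT M N (TensorProduct.map LinearMap.id N.obj.act.lin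
    (ZObj.assocHom M.obj.X N.obj.X D.obj ((v ⊗ₜ[k] w) ⊗ₜ[k] AlgData.e k f))) = _
  rw [ZObj.assocHom_tmul hv hw (D.isDeg_e f), map_smul, map_smul, TensorProduct.map_tmul]
  rfl

/-- The defining relation of the relative tensor product. The left action on N is the braiding
followed by the right action, whence the action of f on w. -/
theorem locT_balanced (hv : M.obj.X.IsDeg g v) (hw : N.obj.X.IsDeg h w) (f : F) :
    locT M N (mulE M.obj f v ⊗ₜ w) =
      ((α g f h)⁻¹ : k) • locT M N (v ⊗ₜ mulE N.obj f (N.obj.X.act f w)) := by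
  have e := LinearMap.congr_fun (congrArg ZObj.Hom.lin (RMod.π_cond M.obj N.obj))
    ((v ⊗ₜ[k] AlgData.e k f) ⊗ₜ[k] w)
  refine Eq.trans e ?_
  change locT M N (TensorProduct.map LinearMap.id N.obj.actLeft.lin
    (ZObj.assocHom M.obj.X D.obj N.obj.X ((v ⊗ₜ[k] AlgData.e k f) ⊗ₜ[k] w))) = _
  rw [ZObj.assocHom_tmul hv (D.isDeg_e f) hw, map_smul, map_smul, TensorProduct.map_tmul,
    actLeft_lin]
  rfl

/-- A universal property for maps that are merely linear: it is used with targets that are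
reductions over H/F and hence not objects of Z(H, α). -/
theorem locT_exists_desc {W : Type*} [AddCommGroup W] [Module k W]
    {χ : M.obj.X.V ⊗[k] N.obj.X.V →ₗ[k] W}
    (hχ : ∀ g v, M.obj.X.IsDeg g v → ∀ f : F, ∀ h w, N.obj.X.IsDeg h w →
      χ (mulE M.obj f v ⊗ₜ w) =
        ((α g f h)⁻¹ : k) • χ (v ⊗ₜ mulE N.obj f (N.obj.X.act f w))) :
    ∃ χ' : (M ⊗ N).obj.X.V →ₗ[k] W, χ' ∘ₗ locT M N = χ := by
  refine ZObj.coequalizer_exists_desc (X := (M.obj.X ⊗ D.obj) ⊗ N.obj.X)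
    (Y := M.obj.X ⊗ N.obj.X) (M.obj.act ▷ N.obj.X)
    ((α_ _ _ _).hom ≫ M.obj.X ◁ N.obj.actLeft) (χ := χ) ?_
  refine TensorProduct.ext (tmul_e_ext fun g v hv f => ZObj.lin_ext fun h w hw => ?_)
  change χ (mulE M.obj f v ⊗ₜ w) = χ (TensorProduct.map LinearMap.id N.obj.actLeft.lin
    (ZObj.assocHom M.obj.X D.obj N.obj.X ((v ⊗ₜ[k] AlgData.e k f) ⊗ₜ[k] w)))
  rw [ZObj.assocHom_tmul hv (D.isDeg_e f) hw, map_smul, map_smul, TensorProduct.map_tmul,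
    actLeft_lin]
  exact hχ g v hv f h w hw

end LocTensor

namespace Trivialization

/-! ### The tensorator -/

section Tensor

variable {k H : Type u} [Field k] [Group H] [Fintype H] {α : Cocycle3 k H} {F : Subgroup H}
  [F.Normal] {D : AlgData α F} {ω : Cocycle3 k (H ⧸ F)} (t : D.Trivialization ω)
  {M N L : LocMod D.obj} {g h l : H} {v : M.obj.X.V} {w : N.obj.X.V}

theorem ψ_mul_mid (g : H) (f : F) (h : H) :
    t.ψ f h * t.ψ g (f * h) = α g f h * t.ψ g f * t.ψ (g * f) h := by
  have := t.coboundary g f h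
  rwa [(QuotientGroup.eq_one_iff (f : H)).2 f.2, ω.one_mid, one_mul] at this

theorem ψ_mul_right (g h : H) (f : F) :
    t.ψ h f * t.ψ g (h * f) = α g h f * t.ψ g h * t.ψ (g * h) f := by
  have := t.coboundary g h f
  rwa [(QuotientGroup.eq_one_iff (f : H)).2 f.2, ω.one_right, one_mul] at this

/-- This computes the left action of e_f on a local module. By `act_coe` the action of f shifts v by
g⁻¹fgf⁻¹, and e_f then shifts by f, which makes g⁻¹fg in total. -/
theorem mulE_act (hM : RMod.IsLocal D.obj M.obj) (hv : M.obj.X.IsDeg g v) (f : F) :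
    mulE M.obj f (M.obj.X.act f v) =
      (t.ψ f g : k) • t.shift M.obj (MulAut.conjNormal g⁻¹ f) v := by
  have e : M.obj.X.act f v = ((t.corr f g)⁻¹ : kˣ).val • t.act M.obj.X f v := by
    rw [t.act_apply hv, smul_smul]; simp
  rw [e, map_smul, t.act_coe hM hv, t.mulE_eq_shift (t.isDeg_shift hv _), ← LinearMap.comp_apply,
    shift_mul, inv_mul_cancel_right, smul_smul, ← Units.val_mul]
  congr 2
  rw [show g * (MulAut.conjNormal g⁻¹ f * f⁻¹ : F) = f * g * (f : H)⁻¹ by simp [mul_assoc], corr]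
  simp

theorem shift_locT (hv : M.obj.X.IsDeg g v) (hw : N.obj.X.IsDeg h w) (f : F) :
    t.shift (M ⊗ N).obj f (locT M N (v ⊗ₜ w)) =
      (t.ψ g h * (t.ψ g (h * f))⁻¹ : kˣ).val • locT M N (v ⊗ₜ t.shift N.obj f w) := by
  rw [t.shift_apply (isDeg_locT hv hw), mulE_locT hv hw, t.mulE_eq_shift hw,
    TensorProduct.tmul_smul, map_smul, smul_smul, smul_smul, ← Units.val_inv_eq_inv_val,
    ← Units.val_mul, ← Units.val_mul]
  congr 2
  have h₁ := congrArg Additive.ofMul (t.ψ_mul_right g h f)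
  apply Additive.ofMul.injective
  simp only [ofMul_mul, ofMul_inv] at *
  linear_combination (norm := abel) h₁

/-- Balancedness turns a shift of the left factor into the left action on the right factor, which is
again a shift by `mulE_act`. The scalars are collected with `ψ_mul_mid`. -/
theorem locT_shift (hv : M.obj.X.IsDeg g v) (hw : N.obj.X.IsDeg h w) (f : F) :
    locT M N (t.shift M.obj f v ⊗ₜ w) = (t.ψ (g * f) h * (t.ψ g (f * h))⁻¹ : kˣ).val •
      locT M N (v ⊗ₜ t.shift N.obj (MulAut.conjNormal h⁻¹ f) w) := by
  rw [t.shift_apply hv, ← TensorProduct.smul_tmul', map_smul, locT_balanced hv hw,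
    t.mulE_act N.property hw, TensorProduct.tmul_smul, map_smul, smul_smul, smul_smul,
    ← Units.val_inv_eq_inv_val, ← Units.val_mul, ← Units.val_mul]
  congr 2
  have h₁ := congrArg Additive.ofMul (t.ψ_mul_mid g f h)
  apply Additive.ofMul.injective
  simp only [ofMul_mul, ofMul_inv] at *
  linear_combination (norm := abel) h₁

variable (s : H ⧸ F → H) (hs : ∀ x, (s x : H ⧸ F) = x)

/-- The corrected projection to the reduction of a relative tensor product. -/
noncomputable def tensPre (M N : LocMod D.obj) :
    M.obj.X.V ⊗[k] N.obj.X.V →ₗ[k] t.redV s hs (M ⊗ N).obj :=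
  ∑ g, ∑ h, ((t.ψ g h)⁻¹ : kˣ).val • (t.redπ s hs (M ⊗ N).obj ∘ₗ locT M N ∘ₗ
    TensorProduct.map (M.obj.X.proj g) (N.obj.X.proj h))

theorem tensPre_apply (hv : M.obj.X.IsDeg g v) (hw : N.obj.X.IsDeg h w) :
    t.tensPre s hs M N (v ⊗ₜ w) =
      ((t.ψ g h)⁻¹ : kˣ).val • t.redπ s hs (M ⊗ N).obj (locT M N (v ⊗ₜ w)) := by
  simp only [tensPre, LinearMap.sum_apply, LinearMap.smul_apply, LinearMap.comp_apply,
    TensorProduct.map_tmul]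
  rw [hv.sum (fun g' v' => ∑ h', ((t.ψ g' h')⁻¹ : kˣ).val • t.redπ s hs (M ⊗ N).obj
      (locT M N (v' ⊗ₜ N.obj.X.proj h' w))) (by simp),
    hw.sum (fun h' w' => ((t.ψ g h')⁻¹ : kˣ).val • t.redπ s hs (M ⊗ N).obj
      (locT M N (v ⊗ₜ w'))) (by simp)]

/-- The factor ψ(g, h)⁻¹ in `tensPre` exists for this: it cancels the quotient of ψ-values in
`shift_locT`. With the analogous statement for the left factor, the map passes to the reductions of
both factors. -/
theorem tensPre_shift_right (hv : M.obj.X.IsDeg g v) (hw : N.obj.X.IsDeg h w) (f : F) :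
    t.tensPre s hs M N (v ⊗ₜ t.shift N.obj f w) = t.tensPre s hs M N (v ⊗ₜ w) := by
  rw [t.tensPre_apply s hs hv hw, ← t.redπ_shift s hs f, t.shift_locT hv hw, map_smul,
    t.tensPre_apply s hs hv (t.isDeg_shift hw f), smul_smul, ← Units.val_mul]
  congr 2
  simp

theorem tensPre_shift_left (hv : M.obj.X.IsDeg g v) (hw : N.obj.X.IsDeg h w) (f : F) :
    t.tensPre s hs M N (t.shift M.obj f v ⊗ₜ w) = t.tensPre s hs M N (v ⊗ₜ w) := by
  rw [t.tensPre_apply s hs (t.isDeg_shift hv f) hw, t.locT_shift hv hw, map_smul,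
    ← t.tensPre_shift_right s hs hv hw (MulAut.conjNormal h⁻¹ f),
    t.tensPre_apply s hs hv (t.isDeg_shift hw _), smul_smul, ← Units.val_mul]
  congr 2
  rw [show h * (MulAut.conjNormal h⁻¹ f : F) = f * h by simp [mul_assoc]]
  simp

theorem tensPre_toRep : t.tensPre s hs M N ∘ₗ
    TensorProduct.map (t.toRep s hs M.obj) (t.toRep s hs N.obj) = t.tensPre s hs M N :=
  ZObj.tens_ext fun g v hv h w hw => by
    rw [LinearMap.comp_apply, TensorProduct.map_tmul, t.toRep_apply s hs hv, t.toRep_apply s hs hw,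
      t.tensPre_shift_left s hs hv (t.isDeg_shift hw _), t.tensPre_shift_right s hs hv hw]

/-- The tensorator as a linear map. -/
noncomputable def tensLin (M N : LocMod D.obj) :
    t.redV s hs M.obj ⊗[k] t.redV s hs N.obj →ₗ[k] t.redV s hs (M ⊗ N).obj :=
  t.tensPre s hs M N ∘ₗ TensorProduct.map (t.redι s hs M.obj) (t.redι s hs N.obj)

theorem tensLin_redπ (hv : M.obj.X.IsDeg g v) (hw : N.obj.X.IsDeg h w) :
    t.tensLin s hs M N (t.redπ s hs M.obj v ⊗ₜ t.redπ s hs N.obj w) =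
      ((t.ψ g h)⁻¹ : kˣ).val • t.redπ s hs (M ⊗ N).obj (locT M N (v ⊗ₜ w)) :=
  (LinearMap.congr_fun (t.tensPre_toRep s hs) (v ⊗ₜ w)).trans (t.tensPre_apply s hs hv hw)

theorem redV_ext₂ {W : Type*} [AddCommGroup W] [Module k W]
    {φ ψ : t.redV s hs M.obj ⊗[k] t.redV s hs N.obj →ₗ[k] W}
    (e : ∀ g v, M.obj.X.IsDeg g v → ∀ h w, N.obj.X.IsDeg h w →
      φ (t.redπ s hs M.obj v ⊗ₜ t.redπ s hs N.obj w) =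
        ψ (t.redπ s hs M.obj v ⊗ₜ t.redπ s hs N.obj w)) : φ = ψ :=
  TensorProduct.ext (t.redV_ext s hs fun g v hv => t.redV_ext s hs fun h w hw => e g v hv h w hw)

theorem redV_ext₃ {W : Type*} [AddCommGroup W] [Module k W]
    {φ ψ : (t.redV s hs M.obj ⊗[k] t.redV s hs N.obj) ⊗[k] t.redV s hs L.obj →ₗ[k] W}
    (e : ∀ g v, M.obj.X.IsDeg g v → ∀ h w, N.obj.X.IsDeg h w → ∀ l u, L.obj.X.IsDeg l u →
      φ ((t.redπ s hs M.obj v ⊗ₜ t.redπ s hs N.obj w) ⊗ₜ t.redπ s hs L.obj u) =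
        ψ ((t.redπ s hs M.obj v ⊗ₜ t.redπ s hs N.obj w) ⊗ₜ t.redπ s hs L.obj u)) : φ = ψ :=
  TensorProduct.ext (t.redV_ext₂ s hs fun g v hv h w hw => t.redV_ext s hs fun l u hu =>
    e g v hv h w hw l u hu)

/-- The linear map underlying `tensInv`, before passing to the quotient. -/
noncomputable def tensInvPre (M N : LocMod D.obj) :
    M.obj.X.V ⊗[k] N.obj.X.V →ₗ[k] t.redV s hs M.obj ⊗[k] t.redV s hs N.obj :=
  ∑ g, ∑ h, (t.ψ g h : k) • (TensorProduct.map (t.redπ s hs M.obj ∘ₗ M.obj.X.proj g)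
    (t.redπ s hs N.obj ∘ₗ N.obj.X.proj h))

theorem tensInvPre_apply (hv : M.obj.X.IsDeg g v) (hw : N.obj.X.IsDeg h w) :
    t.tensInvPre s hs M N (v ⊗ₜ w) =
      (t.ψ g h : k) • (t.redπ s hs M.obj v ⊗ₜ t.redπ s hs N.obj w) := by
  simp only [tensInvPre, LinearMap.sum_apply, LinearMap.smul_apply, LinearMap.comp_apply,
    TensorProduct.map_tmul]
  rw [hv.sum (fun g' v' => ∑ h', (t.ψ g' h' : k) • (t.redπ s hs M.obj v' ⊗ₜ[k]
      t.redπ s hs N.obj (N.obj.X.proj h' w))) (by simp),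
    hw.sum (fun h' w' => (t.ψ g h' : k) • (t.redπ s hs M.obj v ⊗ₜ[k]
      t.redπ s hs N.obj w')) (by simp)]

/-- After reduction the shifts on both sides of the balancing relation disappear, and the remaining
equality of scalars is `ψ_mul_mid`. -/
theorem exists_tensInv (M N : LocMod D.obj) :
    ∃ χ : (M ⊗ N).obj.X.V →ₗ[k] t.redV s hs M.obj ⊗[k] t.redV s hs N.obj,
      χ ∘ₗ locT M N = t.tensInvPre s hs M N :=
  locT_exists_desc fun g v hv f h w hw => by
    rw [t.mulE_eq_shift hv, ← TensorProduct.smul_tmul', map_smul,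
      t.tensInvPre_apply s hs (t.isDeg_shift hv f) hw, t.mulE_act N.property hw,
      TensorProduct.tmul_smul, map_smul, t.tensInvPre_apply s hs hv (t.isDeg_shift hw _),
      redπ_shift, redπ_shift, ← Units.val_inv_eq_inv_val]
    simp only [smul_smul, ← Units.val_mul]
    congr 2
    have h₁ := congrArg Additive.ofMul (t.ψ_mul_mid g f h)
    rw [show h * (MulAut.conjNormal h⁻¹ f : F) = f * h by simp [mul_assoc]]
    apply Additive.ofMul.injective
    simp only [ofMul_mul, ofMul_inv] at *
    linear_combination (norm := abel) -h₁

/-- The inverse of the tensorator, as a linear map. -/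
noncomputable def tensInv (M N : LocMod D.obj) :
    t.redV s hs (M ⊗ N).obj →ₗ[k] t.redV s hs M.obj ⊗[k] t.redV s hs N.obj :=
  t.redDesc s hs (t.exists_tensInv s hs M N).choose

theorem tensInv_redπ (hv : M.obj.X.IsDeg g v) (hw : N.obj.X.IsDeg h w) :
    t.tensInv s hs M N (t.redπ s hs (M ⊗ N).obj (locT M N (v ⊗ₜ w))) =
      (t.ψ g h : k) • (t.redπ s hs M.obj v ⊗ₜ t.redπ s hs N.obj w) := by
  have hc := (t.exists_tensInv s hs M N).choose_spec
  rw [tensInv, redDesc_redπ]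
  · exact (LinearMap.congr_fun hc (v ⊗ₜ w)).trans (t.tensInvPre_apply s hs hv hw)
  · intro f
    refine locT_ext fun g v hv h w hw => ?_
    have h₁ := fun x => LinearMap.congr_fun hc x
    simp only [LinearMap.comp_apply] at h₁ ⊢
    rw [t.shift_locT hv hw, map_smul, h₁, h₁, t.tensInvPre_apply s hs hv (t.isDeg_shift hw f),
      t.tensInvPre_apply s hs hv hw, redπ_shift, smul_smul, ← Units.val_mul]
    congr 2
    simp

variable [Fintype (H ⧸ F)]

/-- The tensorator of the reduction functor. -/
noncomputable def tensIso (M N : LocMod D.obj) :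
    t.redObj s hs M ⊗ t.redObj s hs N ≅ t.redObj s hs (M ⊗ N) :=
  ZObj.mkIso (X := t.redObj s hs M ⊗ t.redObj s hs N) (Y := t.redObj s hs (M ⊗ N))
    { lin := t.tensLin s hs M N
      proj_comm := fun x u => by
        classical
        refine LinearMap.congr_fun
          (f := t.tensLin s hs M N ∘ₗ ZObj.tProj (t.redObj s hs M) (t.redObj s hs N) x)
          (g := t.redProj s hs (M ⊗ N).obj x ∘ₗ t.tensLin s hs M N)
          (t.redV_ext₂ s hs fun g v hv h w hw => ?_) u
        rw [LinearMap.comp_apply, LinearMap.comp_apply, ZObj.tProj_tmul (t.isDeg_redπ s hs hv)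
          (t.isDeg_redπ s hs hw), apply_ite (t.tensLin s hs M N), map_zero,
          t.tensLin_redπ s hs hv hw, map_smul, t.redProj_redπ s hs (isDeg_locT hv hw), smul_ite,
          smul_zero]
        rfl
      act_comm := fun x u => by
        obtain ⟨f, rfl⟩ := QuotientGroup.mk_surjective x
        refine LinearMap.congr_fun
          (f := t.tensLin s hs M N ∘ₗ ZObj.tAct (t.redObj s hs M) (t.redObj s hs N) f)
          (g := t.redAct s hs (M ⊗ N).obj f ∘ₗ t.tensLin s hs M N)
          (t.redV_ext₂ s hs fun g v hv h w hw => ?_) u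
        have h₁ := t.act_redπ s hs (isDeg_locT hv hw) f
        rw [act_locT hv hw, map_smul] at h₁
        rw [LinearMap.comp_apply, LinearMap.comp_apply, ZObj.tAct_tmul (t.isDeg_redπ s hs hv)
          (t.isDeg_redπ s hs hw), t.act_redπ s hs hv, t.act_redπ s hs hw,
          TensorProduct.tmul_smul, ← TensorProduct.smul_tmul', map_smul, map_smul, map_smul,
          t.tensLin_redπ s hs hv hw, map_smul, t.tensLin_redπ s hs (hv.act f) (hw.act f)]
        refine Eq.trans ?_ (congrArg (((t.ψ g h)⁻¹ : kˣ).val • ·) h₁).symm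
        simp only [smul_smul, ← Units.val_mul]
        congr 2
        have h₂ := congrArg Additive.ofMul (t.corr_one f g h)
        apply Additive.ofMul.injective
        simp only [ofMul_mul, ofMul_inv] at *
        linear_combination (norm := abel) h₂ }
    (t.tensInv s hs M N)
    (t.redV_ext₂ s hs fun g v hv h w hw => by
      change t.tensInv s hs M N (t.tensLin s hs M N _) = _
      rw [t.tensLin_redπ s hs hv hw, map_smul, t.tensInv_redπ s hs hv hw, smul_smul,
        ← Units.val_mul, inv_mul_cancel, Units.val_one, one_smul]
      rfl)
    ((LinearMap.cancel_right (t.redπ_surjective s hs (M ⊗ N).obj)).1 <|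
      locT_ext fun g v hv h w hw => by
      change t.tensLin s hs M N (t.tensInv s hs M N _) = _
      rw [t.tensInv_redπ s hs hv hw, map_smul, t.tensLin_redπ s hs hv hw, smul_smul,
        ← Units.val_mul, mul_inv_cancel, Units.val_one, one_smul]
      rfl)

end Tensor

end Trivialization
end AlgData

namespace AlgData

/-! ### Structure maps of the local modules in terms of elements -/

section LocStructure

variable {k H : Type u} [Field k] [Group H] [Fintype H] {α : Cocycle3 k H} {F : Subgroup H}
  [F.Normal] {D : AlgData α F} {M N L : LocMod D.obj} {g h l : H} {v : M.obj.X.V}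
  {w : N.obj.X.V} {u : L.obj.X.V}

theorem whiskerRight_locT (φ : M ⟶ N) (L : LocMod D.obj) (v : M.obj.X.V) (u : L.obj.X.V) :
    (φ ▷ L).hom.hom.lin (locT M L (v ⊗ₜ u)) = locT N L (φ.hom.hom.lin v ⊗ₜ u) :=
  LinearMap.congr_fun (congrArg ZObj.Hom.lin (LocMod.locπ_whiskerRight φ L)) (v ⊗ₜ u)

theorem whiskerLeft_locT (L : LocMod D.obj) (φ : M ⟶ N) (u : L.obj.X.V) (v : M.obj.X.V) :
    (L ◁ φ).hom.hom.lin (locT L M (u ⊗ₜ v)) = locT L N (u ⊗ₜ φ.hom.hom.lin v) :=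
  LinearMap.congr_fun (congrArg ZObj.Hom.lin (LocMod.locπ_whiskerLeft L φ)) (u ⊗ₜ v)

theorem associator_locT (hv : M.obj.X.IsDeg g v) (hw : N.obj.X.IsDeg h w)
    (hu : L.obj.X.IsDeg l u) :
    (α_ M N L).hom.hom.hom.lin (locT (M ⊗ N) L (locT M N (v ⊗ₜ w) ⊗ₜ u)) =
      ((α g h l)⁻¹ : kˣ).val • locT M (N ⊗ L) (v ⊗ₜ locT N L (w ⊗ₜ u)) := by
  refine (LinearMap.congr_fun (congrArg ZObj.Hom.lin (LocMod.locπ_associator M N L))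
    ((v ⊗ₜ w) ⊗ₜ u)).trans ?_
  change locT M (N ⊗ L) (TensorProduct.map LinearMap.id (locT N L)
    (ZObj.assocHom M.obj.X N.obj.X L.obj.X ((v ⊗ₜ[k] w) ⊗ₜ[k] u))) = _
  rw [ZObj.assocHom_tmul hv hw hu, map_smul, map_smul, TensorProduct.map_tmul,
    Units.val_inv_eq_inv_val]
  rfl

theorem braiding_locT (hv : M.obj.X.IsDeg g v) (w : N.obj.X.V) :
    (β_ M N).hom.hom.hom.lin (locT M N (v ⊗ₜ w)) = locT N M (N.obj.X.act g w ⊗ₜ v) := by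
  refine (LinearMap.congr_fun (congrArg ZObj.Hom.lin (LocMod.locπ_braid M N)) (v ⊗ₜ w)).trans ?_
  change locT N M (ZObj.braidHom M.obj.X N.obj.X (v ⊗ₜ[k] w)) = _
  rw [ZObj.braidHom_tmul hv]

theorem leftUnitor_locT (M : LocMod D.obj) (f : F) (v : M.obj.X.V) :
    (λ_ M).hom.hom.hom.lin (locT (𝟙_ _) M (e k f ⊗ₜ[k] v)) =
      mulE M.obj f (M.obj.X.act f v) :=
  (LinearMap.congr_fun (congrArg ZObj.Hom.lin (RMod.leftUnitor_hom_hom M.obj))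
    (e k f ⊗ₜ[k] v)).trans (actLeft_lin M.obj f v)

theorem rightUnitor_locT (M : LocMod D.obj) (v : M.obj.X.V) (f : F) :
    (ρ_ M).hom.hom.hom.lin (locT M (𝟙_ _) (v ⊗ₜ[k] e k f)) = mulE M.obj f v :=
  LinearMap.congr_fun (congrArg ZObj.Hom.lin (RMod.rightUnitor_hom_hom M.obj)) (v ⊗ₜ[k] e k f)

theorem mulE_unit (a f : F) :
    mulE (RMod.unit D.obj) f (e k a) = (D.γ a f : k) • e k (a * f) :=
  D.mulLin_e a f

end LocStructure

/-! ### The twist of local modules -/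

section Twist

variable {k H : Type u} [Field k] [Group H] [Fintype H] {α : Cocycle3 k H} {F : Subgroup H}
  [F.Normal] {D : AlgData α F}

/-- Commutativity at (f, f) compares γ(f, f) with itself. In consequence the twist of the algebra is
the identity. -/
theorem ε_self (f : F) : D.ε f f = 1 := by
  have h := D.comm f f
  have e : MulAut.conjNormal (f : H) f = f := Subtype.ext (by simp)
  rw [e] at h
  exact (mul_eq_right.1 h.symm)

/-- By naturality the twist passes from M to M ⊗ A. By balance it becomes there the double braiding
together with the twists of M and A. The twist of A is trivial, and the double braiding is absorbed
by the action of a local module. -/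
theorem twist_act {M : RMod D.obj} (hM : RMod.IsLocal D.obj M) :
    M.act ≫ (ZObj.twist α).hom.app M.X = ((ZObj.twist α).hom.app M.X) ▷ D.obj ≫ M.act := by
  have h₁ : (ZObj.twist α).hom.app D.obj = 𝟙 _ := ZObj.hom_ext <| e_ext fun f => by
    change ZObj.twistLin D.obj (e k f) = e k f
    rw [ZObj.twistLin_apply (D.isDeg_e f), D.act_e, ε_self, Units.val_one, one_smul,
      show MulAut.conjNormal (f : H) f = f from Subtype.ext (by simp)]
  have h₂ := (ZObj.twist α).hom.naturality M.act
  refine h₂.trans ?_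
  change (ZObj.twist α).hom.app (M.X ⊗ D.obj) ≫ M.act = _
  have h₃ : (β_ M.X D.obj).hom ≫ (β_ D.obj M.X).hom ≫ M.act = M.act := hM
  have h₄ : ∀ φ : M.X ⟶ M.X, ((β_ M.X D.obj).hom ≫ (β_ D.obj M.X).hom ≫
      (φ ⊗ₘ 𝟙 D.obj)) ≫ M.act = φ ▷ D.obj ≫ M.act := fun φ => by
    rw [tensorHom_id, ← BraidedCategory.braiding_naturality_right,
      ← BraidedCategory.braiding_naturality_left_assoc, Category.assoc, Category.assoc, h₃]
  exact (congrArg (· ≫ M.act) (ZObj.isRibbonTwist_twist.balance M.X D.obj)).trans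
    ((congrArg (fun z => ((β_ M.X D.obj).hom ≫ (β_ D.obj M.X).hom ≫
      ((ZObj.twist α).hom.app M.X ⊗ₘ z)) ≫ M.act) h₁).trans (h₄ _))

theorem act_inv_comm {M : RMod D.obj} {φ ψ : M.X ⟶ M.X} (h₁ : φ ≫ ψ = 𝟙 _) (h₂ : ψ ≫ φ = 𝟙 _)
    (h : M.act ≫ φ = φ ▷ D.obj ≫ M.act) : M.act ≫ ψ = ψ ▷ D.obj ≫ M.act := by
  have h₃ := congrArg (fun z => ψ ▷ D.obj ≫ z ≫ ψ) h
  simp only [Category.assoc, h₁, Category.comp_id, ← comp_whiskerRight_assoc, h₂,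
    id_whiskerRight, Category.id_comp] at h₃
  exact h₃.symm

/-- The twist of a local module. -/
noncomputable def locTwistIso (M : LocMod D.obj) : M ≅ M :=
  (RMod.IsLocal D.obj).isoMk
    { hom := ⟨(ZObj.twist α).hom.app M.obj.X, twist_act M.property⟩
      inv := ⟨(ZObj.twist α).inv.app M.obj.X, act_inv_comm
        ((ZObj.twist α).hom_inv_id_app M.obj.X) ((ZObj.twist α).inv_hom_id_app M.obj.X)
        (twist_act M.property)⟩
      hom_inv_id := RMod.hom_ext ((ZObj.twist α).hom_inv_id_app _)
      inv_hom_id := RMod.hom_ext ((ZObj.twist α).inv_hom_id_app _) }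

variable (D) in
/-- The twist of `Z(H, α)` restricted to the local modules. -/
noncomputable def locTwist : 𝟭 (LocMod D.obj) ≅ 𝟭 (LocMod D.obj) :=
  NatIso.ofComponents locTwistIso fun φ =>
    LocMod.locHom_ext ((ZObj.twist α).hom.naturality φ.hom.hom)

end Twist

namespace Trivialization

/-! ### The braided monoidal structure of the reduction functor -/

section Reduction

variable {k H : Type u} [Field k] [Group H] [Fintype H] {α : Cocycle3 k H} {F : Subgroup H}
  [F.Normal] {D : AlgData α F} {ω : Cocycle3 k (H ⧸ F)} (t : D.Trivialization ω)
  (s : H ⧸ F → H) (hs : ∀ x, (s x : H ⧸ F) = x) [Fintype (H ⧸ F)]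

/-- As ψ = γ on F, the correction cancels the structure constants. The shifts permute the e_f simply
transitively, so that the reduction of the unit is spanned by the class of e_1. -/
theorem shift_unit (a f : F) :
    t.shift (RMod.unit D.obj) f (e k a) = e k (a * f) := by
  rw [t.shift_apply (M := RMod.unit D.obj) (D.isDeg_e a), mulE_unit, smul_smul, t.ψ_coe,
    ← Units.val_mul, inv_mul_cancel, Units.val_one, one_smul]

theorem eLin_shift (f : F) : (eLin fun _ => (1 : k)) ∘ₗ t.shift (RMod.unit D.obj) f =
    eLin fun _ => (1 : k) :=
  e_ext fun a => by
    refine (congrArg (eLin fun _ => (1 : k)) (t.shift_unit a f)).trans ?_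
    rw [eLin_e, eLin_e]

theorem redπ_e (f : F) :
    t.redπ s hs (RMod.unit D.obj) (e k f) = t.redπ s hs (RMod.unit D.obj) (e k (1 : F)) := by
  refine Eq.trans ?_ (t.redπ_shift s hs (M := RMod.unit D.obj) f (e k (1 : F)))
  rw [shift_unit, one_mul]

/-- The unit constraint of the reduction functor. -/
noncomputable def unitIso : 𝟙_ (ZObj ω) ≅ t.redObj s hs (𝟙_ (LocMod D.obj)) :=
  ZObj.mkIso (X := 𝟙_ (ZObj ω)) (Y := t.redObj s hs (𝟙_ (LocMod D.obj)))
    (ZObj.mkHom (X := 𝟙_ (ZObj ω)) (Y := t.redObj s hs (𝟙_ (LocMod D.obj)))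
      (LinearMap.toSpanSingleton k _ (t.redπ s hs (RMod.unit D.obj) (e k (1 : F))))
      (fun x c hc => by
        rcases eq_or_ne x 1 with rfl | hx
        · exact (t.isDeg_redπ s hs (M := 𝟙_ _) (D.isDeg_e (1 : F))).smul c
        · have h₀ : c = 0 := hc.symm.trans ((ZObj.isDeg_unit (α := ω) c).proj_ne hx)
          subst h₀
          rw [map_zero]
          exact map_zero ((t.redObj s hs (𝟙_ _)).proj x))
      fun x y c hc => by
        change c • _ = (t.redObj s hs (𝟙_ _)).act x (c • t.redπ s hs (RMod.unit D.obj) _)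
        obtain ⟨f, rfl⟩ := QuotientGroup.mk_surjective x
        have h₁ := t.act_redπ s hs (M := 𝟙_ _) (D.isDeg_e (1 : F)) f
        rw [map_smul]
        refine congrArg (c • ·) (h₁.trans ?_).symm
        have h₂ : D.obj.act f (e k (1 : F)) = e k (1 : F) := by
          rw [D.act_e, D.ε_one_right, map_one, Units.val_one, one_smul]
        refine Eq.trans (congrArg (fun z => (t.corr f (1 : F) : k) •
          t.redπ s hs (RMod.unit D.obj) z) h₂) ?_
        rw [corr, Subgroup.coe_one, mul_one, mul_inv_cancel, t.ψ_one_left, t.ψ_one_right]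
        simp)
    (t.redDesc s hs (M := RMod.unit D.obj) (eLin fun _ => (1 : k)))
    (LinearMap.ext_ring <| by
      change t.redDesc s hs (M := RMod.unit D.obj) (eLin fun _ => (1 : k))
        ((1 : k) • t.redπ s hs (RMod.unit D.obj) (e k (1 : F))) = 1
      rw [one_smul, t.redDesc_redπ s hs (t.eLin_shift), eLin_e])
    ((LinearMap.cancel_right (t.redπ_surjective s hs (RMod.unit D.obj))).1 <| e_ext fun f => by
      change t.redDesc s hs (M := RMod.unit D.obj) (eLin fun _ => (1 : k))
        (t.redπ s hs (RMod.unit D.obj) (e k f)) • t.redπ s hs (RMod.unit D.obj) (e k (1 : F)) =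
          t.redπ s hs (RMod.unit D.obj) (e k f)
      rw [t.redDesc_redπ s hs (t.eLin_shift), eLin_e, one_smul, t.redπ_e s hs f])

theorem tens_natural_left {M N : LocMod D.obj} (φ : M ⟶ N) (L : LocMod D.obj) :
    (t.redFunctor s hs).map φ ▷ (t.redFunctor s hs).obj L ≫ (t.tensIso s hs N L).hom =
      (t.tensIso s hs M L).hom ≫ (t.redFunctor s hs).map (φ ▷ L) :=
  ZObj.hom_ext <| t.redV_ext₂ s hs fun g v hv h w hw => by
    change t.tensLin s hs N L (t.redMapLin s hs φ (t.redπ s hs M.obj v) ⊗ₜ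
        t.redπ s hs L.obj w) = t.redMapLin s hs (φ ▷ L)
      (t.tensLin s hs M L (t.redπ s hs M.obj v ⊗ₜ t.redπ s hs L.obj w))
    rw [redMapLin_redπ, t.tensLin_redπ s hs (hv.map φ.hom.hom) hw, t.tensLin_redπ s hs hv hw,
      map_smul, redMapLin_redπ, whiskerRight_locT]

theorem tens_natural_right (L : LocMod D.obj) {M N : LocMod D.obj} (φ : M ⟶ N) :
    (t.redFunctor s hs).obj L ◁ (t.redFunctor s hs).map φ ≫ (t.tensIso s hs L N).hom =
      (t.tensIso s hs L M).hom ≫ (t.redFunctor s hs).map (L ◁ φ) :=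
  ZObj.hom_ext <| t.redV_ext₂ s hs fun g v hv h w hw => by
    change t.tensLin s hs L N (t.redπ s hs L.obj v ⊗ₜ
        t.redMapLin s hs φ (t.redπ s hs M.obj w)) =
      t.redMapLin s hs (L ◁ φ)
        (t.tensLin s hs L M (t.redπ s hs L.obj v ⊗ₜ t.redπ s hs M.obj w))
    rw [redMapLin_redπ, t.tensLin_redπ s hs hv (hw.map φ.hom.hom), t.tensLin_redπ s hs hv hw,
      map_smul, redMapLin_redπ, whiskerLeft_locT]

/-- The two composites carry ψ(g, h)⁻¹ψ(gh, l)⁻¹ and ψ(h, l)⁻¹ψ(g, hl)⁻¹. By the coboundary equation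
these differ by the ratio of `α` to `ω`, that is, of the two associators. -/
theorem tens_assoc (M N L : LocMod D.obj) :
    (t.tensIso s hs M N).hom ▷ (t.redFunctor s hs).obj L ≫ (t.tensIso s hs (M ⊗ N) L).hom ≫
        (t.redFunctor s hs).map (α_ M N L).hom =
      (α_ _ _ _).hom ≫ (t.redFunctor s hs).obj M ◁ (t.tensIso s hs N L).hom ≫
        (t.tensIso s hs M (N ⊗ L)).hom :=
  ZObj.hom_ext <| t.redV_ext₃ s hs fun g v hv h w hw l u hu => by
    change t.redMapLin s hs (α_ M N L).hom (t.tensLin s hs (M ⊗ N) L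
        (t.tensLin s hs M N (t.redπ s hs M.obj v ⊗ₜ t.redπ s hs N.obj w) ⊗ₜ
          t.redπ s hs L.obj u)) =
      t.tensLin s hs M (N ⊗ L) (TensorProduct.map LinearMap.id (t.tensLin s hs N L)
        (ZObj.assocHom (t.redObj s hs M) (t.redObj s hs N) (t.redObj s hs L)
          ((t.redπ s hs M.obj v ⊗ₜ[k] t.redπ s hs N.obj w) ⊗ₜ[k] t.redπ s hs L.obj u)))
    rw [ZObj.assocHom_tmul (t.isDeg_redπ s hs hv) (t.isDeg_redπ s hs hw) (t.isDeg_redπ s hs hu),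
      map_smul, map_smul, TensorProduct.map_tmul, t.tensLin_redπ s hs hw hu,
      t.tensLin_redπ s hs hv hw, TensorProduct.tmul_smul, ← TensorProduct.smul_tmul', map_smul,
      map_smul, map_smul, t.tensLin_redπ s hs (isDeg_locT hv hw) hu, LinearMap.id_apply,
      t.tensLin_redπ s hs hv (isDeg_locT hw hu), map_smul, redMapLin_redπ,
      associator_locT hv hw hu, map_smul, ← Units.val_inv_eq_inv_val]
    simp only [smul_smul, ← Units.val_mul]
    congr 2
    have h₁ := congrArg Additive.ofMul (t.coboundary g h l)
    apply Additive.ofMul.injective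
    simp only [ofMul_mul, ofMul_inv] at *
    linear_combination (norm := abel) h₁

theorem tens_leftUnitor (M : LocMod D.obj) :
    (λ_ ((t.redFunctor s hs).obj M)).hom = (t.unitIso s hs).hom ▷ (t.redFunctor s hs).obj M ≫
      (t.tensIso s hs (𝟙_ _) M).hom ≫ (t.redFunctor s hs).map (λ_ M).hom :=
  ZObj.hom_ext <| TensorProduct.ext <| LinearMap.ext_ring <| t.redV_ext s hs fun g v hv => by
    change (1 : k) • t.redπ s hs M.obj v = t.redMapLin s hs (λ_ M).hom
      (t.tensLin s hs (𝟙_ _) M (((1 : k) • t.redπ s hs (RMod.unit D.obj) (e k (1 : F))) ⊗ₜ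
        t.redπ s hs M.obj v))
    rw [one_smul, one_smul]
    have h₁ := t.tensLin_redπ s hs (M := 𝟙_ _) (D.isDeg_e (1 : F)) hv
    refine Eq.trans ?_ (congrArg (t.redMapLin s hs (λ_ M).hom) h₁).symm
    rw [map_smul, redMapLin_redπ, leftUnitor_locT, Subgroup.coe_one, M.obj.X.act_one,
      mulE_one, t.ψ_one_left]
    simp

theorem tens_rightUnitor (M : LocMod D.obj) :
    (ρ_ ((t.redFunctor s hs).obj M)).hom = (t.redFunctor s hs).obj M ◁ (t.unitIso s hs).hom ≫
      (t.tensIso s hs M (𝟙_ _)).hom ≫ (t.redFunctor s hs).map (ρ_ M).hom :=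
  ZObj.hom_ext <| TensorProduct.ext <| t.redV_ext s hs fun g v hv => LinearMap.ext_ring <| by
    change (1 : k) • t.redπ s hs M.obj v = t.redMapLin s hs (ρ_ M).hom
      (t.tensLin s hs M (𝟙_ _) (t.redπ s hs M.obj v ⊗ₜ
        ((1 : k) • t.redπ s hs (RMod.unit D.obj) (e k (1 : F)))))
    rw [one_smul, one_smul]
    have h₁ := t.tensLin_redπ s hs (N := 𝟙_ _) hv (D.isDeg_e (1 : F))
    refine Eq.trans ?_ (congrArg (t.redMapLin s hs (ρ_ M).hom) h₁).symm
    rw [map_smul, redMapLin_redπ, rightUnitor_locT, Subgroup.coe_one, mulE_one,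
      t.ψ_one_right]
    simp

/-- The monoidal structure of the reduction functor. -/
noncomputable def coreMonoidal : (t.redFunctor s hs).CoreMonoidal where
  εIso := t.unitIso s hs
  μIso := t.tensIso s hs
  μIso_hom_natural_left φ L := t.tens_natural_left s hs φ L
  μIso_hom_natural_right L φ := t.tens_natural_right s hs L φ
  associativity := t.tens_assoc s hs
  left_unitality := t.tens_leftUnitor s hs
  right_unitality := t.tens_rightUnitor s hs

/-- `corr g h` is ψ(ghg⁻¹, g)ψ(g, h)⁻¹, precisely the ratio of the tensorator factors before and
after the braiding, so the corrected action yields the braiding of the target. -/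
theorem tens_braiding (M N : LocMod D.obj) :
    (t.tensIso s hs M N).hom ≫ (t.redFunctor s hs).map (β_ M N).hom =
      (β_ ((t.redFunctor s hs).obj M) ((t.redFunctor s hs).obj N)).hom ≫
        (t.tensIso s hs N M).hom :=
  ZObj.hom_ext <| t.redV_ext₂ s hs fun g v hv h w hw => by
    change t.redMapLin s hs (β_ M N).hom (t.tensLin s hs M N
        (t.redπ s hs M.obj v ⊗ₜ t.redπ s hs N.obj w)) =
      t.tensLin s hs N M (ZObj.braidHom (t.redObj s hs M) (t.redObj s hs N)
        (t.redπ s hs M.obj v ⊗ₜ[k] t.redπ s hs N.obj w))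
    rw [ZObj.braidHom_tmul (t.isDeg_redπ s hs hv), t.act_redπ s hs hw,
      ← TensorProduct.smul_tmul', map_smul, t.tensLin_redπ s hs hv hw,
      t.tensLin_redπ s hs (hw.act g) hv, map_smul, redMapLin_redπ, braiding_locT hv,
      smul_smul, ← Units.val_mul]
    congr 2
    simp [corr, mul_comm]

/-- The reduction functor is braided. -/
noncomputable instance redFunctorBraided : (t.redFunctor s hs).Braided where
  toMonoidal := (t.coreMonoidal s hs).toMonoidal
  braided := t.tens_braiding s hs

theorem redFunctor_map_locTwist (M : LocMod D.obj) :
    (t.redFunctor s hs).map ((locTwist D).hom.app M) =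
      (ZObj.twist ω).hom.app ((t.redFunctor s hs).obj M) :=
  ZObj.hom_ext <| t.redV_ext s hs fun g v hv => by
    refine (t.redFunctor_map_redπ s hs _ v).trans ?_
    change t.redπ s hs M.obj (ZObj.twistLin M.obj.X v) =
      ZObj.twistLin (t.redObj s hs M) (t.redπ s hs M.obj v)
    change M.obj.X.V at v
    change M.obj.X.IsDeg g v at hv
    rw [ZObj.twistLin_apply hv, ZObj.twistLin_apply (t.isDeg_redπ s hs hv), t.act_redπ s hs hv,
      corr_self, Units.val_one, one_smul]

/-- Additivity and homogeneity in one equation between underlying linear maps; it holds because the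
functor acts by passing to the quotient. -/
theorem redFunctor_map_linear {M N : LocMod D.obj} {φ χ ξ : M ⟶ N} {c : k}
    (h : ξ.hom.hom.lin = c • φ.hom.hom.lin + χ.hom.hom.lin) :
    ((t.redFunctor s hs).map ξ).lin =
      c • ((t.redFunctor s hs).map φ).lin + ((t.redFunctor s hs).map χ).lin :=
  t.redV_ext s hs fun g v hv => by
    change t.redMapLin s hs ξ (t.redπ s hs M.obj v) =
      c • t.redMapLin s hs φ (t.redπ s hs M.obj v) + t.redMapLin s hs χ (t.redπ s hs M.obj v)
    rw [redMapLin_redπ, redMapLin_redπ, redMapLin_redπ, h, ← map_smul, ← map_add]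
    rfl

end Reduction

end Trivialization
end AlgData

/-! ### The equivalence of ribbon categories -/

theorem mainTheorem5 {k H : Type u} [Field k] [CharZero k] [Group H] [Fintype H]
    (α : Cocycle3 k H) (F : Subgroup H) [F.Normal] [Fintype (H ⧸ F)] (D : AlgData α F)
    (s : H ⧸ F → H) (hs : ∀ x, (s x : H ⧸ F) = x) (hs₁ : s 1 = 1) :
    ∃ ω : Cocycle3 k (H ⧸ F), (∀ x y z, ω x y z = D.reduced s hs x y z) ∧
      ∃ θ : 𝟭 (LocMod D.obj) ≅ 𝟭 (LocMod D.obj),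
        (∀ M : LocMod D.obj, (θ.hom.app M).hom.hom = (ZObj.twist α).hom.app M.obj.X) ∧
        IsRibbonTwist θ ∧ IsRibbonTwist (ZObj.twist ω) ∧
        ∃ e : LocMod D.obj ≌ ZObj ω,
          Nonempty e.functor.Braided ∧
          (∀ {M N : LocMod D.obj} (f g h : M ⟶ N) (c : k),
            h.hom.hom.lin = c • f.hom.hom.lin + g.hom.hom.lin →
            (e.functor.map h).lin = c • (e.functor.map f).lin + (e.functor.map g).lin) ∧
          ∀ M : LocMod D.obj,
            e.functor.map (θ.hom.app M) = (ZObj.twist ω).hom.app (e.functor.obj M) := by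
  let t := D.trivialization s hs hs₁
  refine ⟨D.deflated s hs hs₁, D.deflated_eq_reduced s hs hs₁, AlgData.locTwist D, fun _ => rfl,
    -- Duals over A need not be constructed: rigidity, balance and compatibility with duality are
    -- pulled back from Z(H/F, ω) along the reduction functor, which matches the twists.
    IsRibbonTwist.of_equivalence ZObj.isRibbonTwist_twist (t.redFunctor s hs)
      (t.redFunctor_map_locTwist s hs), ZObj.isRibbonTwist_twist,
    (t.redFunctor s hs).asEquivalence, ⟨t.redFunctorBraided s hs⟩,
    fun _ _ _ _ h => t.redFunctor_map_linear s hs h, t.redFunctor_map_locTwist s hs⟩
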